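/- **Setting.** Let $\Bbbk$ be a field of characteristic $0$ and $\mathcal C$ a skeletally small abelian monoidal category, enriched over finite-dimensional $\Bbbk$-vector spaces (with $\Bbbk$-bilinear tensor product), whose tensor unit $\mathbf 1$ is simple and absolutely simple ($\mathrm{End}(\mathbf 1)=\Bbbk\,\mathrm{id}$). Assume $\mathcal C$ is *sovereign*: it has a right duality $(X^\vee,\ b_X:\mathbf 1\to X\otimes X^\vee,\ d_X:X^\vee\otimes X\to\mathbf 1)$ and a left duality $(X^\vee,\ \tilde b_X:\mathbf 1\to X^\vee\otimes X,\ \tilde d_X:X\otimes X^\vee\to\mathbf 1)$ with the same dual objects, which coincide as contravariant monoidal functors (same dual morphisms, same canonical isomorphisms $(X\otimes Y)^\vee\cong Y^\vee\otimes X^\vee$). Associativity and unit constraints are suppressed below. A Frobenius algebra $(A,m,\eta,\Delta,\epsilon)$ (an algebra and coalgebra with $(\mathrm{id}\otimes m)(\Delta\otimes\mathrm{id})=\Delta m=(m\otimes\mathrm{id})(\mathrm{id}\otimes\Delta)$) is *special* if $m\Delta=\beta_A\mathrm{id}_A$ and $\epsilon\eta=\beta_{\mathbf 1}\mathrm{id}_{\mathbf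 1}$ with $\beta_A,\beta_{\mathbf 1}\in\Bbbk^\times$, and *symmetric* if $(\epsilon m\otimes\mathrm{id}_{A^\vee})(\mathrm{id}_A\otimes b_A)=(\mathrm{id}_{A^\vee}\otimes\epsilon m)(\tilde b_A\otimes\mathrm{id}_A)$ in $\mathrm{Hom}(A,A^\vee)$. $\mathrm{Aut}(A)$ is the group, under composition, of automorphisms of the object $A$ that are algebra and coalgebra morphisms. $\mathcal C_{A|A}$ denotes the monoidal category of $A$-bimodules under $\otimes_A$ (a coequalizer, with projections $r_{X,Y}:X\otimes Y\to X\otimes_AY$), and $\mathrm{Pic}(\mathcal C_{A|A})$ the group of isomorphism classes of invertible bimodules. Let $A$ be a symmetric special Frobenius algebra in $\mathcal C$ that is simple and absolutely simple as a bimodule over itself. For an $A$-bimodule $M$ the dualities of $\mathcal C_{A|A}$ have dual object $M^\vee$. With $\Delta'=\beta_A^{-1}\Delta$, their structure morphisms are as follows. The coevaluations $b^A_M:A\to M\otimes_AM^\vee$ and $\tilde b^A_M:A\to M^\vee\otimes_AM$ are obtained from $b_M$ and $\tilde b_M$ by letting $A$ act on $M$ from the left and from the right, respectively. The evaluations $d^A_M:M^\vee\otimes_AM\to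 A$ and $\tilde d^A_M:M\otimes_AM^\vee\to A$ are induced by $(d_M\otimes\mathrm{id}_A)(\mathrm{id}\otimes\varrho_M\otimes\mathrm{id})(\mathrm{id}\otimes\mathrm{id}\otimes\Delta'\eta)$ and $(\mathrm{id}_A\otimes\tilde d_M)(\mathrm{id}\otimes\rho_M\otimes\mathrm{id})(\Delta'\eta\otimes\mathrm{id}\otimes\mathrm{id})$, where $\rho_M,\varrho_M$ are the left and right actions. The left and right dimensions of $M$ in $\mathcal C_{A|A}$ are the scalars $c$ with $d^A_M\tilde b^A_M=c\,\mathrm{id}_A$, respectively $\tilde d^A_Mb^A_M=c\,\mathrm{id}_A$. Choose representatives $L_g$ of the classes $g\in\mathrm{Pic}(\mathcal C_{A|A})$, with $L_1\cong A$, and isomorphisms ${}_gb_h:L_g\otimes_AL_h\to L_{gh}$, with ${}_1b_h$ and ${}_gb_1$ the unit constraints. Let $\psi$ be the resulting normalised three-cocycle with values in $\Bbbk^\times$ describing the associator: $${}_{g_1g_2}b_{g_3}\circ({}_{g_1}b_{g_2}\otimes_A\mathrm{id})=\psi(g_1,g_2,g_3)\;{}_{g_1}b_{g_2g_3}\circ(\mathrm{id}\otimes_A{}_{g_2}b_{g_3}).$$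 A *trivialisation* of $\psi$ on a subgroup $H\le\mathrm{Pic}(\mathcal C_{A|A})$ is a normalised map $\omega:H\times H\to\Bbbk^\times$ ($\omega(1,h)=\omega(h,1)=1$) with $\mathrm d\omega=\psi|_H$, where $\mathrm d\omega(g,h,l)=\dfrac{\omega(h,l)\,\omega(g,hl)}{\omega(gh,l)\,\omega(g,h)}$. Let $H$ be *admissible*, that is, $H$ is finite, every $L_h$ ($h\in H$) has left and right dimension $1$ in $\mathcal C_{A|A}$, and $\psi$ has a trivialisation on $H$. For a trivialisation $\omega$, let $Q(H,\omega)$ be the algebra $Q=\bigoplus_{h\in H}L_h$ in $\mathcal C_{A|A}$, with inclusions $e_h$ and projections $r_h$, product $m_Q=\sum_{g,h\in H}\omega(g,h)\,e_{gh}\circ{}_gb_h\circ(r_g\otimes_Ar_h)$ and unit $e_1$. Let $\dot Q(H,\omega)$ be the algebra in $\mathcal C$ with the same underlying object, product $m_Q\circ r_{Q,Q}$ and unit $e_1\circ\eta$. **Theorem.** There exist a symmetric special Frobenius algebra $A'$ in $\mathcal C$ and a Morita context between $A$ and $A'$ (an $A$-$A'$-bimodule $P$ and an $A'$-$A$-bimodule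 $P'$ with bimodule isomorphisms $P\otimes_{A'}P'\cong A$ and $P'\otimes_AP\cong A'$ making the two standard compatibility diagrams commute), and for each trivialisation $\omega$ of $\psi$ on $H$ a group homomorphism $\alpha_\omega:H\to\mathrm{Aut}(A')$, such that: (i) each $\alpha_\omega$ is injective and $\Pi_{P,P'}\circ\Psi_{A'}\circ\alpha_\omega=\mathrm{id}_H$, where $\Psi_{A'}(\gamma)=[{}_{\mathrm{id}}A'_\gamma]$ is the class of $A'$ with right action twisted by $\gamma$, and $\Pi_{P,P'}[X]=[P\otimes_{A'}X\otimes_{A'}P']$; moreover, the assignment $\omega\mapsto\alpha_\omega$ is injective; (ii) for each $\omega$, the fixed algebra of $\mathrm{im}(\alpha_\omega)$ exists and is isomorphic, as an algebra, to $\dot Q(H,\omega)$. Here the fixed algebra is the universal monomorphism $j:F\to A'$ with $\gamma\circ j=j$ for all $\gamma\in\mathrm{im}(\alpha_\omega)$, where $F$ carries the algebra structure for which $j$ is an algebra morphism. -/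

import Mathlib

open CategoryTheory CategoryTheory.MonoidalCategory CategoryTheory.Limits
open scoped MonObj ComonObj

universe v u w

noncomputable section

namespace RosenbergZelinsky

/-! ## Sovereign monoidal categories -/

section Sovereign

variable {C : Type u} [Category.{v} C] [MonoidalCategory C]

/-- The dual morphism `f^∨ : Y' ⟶ X'` of `f : X ⟶ Y`, formed with right duals `X'` of `X` and `Y'`
of `Y`. -/
def rightMate {X X' Y Y' : C} (p : ExactPairing X X') (q : ExactPairing Y Y') (f : X ⟶ Y) :
    Y' ⟶ X' :=
  letI : HasRightDual X := ⟨X'⟩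
  letI : HasRightDual Y := ⟨Y'⟩
  rightAdjointMate f

/-- The dual morphism `^∨f : Y' ⟶ X'` of `f : X ⟶ Y`, formed with left duals `X'` of `X` and `Y'`
of `Y`. -/
def leftMate {X X' Y Y' : C} (p : ExactPairing X' X) (q : ExactPairing Y' Y) (f : X ⟶ Y) :
    Y' ⟶ X' :=
  letI : HasLeftDual X := ⟨X'⟩
  letI : HasLeftDual Y := ⟨Y'⟩
  leftAdjointMate f

variable (C) in
/-- A sovereign structure: a right duality and a left duality with the same dual objects, which
coincide as (contravariant) monoidal functors: dual morphisms are the same for both dualities, and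
so are the canonical isomorphisms `(X ⊗ Y)^∨ ≅ Y^∨ ⊗ X^∨`. -/
class Sovereign where
  /-- The common (right and left) dual object. -/
  dual : C → C
  /-- The right duality. -/
  rightPairing (X : C) : ExactPairing X (dual X)
  /-- The left duality. -/
  leftPairing (X : C) : ExactPairing (dual X) X
  rightMate_eq_leftMate {X Y : C} (f : X ⟶ Y) :
    rightMate (rightPairing X) (rightPairing Y) f = leftMate (leftPairing X) (leftPairing Y) f
  rightMate_tensor_eq_leftMate_tensor (X Y : C) :
    rightMate (@ExactPairing.tensor C _ _ X Y (dual X) (dual Y) (rightPairing X) (rightPairing Y))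
        (rightPairing (X ⊗ Y)) (𝟙 (X ⊗ Y)) =
      leftMate (@ExactPairing.tensor C _ _ (dual Y) (dual X) Y X (leftPairing Y) (leftPairing X))
        (leftPairing (X ⊗ Y)) (𝟙 (X ⊗ Y))

variable [Sovereign C]

/-- The dual object `X^∨`. -/
abbrev dual (X : C) : C := Sovereign.dual X

/-- The coevaluation `b_X : 1 ⟶ X ⊗ X^∨` of the right duality. -/
def coevR (X : C) : 𝟙_ C ⟶ X ⊗ dual X := (Sovereign.rightPairing X).coevaluation'

/-- The evaluation `d_X : X^∨ ⊗ X ⟶ 1` of the right duality. -/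
def evR (X : C) : dual X ⊗ X ⟶ 𝟙_ C := (Sovereign.rightPairing X).evaluation'

/-- The coevaluation `b̃_X : 1 ⟶ X^∨ ⊗ X` of the left duality. -/
def coevL (X : C) : 𝟙_ C ⟶ dual X ⊗ X := (Sovereign.leftPairing X).coevaluation'

/-- The evaluation `d̃_X : X ⊗ X^∨ ⟶ 1` of the left duality. -/
def evL (X : C) : X ⊗ dual X ⟶ 𝟙_ C := (Sovereign.leftPairing X).evaluation'

theorem coevR_evR_dual (X : C) : dual X ◁ coevR X ⊗≫ evR X ▷ dual X = ⊗𝟙.hom :=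
  @ExactPairing.coevaluation_evaluation'' C _ _ X (dual X) (Sovereign.rightPairing X)

theorem coevR_evR (X : C) : coevR X ▷ X ⊗≫ X ◁ evR X = ⊗𝟙.hom :=
  @ExactPairing.evaluation_coevaluation'' C _ _ X (dual X) (Sovereign.rightPairing X)

theorem coevL_evL (X : C) : X ◁ coevL X ⊗≫ evL X ▷ X = ⊗𝟙.hom :=
  @ExactPairing.coevaluation_evaluation'' C _ _ (dual X) X (Sovereign.leftPairing X)

theorem coevL_evL_dual (X : C) : coevL X ▷ dual X ⊗≫ dual X ◁ evL X = ⊗𝟙.hom :=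
  @ExactPairing.evaluation_coevaluation'' C _ _ (dual X) X (Sovereign.leftPairing X)

instance preservesColimits_tensorLeft (X : C) :
    PreservesColimitsOfSize.{0, 0} (tensorLeft X) :=
  letI := Sovereign.leftPairing X
  (tensorLeftAdjunction (dual X) X).leftAdjoint_preservesColimits

instance preservesColimits_tensorRight (X : C) :
    PreservesColimitsOfSize.{0, 0} (tensorRight X) :=
  letI := Sovereign.rightPairing X
  (tensorRightAdjunction X (dual X)).leftAdjoint_preservesColimits

end Sovereign

/-! ## Frobenius algebras -/

section Frobenius

variable (C : Type u) [Category.{v} C] [MonoidalCategory C]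

/-- A Frobenius algebra: an algebra and coalgebra on the same object, such that the coproduct is a
morphism of bimodules. -/
structure Frobenius where
  /-- The underlying algebra. -/
  alg : Mon C
  /-- The coalgebra structure. -/
  [comon : ComonObj alg.X]
  left_frobenius :
    Δ[alg.X] ▷ alg.X ≫ (α_ _ _ _).hom ≫ alg.X ◁ μ[alg.X] = μ[alg.X] ≫ Δ[alg.X]
  right_frobenius :
    alg.X ◁ Δ[alg.X] ≫ (α_ _ _ _).inv ≫ μ[alg.X] ▷ alg.X = μ[alg.X] ≫ Δ[alg.X]

attribute [instance] Frobenius.comon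

variable {C}

namespace Frobenius

variable (A : Frobenius C)

/-- `m ∘ Δ = β_A id_A` and `ε ∘ η = β_1 id_1` with `β_A`, `β_1` nonzero scalars. -/
structure IsSpecialWith {k : Type w} [Field k] [Preadditive C] [Linear k C] (βA β1 : k) :
    Prop where
  betaA_ne_zero : βA ≠ 0
  beta1_ne_zero : β1 ≠ 0
  comul_mul : Δ[A.alg.X] ≫ μ[A.alg.X] = βA • 𝟙 A.alg.X
  one_counit : η[A.alg.X] ≫ ε[A.alg.X] = β1 • 𝟙 (𝟙_ C)

/-- The Frobenius algebra `A` is special. -/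
def IsSpecial (k : Type w) [Field k] [Preadditive C] [Linear k C] : Prop :=
  ∃ βA β1 : k, A.IsSpecialWith βA β1

/-- The morphism `Φ₁ = ((ε ∘ m) ⊗ id) ∘ (id ⊗ b_A) : A ⟶ A^∨`. -/
def Phi1 [Sovereign C] : A.alg.X ⟶ dual A.alg.X :=
  (ρ_ _).inv ≫ A.alg.X ◁ coevR A.alg.X ≫ (α_ _ _ _).inv ≫
    (μ[A.alg.X] ≫ ε[A.alg.X]) ▷ dual A.alg.X ≫ (λ_ _).hom

/-- The morphism `Φ₂ = (id ⊗ (ε ∘ m)) ∘ (b̃_A ⊗ id) : A ⟶ A^∨`. -/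
def Phi2 [Sovereign C] : A.alg.X ⟶ dual A.alg.X :=
  (λ_ _).inv ≫ coevL A.alg.X ▷ A.alg.X ≫ (α_ _ _ _).hom ≫
    dual A.alg.X ◁ (μ[A.alg.X] ≫ ε[A.alg.X]) ≫ (ρ_ _).hom

/-- The Frobenius algebra `A` is symmetric. -/
def IsSymmetric [Sovereign C] : Prop := A.Phi1 = A.Phi2

/-- The group `Aut(A)` of automorphisms of the Frobenius algebra `A`, that is, of the automorphisms
of the object `A` that are algebra and coalgebra morphisms. The product is composition:
`(f * g).hom = g.hom ≫ f.hom`. -/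
def autGroup : Subgroup (Aut A.alg.X) where
  carrier := {f | IsMonHom f.hom ∧ IsComonHom f.hom}
  one_mem' := ⟨inferInstanceAs (IsMonHom (𝟙 _)), inferInstanceAs (IsComonHom (𝟙 _))⟩
  mul_mem' := by
    rintro f g ⟨_, _⟩ ⟨_, _⟩
    exact ⟨inferInstanceAs (IsMonHom (g.hom ≫ f.hom)),
      inferInstanceAs (IsComonHom (g.hom ≫ f.hom))⟩
  inv_mem' := by
    intro f hf
    have key : ∀ g : A.alg.X ≅ A.alg.X, IsMonHom g.hom → IsComonHom g.hom →
        IsMonHom g.inv ∧ IsComonHom g.inv := fun g _ _ => ⟨inferInstance, inferInstance⟩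
    exact key f hf.1 hf.2

end Frobenius

end Frobenius

/-! ## The monoidal category of bimodules -/

section BimodMonoidal

variable {C : Type u} [Category.{v} C] [MonoidalCategory C] [HasCoequalizers C]
  [∀ X : C, PreservesColimitsOfSize.{0, 0} (tensorLeft X)]
  [∀ X : C, PreservesColimitsOfSize.{0, 0} (tensorRight X)]

/-- The monoidal category `C_{A|A}` of `A`-bimodules, with tensor product over `A`. -/
instance bimodMonoidal (A : Mon C) : MonoidalCategory (Bimod A A) where
  tensorObj M N := M.tensorBimod N
  whiskerLeft M _ _ f := Bimod.whiskerLeft M f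
  whiskerRight f N := Bimod.whiskerRight f N
  tensorUnit := Bimod.regular A
  associator := Bimod.associatorBimod
  leftUnitor := Bimod.leftUnitorBimod
  rightUnitor := Bimod.rightUnitorBimod
  tensorHom_comp_tensorHom f₁ f₂ g₁ g₂ := by
    dsimp only
    rw [Bimod.comp_whiskerRight_bimod, Bimod.whiskerLeft_comp_bimod, Category.assoc,
      Category.assoc, ← Category.assoc (Bimod.whiskerLeft _ f₂), Bimod.whisker_exchange_bimod,
      Category.assoc]
  id_tensorHom_id M N := by
    dsimp only
    rw [Bimod.id_whiskerRight_bimod, Bimod.whiskerLeft_id_bimod]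
    exact Category.comp_id _
  whiskerLeft_id _ _ := Bimod.whiskerLeft_id_bimod
  id_whiskerRight _ _ := Bimod.id_whiskerRight_bimod
  associator_naturality f₁ f₂ f₃ := by
    let := Bimod.monBicategory (C := C)
    exact MonoidalCategory.associator_naturality (C := EndMonoidal (A : Mon C)) f₁ f₂ f₃
  leftUnitor_naturality f := by
    rw [Bimod.id_whiskerLeft_bimod]; simp
  rightUnitor_naturality f := by
    rw [Bimod.whiskerRight_id_bimod]; simp
  pentagon := Bimod.pentagon_bimod
  triangle := Bimod.triangle_bimod

/-- The projection `r_{M,N} : M ⊗ N ⟶ M ⊗_B N` onto the tensor product over `B`. -/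
def tensorProj {A B D : Mon C} (M : Bimod A B) (N : Bimod B D) :
    M.X ⊗ N.X ⟶ (M.tensorBimod N).X :=
  coequalizer.π _ _

end BimodMonoidal

/-! ## Linear structure and direct sums of bimodules -/

section BimodLinear

variable {C : Type u} [Category.{v} C] [MonoidalCategory C] [Preadditive C]
  [MonoidalPreadditive C] {A B : Mon C}

section

variable (M N : Bimod A B)

instance : Zero (M ⟶ N) := ⟨{ hom := 0 }⟩

instance : Add (M ⟶ N) := ⟨fun f g => { hom := f.hom + g.hom }⟩

instance : Neg (M ⟶ N) := ⟨fun f =>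
  { hom := -f.hom
    left_act_hom := by
      rw [Preadditive.comp_neg, f.left_act_hom]
      have h : A.X ◁ (-f.hom) = -(A.X ◁ f.hom) :=
        Functor.map_neg (tensorLeft A.X) (f := f.hom)
      rw [h, Preadditive.neg_comp]
    right_act_hom := by
      rw [Preadditive.comp_neg, f.right_act_hom]
      have h : (-f.hom) ▷ B.X = -(f.hom ▷ B.X) :=
        Functor.map_neg (tensorRight B.X) (f := f.hom)
      rw [h, Preadditive.neg_comp] }⟩

instance : AddCommGroup (M ⟶ N) where
  add_assoc f g h := Bimod.hom_ext _ _ (add_assoc f.hom g.hom h.hom)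
  zero_add f := Bimod.hom_ext _ _ (zero_add f.hom)
  add_zero f := Bimod.hom_ext _ _ (add_zero f.hom)
  nsmul := nsmulRec
  zsmul := zsmulRec
  neg_add_cancel f := Bimod.hom_ext _ _ (neg_add_cancel f.hom)
  add_comm f g := Bimod.hom_ext _ _ (add_comm f.hom g.hom)

end

@[simp] theorem bimod_zero_hom (M N : Bimod A B) : (0 : M ⟶ N).hom = 0 := rfl

@[simp] theorem bimod_add_hom {M N : Bimod A B} (f g : M ⟶ N) :
    (f + g).hom = f.hom + g.hom := rfl

instance bimodPreadditive : Preadditive (Bimod A B) where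
  add_comp _ _ _ f f' g := Bimod.hom_ext _ _ (by simp)
  comp_add _ _ _ f g g' := Bimod.hom_ext _ _ (by simp)

variable {k : Type w} [Field k] [Linear k C] [MonoidalLinear k C]

instance (M N : Bimod A B) : SMul k (M ⟶ N) := ⟨fun c f => { hom := c • f.hom }⟩

@[simp] theorem bimod_smul_hom {M N : Bimod A B} (c : k) (f : M ⟶ N) :
    (c • f).hom = c • f.hom := rfl

instance (M N : Bimod A B) : Module k (M ⟶ N) where
  one_smul f := Bimod.hom_ext _ _ (one_smul k f.hom)
  mul_smul c d f := Bimod.hom_ext _ _ (mul_smul c d f.hom)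
  smul_zero c := Bimod.hom_ext _ _ (smul_zero (A := M.X ⟶ N.X) c)
  smul_add c f g := Bimod.hom_ext _ _ (smul_add c f.hom g.hom)
  add_smul c d f := Bimod.hom_ext _ _ (add_smul c d f.hom)
  zero_smul f := Bimod.hom_ext _ _ (zero_smul k f.hom)

instance bimodLinear : Linear k (Bimod A B) where
  smul_comp _ _ _ c f g := Bimod.hom_ext _ _ (by simp)
  comp_smul _ _ _ f c g := Bimod.hom_ext _ _ (by simp)

/-- The direct sum of bimodules, with componentwise actions. -/
def bimodSum {J : Type*} (M : J → Bimod A B) [HasBiproduct fun j => (M j).X] :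
    Bimod A B where
  X := ⨁ fun j => (M j).X
  actLeft := biproduct.lift fun j => A.X ◁ biproduct.π (fun j => (M j).X) j ≫ (M j).actLeft
  actRight := biproduct.lift fun j => biproduct.π (fun j => (M j).X) j ▷ B.X ≫ (M j).actRight
  one_actLeft := by
    ext j
    simp only [Category.assoc, biproduct.lift_π]
    rw [← whisker_exchange_assoc, Bimod.one_actLeft, leftUnitor_naturality]
  left_assoc := by
    ext j
    simp only [Category.assoc, biproduct.lift_π]
    rw [← whisker_exchange_assoc, Bimod.left_assoc, ← whiskerLeft_comp_assoc, biproduct.lift_π]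
    simp
  actRight_one := by
    ext j
    simp only [Category.assoc, biproduct.lift_π]
    rw [whisker_exchange_assoc, Bimod.actRight_one, rightUnitor_naturality]
  right_assoc := by
    ext j
    simp only [Category.assoc, biproduct.lift_π]
    rw [whisker_exchange_assoc, Bimod.right_assoc, ← comp_whiskerRight_assoc, biproduct.lift_π]
    simp
  middle_assoc := by
    ext j
    simp only [Category.assoc, biproduct.lift_π]
    rw [← comp_whiskerRight_assoc, biproduct.lift_π, ← whiskerLeft_comp_assoc, biproduct.lift_π]
    simp

/-- The inclusion of a summand. -/
def bimodSumι {J : Type*} (M : J → Bimod A B) [HasBiproduct fun j => (M j).X] (j : J) :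
    M j ⟶ bimodSum M where
  hom := biproduct.ι (fun j => (M j).X) j
  left_act_hom := by
    classical
    dsimp only [bimodSum]
    ext i
    simp only [Category.assoc, biproduct.lift_π]
    rw [← whiskerLeft_comp_assoc]
    by_cases h : j = i
    · subst h; simp
    · simp [h]
  right_act_hom := by
    classical
    dsimp only [bimodSum]
    ext i
    simp only [Category.assoc, biproduct.lift_π]
    rw [← comp_whiskerRight_assoc]
    by_cases h : j = i
    · subst h; simp
    · simp [h]

/-- The projection onto a summand. -/
def bimodSumπ {J : Type*} (M : J → Bimod A B) [HasBiproduct fun j => (M j).X] (j : J) :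
    bimodSum M ⟶ M j where
  hom := biproduct.π (fun j => (M j).X) j
  left_act_hom := by simp [bimodSum]
  right_act_hom := by simp [bimodSum]

@[simp] theorem bimod_sum_hom {M N : Bimod A B} {J : Type*} (s : Finset J) (f : J → (M ⟶ N)) :
    (∑ j ∈ s, f j).hom = ∑ j ∈ s, (f j).hom :=
  map_sum (AddMonoidHom.mk' (fun g : M ⟶ N => g.hom) fun _ _ => rfl) f s

/-- Bimodules have finite direct sums. -/
instance bimodHasFiniteBiproducts [HasFiniteProducts C] :
    HasFiniteBiproducts (Bimod A B) := by
  classical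
  have : HasFiniteBiproducts C := HasFiniteBiproducts.of_hasFiniteProducts
  refine ⟨fun n => ⟨fun M => ?_⟩⟩
  have hι : ∀ i j, bimodSumι M i ≫ bimodSumπ M j = if h : i = j then eqToHom (by rw [h]) else 0 := by
    intro i j
    apply Bimod.hom_ext
    by_cases h : i = j
    · subst h
      rw [dif_pos rfl]; exact biproduct.ι_π_self (fun j => (M j).X) i
    · rw [dif_neg h]; exact biproduct.ι_π_ne (fun j => (M j).X) h
  refine hasBiproduct_of_total
    ⟨bimodSum M, bimodSumπ M, bimodSumι M, fun i j => (hι i j).trans (by congr)⟩ ?_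
  apply Bimod.hom_ext
  rw [bimod_sum_hom]
  exact biproduct.total (f := fun j => (M j).X)

end BimodLinear

/-! ## Duals and dimensions of bimodules -/

section Dimension

variable {C : Type u} [Category.{v} C] [MonoidalCategory C] [Sovereign C] {A : Mon C}

/-- The right action of `A` on the dual `M^∨` of an `A`-bimodule:
`(d ⊗ id) ∘ (id ⊗ ρ_M ⊗ id) ∘ (id ⊗ id ⊗ b) : M^∨ ⊗ A ⟶ M^∨`. -/
def dualActRight (M : Bimod A A) : dual M.X ⊗ A.X ⟶ dual M.X :=
  𝟙 _ ⊗≫ (dual M.X ⊗ A.X) ◁ coevR M.X ⊗≫ dual M.X ◁ M.actLeft ▷ dual M.X ⊗≫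
    evR M.X ▷ dual M.X ⊗≫ 𝟙 _

/-- The left action of `A` on the dual `M^∨` of an `A`-bimodule:
`(id ⊗ d̃) ∘ (id ⊗ ϱ_M ⊗ id) ∘ (b̃ ⊗ id ⊗ id) : A ⊗ M^∨ ⟶ M^∨`. -/
def dualActLeft (M : Bimod A A) : A.X ⊗ dual M.X ⟶ dual M.X :=
  𝟙 _ ⊗≫ coevL M.X ▷ (A.X ⊗ dual M.X) ⊗≫ dual M.X ◁ M.actRight ▷ dual M.X ⊗≫
    dual M.X ◁ evL M.X ⊗≫ 𝟙 _

theorem dualActRight_evR (M : Bimod A A) :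
    dualActRight M ▷ M.X ≫ evR M.X = (α_ _ _ _).hom ≫ dual M.X ◁ M.actLeft ≫ evR M.X := by
  calc
    _ = 𝟙 _ ⊗≫ (dual M.X ⊗ A.X) ◁ coevR M.X ▷ M.X ⊗≫
        dual M.X ◁ M.actLeft ▷ dual M.X ▷ M.X ⊗≫
        (evR M.X ▷ (dual M.X ⊗ M.X) ≫ 𝟙_ C ◁ evR M.X) ⊗≫ 𝟙 _ := by
      dsimp only [dualActRight]; monoidal
    _ = 𝟙 _ ⊗≫ (dual M.X ⊗ A.X) ◁ coevR M.X ▷ M.X ⊗≫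
        dual M.X ◁ (M.actLeft ▷ (dual M.X ⊗ M.X) ≫ M.X ◁ evR M.X) ⊗≫
        evR M.X ⊗≫ 𝟙 _ := by
      rw [← whisker_exchange]; monoidal
    _ = 𝟙 _ ⊗≫ (dual M.X ⊗ A.X) ◁ (coevR M.X ▷ M.X ⊗≫ M.X ◁ evR M.X) ⊗≫
        dual M.X ◁ M.actLeft ⊗≫ evR M.X ⊗≫ 𝟙 _ := by
      rw [← whisker_exchange]; monoidal
    _ = _ := by
      rw [coevR_evR]; monoidal

theorem dualActLeft_evL (M : Bimod A A) :
    M.X ◁ dualActLeft M ≫ evL M.X = (α_ _ _ _).inv ≫ M.actRight ▷ dual M.X ≫ evL M.X := by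
  calc
    _ = 𝟙 _ ⊗≫ M.X ◁ coevL M.X ▷ (A.X ⊗ dual M.X) ⊗≫
        M.X ◁ dual M.X ◁ M.actRight ▷ dual M.X ⊗≫
        ((M.X ⊗ dual M.X) ◁ evL M.X ≫ evL M.X ▷ 𝟙_ C) ⊗≫ 𝟙 _ := by
      dsimp only [dualActLeft]; monoidal
    _ = 𝟙 _ ⊗≫ M.X ◁ coevL M.X ▷ (A.X ⊗ dual M.X) ⊗≫
        ((M.X ⊗ dual M.X) ◁ M.actRight ≫ evL M.X ▷ M.X) ▷ dual M.X ⊗≫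
        evL M.X ⊗≫ 𝟙 _ := by
      rw [whisker_exchange]; monoidal
    _ = 𝟙 _ ⊗≫ (M.X ◁ coevL M.X ⊗≫ evL M.X ▷ M.X) ▷ (A.X ⊗ dual M.X) ⊗≫
        M.actRight ▷ dual M.X ⊗≫ evL M.X ⊗≫ 𝟙 _ := by
      rw [whisker_exchange]; monoidal
    _ = _ := by
      rw [coevL_evL]; monoidal

section Pre

variable [ComonObj A.X]

/-- The morphism `(d_M ⊗ id) ∘ (id ⊗ ϱ_M ⊗ id) ∘ (id ⊗ id ⊗ (Δ ∘ η)) : M^∨ ⊗ M ⟶ A`. -/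
def preBimodEvR (M : Bimod A A) : dual M.X ⊗ M.X ⟶ A.X :=
  𝟙 _ ⊗≫ (dual M.X ⊗ M.X) ◁ (η[A.X] ≫ Δ[A.X]) ⊗≫ dual M.X ◁ M.actRight ▷ A.X ⊗≫
    evR M.X ▷ A.X ⊗≫ 𝟙 _

/-- The morphism `(id ⊗ d̃_M) ∘ (id ⊗ ρ_M ⊗ id) ∘ ((Δ ∘ η) ⊗ id ⊗ id) : M ⊗ M^∨ ⟶ A`. -/
def preBimodEvL (M : Bimod A A) : M.X ⊗ dual M.X ⟶ A.X :=
  𝟙 _ ⊗≫ (η[A.X] ≫ Δ[A.X]) ▷ (M.X ⊗ dual M.X) ⊗≫ A.X ◁ M.actLeft ▷ dual M.X ⊗≫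
    A.X ◁ evL M.X ⊗≫ 𝟙 _

theorem preBimodEvR_balanced (M : Bimod A A) :
    dualActRight M ▷ M.X ≫ preBimodEvR M =
      ((α_ _ _ _).hom ≫ dual M.X ◁ M.actLeft) ≫ preBimodEvR M := by
  set e := η[A.X] ≫ Δ[A.X] with he
  calc
    _ = 𝟙 _ ⊗≫ (dualActRight M ▷ (M.X ⊗ 𝟙_ C) ≫ dual M.X ◁ (M.X ◁ e)) ⊗≫
        dual M.X ◁ M.actRight ▷ A.X ⊗≫ evR M.X ▷ A.X ⊗≫ 𝟙 _ := by
      dsimp only [preBimodEvR]; monoidal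
    _ = 𝟙 _ ⊗≫ (dual M.X ⊗ A.X) ◁ M.X ◁ e ⊗≫
        (dualActRight M ▷ (M.X ⊗ A.X) ≫ dual M.X ◁ M.actRight) ▷ A.X ⊗≫
        evR M.X ▷ A.X ⊗≫ 𝟙 _ := by
      rw [← whisker_exchange]; monoidal
    _ = 𝟙 _ ⊗≫ (dual M.X ⊗ A.X) ◁ M.X ◁ e ⊗≫
        ((dual M.X ⊗ A.X) ◁ M.actRight) ▷ A.X ⊗≫
        (dualActRight M ▷ M.X ≫ evR M.X) ▷ A.X ⊗≫ 𝟙 _ := by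
      rw [← whisker_exchange]; monoidal
    _ = 𝟙 _ ⊗≫ (dual M.X ⊗ A.X) ◁ M.X ◁ e ⊗≫
        dual M.X ◁ ((α_ _ _ _).hom ≫ A.X ◁ M.actRight ≫ M.actLeft) ▷ A.X ⊗≫
        evR M.X ▷ A.X ⊗≫ 𝟙 _ := by
      rw [dualActRight_evR]; monoidal
    _ = 𝟙 _ ⊗≫ dual M.X ◁ ((A.X ⊗ M.X) ◁ e ≫ M.actLeft ▷ (A.X ⊗ A.X)) ⊗≫
        dual M.X ◁ M.actRight ▷ A.X ⊗≫ evR M.X ▷ A.X ⊗≫ 𝟙 _ := by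
      rw [← Bimod.middle_assoc]; monoidal
    _ = _ := by
      rw [whisker_exchange]; dsimp only [preBimodEvR]; monoidal

theorem preBimodEvL_balanced (M : Bimod A A) :
    M.actRight ▷ dual M.X ≫ preBimodEvL M =
      ((α_ _ _ _).hom ≫ M.X ◁ dualActLeft M) ≫ preBimodEvL M := by
  set e := η[A.X] ≫ Δ[A.X] with he
  symm
  calc
    _ = 𝟙 _ ⊗≫ ((𝟙_ C ⊗ M.X) ◁ dualActLeft M ≫ (e ▷ M.X) ▷ dual M.X) ⊗≫
        A.X ◁ M.actLeft ▷ dual M.X ⊗≫ A.X ◁ evL M.X ⊗≫ 𝟙 _ := by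
      dsimp only [preBimodEvL]; monoidal
    _ = 𝟙 _ ⊗≫ e ▷ M.X ▷ (A.X ⊗ dual M.X) ⊗≫
        A.X ◁ ((A.X ⊗ M.X) ◁ dualActLeft M ≫ M.actLeft ▷ dual M.X) ⊗≫
        A.X ◁ evL M.X ⊗≫ 𝟙 _ := by
      rw [whisker_exchange]; monoidal
    _ = 𝟙 _ ⊗≫ e ▷ M.X ▷ (A.X ⊗ dual M.X) ⊗≫
        A.X ◁ (M.actLeft ▷ (A.X ⊗ dual M.X)) ⊗≫
        A.X ◁ (M.X ◁ dualActLeft M ≫ evL M.X) ⊗≫ 𝟙 _ := by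
      rw [whisker_exchange]; monoidal
    _ = 𝟙 _ ⊗≫ e ▷ M.X ▷ (A.X ⊗ dual M.X) ⊗≫
        A.X ◁ (M.actLeft ▷ A.X ≫ M.actRight) ▷ dual M.X ⊗≫
        A.X ◁ evL M.X ⊗≫ 𝟙 _ := by
      rw [dualActLeft_evL]; monoidal
    _ = 𝟙 _ ⊗≫ (e ▷ (M.X ⊗ A.X) ≫ (A.X ⊗ A.X) ◁ M.actRight) ▷ dual M.X ⊗≫
        A.X ◁ M.actLeft ▷ dual M.X ⊗≫ A.X ◁ evL M.X ⊗≫ 𝟙 _ := by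
      rw [Bimod.middle_assoc]; monoidal
    _ = _ := by
      rw [← whisker_exchange]; dsimp only [preBimodEvL]; monoidal

end Pre

variable [HasCoequalizers C]

/-- The object `M^∨ ⊗_A M`. -/
def dualTensor (M : Bimod A A) : C :=
  coequalizer (dualActRight M ▷ M.X) ((α_ _ _ _).hom ≫ dual M.X ◁ M.actLeft)

/-- The object `M ⊗_A M^∨`. -/
def tensorDual (M : Bimod A A) : C :=
  coequalizer (M.actRight ▷ dual M.X) ((α_ _ _ _).hom ≫ M.X ◁ dualActLeft M)

/-- The coevaluation `b̃^A_M : A ⟶ M^∨ ⊗_A M` of the left duality of `C_{A|A}`, induced by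
`a ↦ b̃_M · a`. -/
def bimodCoevL (M : Bimod A A) : A.X ⟶ dualTensor M :=
  (𝟙 _ ⊗≫ coevL M.X ▷ A.X ⊗≫ dual M.X ◁ M.actRight) ≫ coequalizer.π _ _

/-- The coevaluation `b^A_M : A ⟶ M ⊗_A M^∨` of the right duality of `C_{A|A}`, induced by
`a ↦ a · b_M`. -/
def bimodCoevR (M : Bimod A A) : A.X ⟶ tensorDual M :=
  (𝟙 _ ⊗≫ A.X ◁ coevR M.X ⊗≫ M.actLeft ▷ dual M.X) ≫ coequalizer.π _ _

variable [ComonObj A.X]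

/-- For a special Frobenius algebra `A` with `m ∘ Δ = β id`, the evaluation
`d^A_M : M^∨ ⊗_A M ⟶ A` of the right duality of `C_{A|A}`. The factor `β⁻¹` replaces the coproduct
by the normalised one, `β⁻¹ Δ`. -/
def bimodEvR {k : Type w} [Field k] [Preadditive C] [Linear k C] (β : k) (M : Bimod A A) :
    dualTensor M ⟶ A.X :=
  β⁻¹ • coequalizer.desc (preBimodEvR M) (preBimodEvR_balanced M)

/-- For a special Frobenius algebra `A` with `m ∘ Δ = β id`, the evaluation
`d̃^A_M : M ⊗_A M^∨ ⟶ A` of the left duality of `C_{A|A}`. The factor `β⁻¹` replaces the coproduct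
by the normalised one, `β⁻¹ Δ`. -/
def bimodEvL {k : Type w} [Field k] [Preadditive C] [Linear k C] (β : k) (M : Bimod A A) :
    tensorDual M ⟶ A.X :=
  β⁻¹ • coequalizer.desc (preBimodEvL M) (preBimodEvL_balanced M)

/-- The left dimension of the bimodule `M` as an object of `C_{A|A}` is `c`, that is,
`d^A_M ∘ b̃^A_M = c id_A`. -/
def HasLeftDim {k : Type w} [Field k] [Preadditive C] [Linear k C] (β : k) (M : Bimod A A)
    (c : k) : Prop :=
  bimodCoevL M ≫ bimodEvR β M = c • 𝟙 A.X

/-- The right dimension of the bimodule `M` as an object of `C_{A|A}` is `c`, that is,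
`d̃^A_M ∘ b^A_M = c id_A`. -/
def HasRightDim {k : Type w} [Field k] [Preadditive C] [Linear k C] (β : k) (M : Bimod A A)
    (c : k) : Prop :=
  bimodCoevR M ≫ bimodEvL β M = c • 𝟙 A.X

end Dimension

/-! ## Morita contexts and twisted bimodules -/

section Morita

variable {C : Type u} [Category.{v} C] [MonoidalCategory C]

/-- The bimodule `_id A_α`: the algebra `A` with left action the product and right action twisted by
the algebra automorphism `α`, `ϱ_α = m ∘ (id ⊗ α)`. -/
def twistedBimod (A : Mon C) (α : A.X ⟶ A.X) [IsMonHom α] : Bimod A A where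
  X := A.X
  actLeft := μ[A.X]
  actRight := A.X ◁ α ≫ μ[A.X]
  actRight_one := by
    rw [← whiskerLeft_comp_assoc, IsMonHom.one_hom, MonObj.mul_one]
  right_assoc := by
    rw [← whiskerLeft_comp_assoc, IsMonHom.mul_hom, comp_whiskerRight, Category.assoc,
      ← whisker_exchange_assoc, MonObj.mul_assoc]
    simp [MonoidalCategory.tensorHom_def]
  middle_assoc := by
    simp [← whisker_exchange_assoc]

variable [HasCoequalizers C]
  [∀ X : C, PreservesColimitsOfSize.{0, 0} (tensorLeft X)]
  [∀ X : C, PreservesColimitsOfSize.{0, 0} (tensorRight X)]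

/-- A Morita context `(A, B, P, P', f, g)`. -/
structure MoritaContext (A B : Mon C) where
  /-- The `A`-`B`-bimodule. -/
  P : Bimod A B
  /-- The `B`-`A`-bimodule. -/
  P' : Bimod B A
  /-- The isomorphism `P ⊗_B P' ≅ A` of `A`-bimodules. -/
  f : P.tensorBimod P' ≅ Bimod.regular A
  /-- The isomorphism `P' ⊗_A P ≅ B` of `B`-bimodules. -/
  g : P'.tensorBimod P ≅ Bimod.regular B
  left_diagram :
    Bimod.whiskerRight f.hom P ≫ (Bimod.leftUnitorBimod P).hom =
      (Bimod.associatorBimod P P' P).hom ≫ Bimod.whiskerLeft P g.hom ≫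
        (Bimod.rightUnitorBimod P).hom
  right_diagram :
    Bimod.whiskerRight g.hom P' ≫ (Bimod.leftUnitorBimod P').hom =
      (Bimod.associatorBimod P' P P').hom ≫ Bimod.whiskerLeft P' f.hom ≫
        (Bimod.rightUnitorBimod P').hom

/-- The Picard group of `C_{A|A}`: the group of isomorphism classes of invertible bimodules. -/
abbrev Pic (A : Mon C) : Type (max u v) := (Skeleton (Bimod A A))ˣ

/-- The map `Π_{P,P'} : [X] ↦ [P ⊗_B X ⊗_B P']` on isomorphism classes. -/
def MoritaContext.classMap {A B : Mon C} (c : MoritaContext A B) :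
    Skeleton (Bimod B B) → Skeleton (Bimod A A) :=
  Quotient.map (fun X => (c.P.tensorBimod X).tensorBimod c.P') (by
    rintro X Y ⟨i⟩
    exact ⟨⟨Bimod.whiskerRight (Bimod.whiskerLeft c.P i.hom) c.P',
      Bimod.whiskerRight (Bimod.whiskerLeft c.P i.inv) c.P',
      by rw [← Bimod.comp_whiskerRight_bimod, ← Bimod.whiskerLeft_comp_bimod, i.hom_inv_id,
        Bimod.whiskerLeft_id_bimod, Bimod.id_whiskerRight_bimod],
      by rw [← Bimod.comp_whiskerRight_bimod, ← Bimod.whiskerLeft_comp_bimod, i.inv_hom_id,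
        Bimod.whiskerLeft_id_bimod, Bimod.id_whiskerRight_bimod]⟩⟩)

/-- The class `Ψ_A(α) = [_id A_α]` of the twisted bimodule of an automorphism of `A`. -/
def twistClass (A : Frobenius C) (α : A.autGroup) : Skeleton (Bimod A.alg A.alg) :=
  letI := α.2.1
  toSkeleton (twistedBimod A.alg α.1.hom)

end Morita

/-! ## The associator of the Picard category, trivialisations and the algebras `Q(H, ω)` -/

section Picard

variable {C : Type u} [Category.{v} C] [MonoidalCategory C] [HasCoequalizers C]
  [∀ X : C, PreservesColimitsOfSize.{0, 0} (tensorLeft X)]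
  [∀ X : C, PreservesColimitsOfSize.{0, 0} (tensorRight X)]

/-- A choice of representatives `L_g` of the elements of the Picard group of `C_{A|A}`, with `L_1`
the tensor unit `A`, and of basis isomorphisms `_g b_h : L_g ⊗_A L_h ≅ L_{gh}`, with `_1 b_h` and
`_g b_1` given by the unit constraints. -/
structure PicBasis (A : Mon C) where
  /-- The representative `L_g`. -/
  L : Pic A → Bimod A A
  toSkeleton_L (g : Pic A) : toSkeleton (L g) = (g : Skeleton (Bimod A A))
  /-- The identification of `L_1` with the tensor unit. -/
  unitIso : L 1 ≅ 𝟙_ (Bimod A A)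
  /-- The basis isomorphism `_g b_h`. -/
  b (g h : Pic A) : L g ⊗ L h ≅ L (g * h)
  b_one_left (h : Pic A) :
    (b 1 h).hom = unitIso.hom ▷ L h ≫ (λ_ (L h)).hom ≫ eqToHom (by rw [one_mul])
  b_one_right (g : Pic A) :
    (b g 1).hom = L g ◁ unitIso.hom ≫ (ρ_ (L g)).hom ≫ eqToHom (by rw [mul_one])

variable [Preadditive C] [MonoidalPreadditive C] {k : Type w} [Field k] [Linear k C]
  [MonoidalLinear k C] {A : Mon C}

/-- `ψ` is the three-cocycle describing the associator of the Picard category with respect to the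
chosen bases:
`_{g₁g₂}b_{g₃} ∘ (_{g₁}b_{g₂} ⊗ id) = ψ(g₁,g₂,g₃) _{g₁}b_{g₂g₃} ∘ (id ⊗ _{g₂}b_{g₃})`, up to the
associator of `C_{A|A}`. -/
def PicBasis.DescribesAssociator (β : PicBasis A) (ψ : Pic A → Pic A → Pic A → kˣ) : Prop :=
  ∀ g₁ g₂ g₃ : Pic A,
    (β.b g₁ g₂).hom ▷ β.L g₃ ≫ (β.b (g₁ * g₂) g₃).hom =
      (ψ g₁ g₂ g₃ : k) • ((α_ (β.L g₁) (β.L g₂) (β.L g₃)).hom ≫ β.L g₁ ◁ (β.b g₂ g₃).hom ≫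
        (β.b g₁ (g₂ * g₃)).hom ≫ eqToHom (by rw [mul_assoc]))

/-- The coboundary `(dω)(g,h,l) = ω(h,l) ω(g,hl) / (ω(gh,l) ω(g,h))` of a two-cochain. -/
def coboundary {G : Type*} [Group G] (ω : G → G → kˣ) (g h l : G) : kˣ :=
  ω h l * ω g (h * l) / (ω (g * h) l * ω g h)

/-- A trivialisation of `ψ` on `H`: a normalised two-cochain `ω` on `H` with values in `kˣ`, such
that `dω` is the restriction of `ψ` to `H`. -/
@[ext]
structure Trivialisation {G : Type*} [Group G] (ψ : G → G → G → kˣ) (H : Subgroup G) where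
  /-- The two-cochain. -/
  ω : H → H → kˣ
  one_left (h : H) : ω 1 h = 1
  one_right (h : H) : ω h 1 = 1
  coboundary_eq (g h l : H) : coboundary ω g h l = ψ g h l

section Q

variable [HasFiniteProducts C] (β : PicBasis A) (H : Subgroup (Pic A)) [Fintype H]

/-- The bimodule `Q(H) = ⨁_{h ∈ H} L_h`. -/
def Q : Bimod A A := ⨁ fun h : H => β.L h

/-- The inclusion `e_h : L_h ⟶ Q(H)`. -/
def Qι (h : H) : β.L h ⟶ Q β H := biproduct.ι (fun h : H => β.L h) h

/-- The projection `r_h : Q(H) ⟶ L_h`. -/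
def Qπ (h : H) : Q β H ⟶ β.L h := biproduct.π (fun h : H => β.L h) h

/-- The product `∑_{g,h} ω(g,h) e_{gh} ∘ _g b_h ∘ (r_g ⊗_A r_h)` of the algebra `Q(H, ω)` in
`C_{A|A}`. -/
def Qmul (ω : H → H → kˣ) : Q β H ⊗ Q β H ⟶ Q β H :=
  ∑ g : H, ∑ h : H, (ω g h : k) • ((Qπ β H g ⊗ₘ Qπ β H h) ≫ (β.b g h).hom ≫ Qι β H (g * h))

/-- The unit `e_1` of the algebra `Q(H, ω)` in `C_{A|A}`. -/
def Qone : 𝟙_ (Bimod A A) ⟶ Q β H := β.unitIso.inv ≫ Qι β H 1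

end Q

/-- The transport `m_B ∘ r_{B,B}` to `C` of the product `m_B` of an algebra in `C_{A|A}`. -/
def transportMul {B : Bimod A A} (m : B ⊗ B ⟶ B) : B.X ⊗ B.X ⟶ B.X :=
  tensorProj B B ≫ m.hom

/-- The transport `η_B ∘ η` to `C` of the unit `η_B` of an algebra in `C_{A|A}`. -/
def transportOne {B : Bimod A A} (e : 𝟙_ (Bimod A A) ⟶ B) : 𝟙_ C ⟶ B.X :=
  η[A.X] ≫ e.hom

end Picard

/-! ## Admissible subgroups and fixed algebras -/

section Admissible

variable {C : Type u} [Category.{v} C] [MonoidalCategory C] [Sovereign C] [HasCoequalizers C]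
  [Preadditive C] {k : Type w} [Field k] [Linear k C]

/-- The finite subgroup `H` of the Picard group of `C_{A|A}` is admissible, for a special Frobenius
algebra `A` with `m ∘ Δ = βA id`: the representatives `L_h`, `h ∈ H`, have left and right dimension
`1` in `C_{A|A}`, and `ψ` has a trivialisation on `H`. -/
structure IsAdmissible (A : Frobenius C) (βA : k) (β : PicBasis A.alg)
    (ψ : Pic A.alg → Pic A.alg → Pic A.alg → kˣ) (H : Subgroup (Pic A.alg)) : Prop where
  finite : Finite H
  leftDim (h : H) : HasLeftDim βA (β.L h) (1 : k)
  rightDim (h : H) : HasRightDim βA (β.L h) (1 : k)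
  exists_trivialisation : Nonempty (Trivialisation ψ H)

end Admissible

section Fixed

variable {C : Type u} [Category.{v} C] [MonoidalCategory C]

/-- `(F, j)` is a fixed algebra of `A` under the subgroup `G` of `Aut(A)`: `j : F ⟶ A` is monic and
universal among the morphisms to `A` that are fixed by `G`, and the algebra structure of `F` is the
one for which `j` is a morphism of algebras. -/
structure IsFixedAlgebra (A : Frobenius C) (G : Subgroup A.autGroup) (F : Mon C)
    (j : F.X ⟶ A.alg.X) : Prop where
  mono : Mono j
  fixed (α : A.autGroup) (hα : α ∈ G) : j ≫ α.1.hom = j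
  existsUnique_lift {B : C} (f : B ⟶ A.alg.X) (hf : ∀ α ∈ G, f ≫ α.1.hom = f) :
    ∃! f' : B ⟶ F.X, f' ≫ j = f
  isMonHom : IsMonHom j

/-- The algebra `F` is isomorphic to the object `X` with product `m` and unit `e`. -/
def IsAlgebraIso (F : Mon C) {X : C} (m : X ⊗ X ⟶ X) (e : 𝟙_ C ⟶ X) : Prop :=
  ∃ φ : F.X ≅ X, μ[F.X] ≫ φ.hom = (φ.hom ⊗ₘ φ.hom) ≫ m ∧ η[F.X] ≫ φ.hom = e

end Fixed

end RosenbergZelinsky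

end

open RosenbergZelinsky

set_option linter.unusedSectionVars false

noncomputable section

namespace RosenbergZelinsky

/-! ## Finite decompositions -/

section Decomp

variable {C : Type u} [Category.{v} C] [Preadditive C]

/-! Fix one trivialisation `ω`. Because `dω = ψ`, the products `L_g ⊗ L_h ⟶ L_{gh}` rescaled by `ω`
are strictly associative, and the Casimir element `Δ ∘ η` of the special Frobenius algebra `A`
supplies matching coproducts. Hence the objects `L_{ij⁻¹}`, for `i, j ∈ H`, form a Frobenius algebra
with several objects (`PicBasis.frobeniusCategory`). The algebra `A'` consists of the `H × H`
matrices whose entry `(i, j)` lies in `L_{ij⁻¹}`, while `A` is the algebra of matrices of size one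
with label `1`. As for ordinary matrix rings, rows and columns form a Morita context: multiplication
of matrices over `A'` is inverted by the coproduct up to the factor `|H| β_A`, which is nonzero in
characteristic `0` (`matTensorIso`, `matMorita_diagram`). The same factor makes `A'` special.

For symmetry, the trace of the regular representation of any algebra in a sovereign category is a
symmetric form (`exists_trace_dual`). Since the `L_h` have dimension `1`, this trace is `|H| β_A`
times the counit of `A'` (`partialTrace_matMul`, `partialTrace_actLeft`).

The group `H` acts on `A'` by translating indices, `(i, j) ↦ (ix, jx)`, which leaves `ij⁻¹`
unchanged. For a trivialisation `t`, the quotient `κ = t/ω` is a two-cocycle, and the action is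
modified by the factor `κ(j,x)/κ(i,x)` on the entry `(i, j)`. This factor telescopes along matrix
products, so each `x` gives an automorphism (`matAut_mem`); the cocycle identity makes it
multiplicative in `x` (`matAut_mul`). A fixed matrix is determined by its column with label `1`: its
entry `(i, j)` is `κ(ij⁻¹, j)` times the component at `ij⁻¹`. By the cocycle identity such matrices
multiply as the elements of `Q(H, t)` (`exists_lift_QEmbed`, `transportMul_QEmbed`).

Finally, twisting by the automorphism of `x` turns the column with label `1` into the column with
label `x⁻¹`, and the product of the row with label `1` by that column is the single entry `L_x`
(`nonempty_tensor_twistedBimod_iso`). This gives the identity on classes and the injectivity of each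
`α_t`. The factor on the entry `(i, 1)` is `κ(i,x)⁻¹`, and `L_i` is nonzero, so `t` can be recovered
from `α_t`. -/

/-- A presentation of `X` as the direct sum of a finite family `Y`. -/
structure Decomp (X : C) {J : Type*} [Fintype J] (Y : J → C) where
  /-- The projections. -/
  proj (j : J) : X ⟶ Y j
  /-- The inclusions. -/
  inj (j : J) : Y j ⟶ X
  inj_proj_self (j : J) : inj j ≫ proj j = 𝟙 _
  inj_proj_ne {i j : J} (h : i ≠ j) : inj i ≫ proj j = 0
  total : ∑ j, proj j ≫ inj j = 𝟙 X

namespace Decomp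

variable {X : C} {J : Type*} [Fintype J] {Y : J → C} (d : Decomp X Y)

attribute [simp] inj_proj_self

@[simp] theorem inj_proj_self_assoc (j : J) {Z : C} (f : Y j ⟶ Z) :
    d.inj j ≫ d.proj j ≫ f = f := by
  rw [← Category.assoc, inj_proj_self, Category.id_comp]

theorem hom_ext_proj {W : C} {f g : W ⟶ X} (h : ∀ j, f ≫ d.proj j = g ≫ d.proj j) : f = g := by
  rw [← Category.comp_id f, ← Category.comp_id g, ← d.total, Preadditive.comp_sum,
    Preadditive.comp_sum]
  exact Finset.sum_congr rfl fun j _ => by rw [reassoc_of% h j]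

theorem hom_ext_inj {W : C} {f g : X ⟶ W} (h : ∀ j, d.inj j ≫ f = d.inj j ≫ g) : f = g := by
  rw [← Category.id_comp f, ← Category.id_comp g, ← d.total, Preadditive.sum_comp,
    Preadditive.sum_comp]
  exact Finset.sum_congr rfl fun j _ => by rw [Category.assoc, Category.assoc, h j]

theorem inj_sum {W : C} (f : ∀ j, Y j ⟶ W) (i : J) : d.inj i ≫ ∑ j, d.proj j ≫ f j = f i := by
  classical
  rw [Preadditive.comp_sum, Finset.sum_eq_single i]
  · simp
  · intro j _ hj
    rw [← Category.assoc, d.inj_proj_ne hj.symm, zero_comp]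
  · simp

theorem sum_proj {W : C} (f : ∀ j, W ⟶ Y j) (i : J) : (∑ j, f j ≫ d.inj j) ≫ d.proj i = f i := by
  classical
  rw [Preadditive.sum_comp, Finset.sum_eq_single i]
  · simp
  · intro j _ hj
    rw [Category.assoc, d.inj_proj_ne hj, comp_zero]
  · simp

theorem sum_comp_proj {W : C} (f : W ⟶ X) : ∑ j, (f ≫ d.proj j) ≫ d.inj j = f := by
  simp only [Category.assoc]
  rw [← Preadditive.comp_sum, d.total, Category.comp_id]

theorem hom_ext_whiskerRight_inj [MonoidalCategory C] [MonoidalPreadditive C] {V W : C}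
    {f g : X ⊗ V ⟶ W} (h : ∀ j, d.inj j ▷ V ≫ f = d.inj j ▷ V ≫ g) : f = g := by
  have e : ∑ j, d.proj j ▷ V ≫ d.inj j ▷ V = 𝟙 (X ⊗ V) := by
    simp only [← comp_whiskerRight]
    rw [← sum_whiskerRight, d.total, id_whiskerRight]
  rw [← Category.id_comp f, ← Category.id_comp g, ← e, Preadditive.sum_comp,
    Preadditive.sum_comp]
  exact Finset.sum_congr rfl fun j _ => by rw [Category.assoc, Category.assoc, h j]

theorem hom_ext_whiskerLeft_inj [MonoidalCategory C] [MonoidalPreadditive C] {V W : C}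
    {f g : V ⊗ X ⟶ W} (h : ∀ j, V ◁ d.inj j ≫ f = V ◁ d.inj j ≫ g) : f = g := by
  have e : ∑ j, V ◁ d.proj j ≫ V ◁ d.inj j = 𝟙 (V ⊗ X) := by
    simp only [← whiskerLeft_comp]
    rw [← whiskerLeft_sum, d.total, whiskerLeft_id]
  rw [← Category.id_comp f, ← Category.id_comp g, ← e, Preadditive.sum_comp,
    Preadditive.sum_comp]
  exact Finset.sum_congr rfl fun j _ => by rw [Category.assoc, Category.assoc, h j]

/-- The decomposition given by a biproduct. -/
def ofBiproduct [HasBiproduct Y] : Decomp (⨁ Y) Y where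
  proj := biproduct.π Y
  inj := biproduct.ι Y
  inj_proj_self := biproduct.ι_π_self Y
  inj_proj_ne h := biproduct.ι_π_ne Y h
  total := by
    classical
    refine biproduct.hom_ext _ _ fun j => ?_
    rw [Preadditive.sum_comp, Finset.sum_eq_single j]
    · simp
    · intro i _ hi
      rw [Category.assoc, biproduct.ι_π_ne Y hi, comp_zero]
    · simp

/-- The decomposition of an object into one summand. -/
def ofIso {X Y : C} (e : X ≅ Y) : Decomp X (fun _ : Unit × Unit => Y) where
  proj _ := e.hom
  inj _ := e.inv
  inj_proj_self _ := e.inv_hom_id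
  inj_proj_ne h := (h (Subsingleton.elim _ _)).elim
  total := by simp

end Decomp

end Decomp

/-! ## Frobenius algebras with several objects, and their matrices -/

section Matrix

variable (C : Type u) [Category.{v} C] [MonoidalCategory C] [Preadditive C]
variable (k : Type w) [Field k] [Linear k C]

/-- A category with set of objects `I` enriched in `C`, together with compatible coproducts
`Y i l ⟶ Y i j ⊗ Y j l`: a Frobenius algebra with several objects, with
`mul ∘ comul = b id`. -/
structure FrobeniusCategory (b : k) (I : Type*) where
  /-- The objects of morphisms. -/
  Y : I → I → C
  /-- The composition. -/
  mul (i j l : I) : Y i j ⊗ Y j l ⟶ Y i l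
  /-- The identities. -/
  one (i : I) : 𝟙_ C ⟶ Y i i
  /-- The coproducts. -/
  comul (i j l : I) : Y i l ⟶ Y i j ⊗ Y j l
  /-- The counits. -/
  counit (i : I) : Y i i ⟶ 𝟙_ C
  mul_assoc (i j l n : I) : mul i j l ▷ Y l n ≫ mul i l n =
    (α_ _ _ _).hom ≫ Y i j ◁ mul j l n ≫ mul i j n
  one_mul (i j : I) : one i ▷ Y i j ≫ mul i i j = (λ_ _).hom
  mul_one (i j : I) : Y i j ◁ one j ≫ mul i j j = (ρ_ _).hom
  left_frobenius (i j l n : I) : comul i n j ▷ Y j l ≫ (α_ _ _ _).hom ≫ Y i n ◁ mul n j l =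
    mul i j l ≫ comul i n l
  right_frobenius (i j l n : I) : Y i j ◁ comul j n l ≫ (α_ _ _ _).inv ≫ mul i j n ▷ Y n l =
    mul i j l ≫ comul i n l
  counit_comul (i j : I) : comul i i j ≫ counit i ▷ Y i j = (λ_ _).inv
  comul_counit (i j : I) : comul i j j ≫ Y i j ◁ counit j = (ρ_ _).inv
  comul_mul (i j l : I) : comul i j l ≫ mul i j l = b • 𝟙 _

variable {C k}

namespace FrobeniusCategory

variable [MonoidalPreadditive C]
variable {b : k} {I : Type*} (F : FrobeniusCategory C k b I)
variable {R S T N : Type*} [Fintype R] [Fintype S] [Fintype T] [Fintype N]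
  {r : R → I} {s : S → I} {t : T → I} {n : N → I}

/-- A presentation of `X` as an object of `R × S`-matrices with entries in `F`, where the rows and
the columns have the labels `r` and `s`. -/
abbrev MatrixObj (X : C) (r : R → I) (s : S → I) :=
  Decomp X fun p : R × S => F.Y (r p.1) (s p.2)

variable {F} {X₁ X₂ X₃ X₄ X₅ X₆ : C}

/-- Matrix multiplication. -/
def matMul (a : F.MatrixObj X₁ r s) (b : F.MatrixObj X₂ s t) (c : F.MatrixObj X₃ r t) :
    X₁ ⊗ X₂ ⟶ X₃ :=
  ∑ p : R × T, (∑ j, (a.proj (p.1, j) ⊗ₘ b.proj (j, p.2)) ≫ F.mul (r p.1) (s j) (t p.2)) ≫ c.inj p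

/-- The unit matrix. -/
def matOne (a : F.MatrixObj X₁ r r) : 𝟙_ C ⟶ X₁ := ∑ i, F.one (r i) ≫ a.inj (i, i)

/-- The coproduct of matrices. -/
def matComul (c : F.MatrixObj X₃ r t) (a : F.MatrixObj X₁ r s) (b : F.MatrixObj X₂ s t) :
    X₃ ⟶ X₁ ⊗ X₂ :=
  ∑ p : R × T, c.proj p ≫ ∑ j, F.comul (r p.1) (s j) (t p.2) ≫ (a.inj (p.1, j) ⊗ₘ b.inj (j, p.2))

/-- The counit of matrices. -/
def matCounit (a : F.MatrixObj X₁ r r) : X₁ ⟶ 𝟙_ C := ∑ i, a.proj (i, i) ≫ F.counit (r i)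

section basic

variable (a : F.MatrixObj X₁ r s) (b' : F.MatrixObj X₂ s t) (c : F.MatrixObj X₃ r t)

theorem matMul_proj (i : R) (l : T) : matMul a b' c ≫ c.proj (i, l) =
    ∑ j, (a.proj (i, j) ⊗ₘ b'.proj (j, l)) ≫ F.mul (r i) (s j) (t l) :=
  c.sum_proj _ (i, l)

theorem inj_matComul (i : R) (l : T) : c.inj (i, l) ≫ matComul c a b' =
    ∑ j, F.comul (r i) (s j) (t l) ≫ (a.inj (i, j) ⊗ₘ b'.inj (j, l)) :=
  c.inj_sum _ (i, l)

/-- Multiplying the elementary matrix at `(i, j)` by a matrix moves row `j` of the latter into row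
`i`. All identities between matrix products and coproducts below are checked after such a
restriction to one entry. -/
theorem inj_matMul (i : R) (j : S) : a.inj (i, j) ▷ X₂ ≫ matMul a b' c =
    ∑ l, F.Y (r i) (s j) ◁ b'.proj (j, l) ≫ F.mul (r i) (s j) (t l) ≫ c.inj (i, l) := by
  classical
  have h : ∀ i' j' l, a.inj (i, j) ▷ X₂ ≫ (a.proj (i', j') ⊗ₘ b'.proj (j', l)) =
      (a.inj (i, j) ≫ a.proj (i', j')) ⊗ₘ b'.proj (j', l) :=
    fun i' j' l => whiskerRight_comp_tensorHom _ _ _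
  rw [matMul, Preadditive.comp_sum, Fintype.sum_prod_type, Finset.sum_eq_single i]
  · refine Finset.sum_congr rfl fun l _ => ?_
    rw [← Category.assoc, Preadditive.comp_sum, Finset.sum_eq_single j]
    · rw [← Category.assoc, h]
      simp
    · intro j' _ hj
      rw [← Category.assoc, h, a.inj_proj_ne (by simpa using hj.symm)]
      simp
    · simp
  · intro i' _ hi
    refine Finset.sum_eq_zero fun l _ => ?_
    rw [← Category.assoc, Preadditive.comp_sum, Finset.sum_eq_zero, zero_comp]
    intro j' _
    rw [← Category.assoc, h, a.inj_proj_ne (by simp [hi.symm])]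
    simp
  · simp

theorem matMul_inj (j : S) (l : T) : X₁ ◁ b'.inj (j, l) ≫ matMul a b' c =
    ∑ i, a.proj (i, j) ▷ F.Y (s j) (t l) ≫ F.mul (r i) (s j) (t l) ≫ c.inj (i, l) := by
  classical
  have h : ∀ i j' l', X₁ ◁ b'.inj (j, l) ≫ (a.proj (i, j') ⊗ₘ b'.proj (j', l')) =
      a.proj (i, j') ⊗ₘ (b'.inj (j, l) ≫ b'.proj (j', l')) :=
    fun i j' l' => whiskerLeft_comp_tensorHom _ _ _
  rw [matMul, Preadditive.comp_sum, Fintype.sum_prod_type]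
  refine Finset.sum_congr rfl fun i _ => ?_
  rw [Finset.sum_eq_single l]
  · rw [← Category.assoc, Preadditive.comp_sum, Finset.sum_eq_single j]
    · rw [← Category.assoc, h]
      simp
    · intro j' _ hj
      rw [← Category.assoc, h, b'.inj_proj_ne (by simpa using hj.symm)]
      simp
    · simp
  · intro l' _ hl
    rw [← Category.assoc, Preadditive.comp_sum, Finset.sum_eq_zero, zero_comp]
    intro j' _
    rw [← Category.assoc, h, b'.inj_proj_ne (by simp [hl.symm])]
    simp
  · simp

end basic

theorem matMul_assoc (a : F.MatrixObj X₁ r s) (b' : F.MatrixObj X₂ s t) (c : F.MatrixObj X₃ t n)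
    (ab : F.MatrixObj X₄ r t) (bc : F.MatrixObj X₅ s n) (abc : F.MatrixObj X₆ r n) :
    matMul a b' ab ▷ X₃ ≫ matMul ab c abc =
      (α_ _ _ _).hom ≫ X₁ ◁ matMul b' c bc ≫ matMul a bc abc := by
  refine abc.hom_ext_proj fun ⟨i, l⟩ => ?_
  simp only [Category.assoc, matMul_proj, Preadditive.comp_sum]
  simp only [whiskerRight_comp_tensorHom_assoc, whiskerLeft_comp_tensorHom_assoc, matMul_proj,
    sum_tensor, tensor_sum, Preadditive.sum_comp, Preadditive.comp_sum]
  rw [Finset.sum_comm]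
  refine Finset.sum_congr rfl fun j _ => Finset.sum_congr rfl fun m _ => ?_
  rw [← tensorHom_comp_whiskerRight, ← tensorHom_comp_whiskerLeft, Category.assoc, F.mul_assoc]
  simp

theorem matOne_matMul (a : F.MatrixObj X₁ r r) (c : F.MatrixObj X₃ r t) :
    matOne a ▷ X₃ ≫ matMul a c c = (λ_ _).hom := by
  rw [matOne, sum_whiskerRight, Preadditive.sum_comp]
  simp only [comp_whiskerRight, Category.assoc, inj_matMul, Preadditive.comp_sum]
  have h : ∀ i l, F.one (r i) ▷ X₃ ≫ F.Y (r i) (r i) ◁ c.proj (i, l) ≫ F.mul (r i) (r i) (t l) ≫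
      c.inj (i, l) = (λ_ _).hom ≫ c.proj (i, l) ≫ c.inj (i, l) := fun i l => by
    rw [← whisker_exchange_assoc, reassoc_of% F.one_mul, leftUnitor_naturality_assoc]
  simp only [h]
  rw [← Fintype.sum_prod_type' (fun i l => (λ_ X₃).hom ≫ c.proj (i, l) ≫ c.inj (i, l)),
    ← Preadditive.comp_sum, c.total, Category.comp_id]

theorem matMul_matOne (a : F.MatrixObj X₁ r s) (c : F.MatrixObj X₃ s s) :
    X₁ ◁ matOne c ≫ matMul a c a = (ρ_ _).hom := by
  rw [matOne, whiskerLeft_sum, Preadditive.sum_comp]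
  simp only [whiskerLeft_comp, Category.assoc, matMul_inj, Preadditive.comp_sum]
  have h : ∀ i j, X₁ ◁ F.one (s j) ≫ a.proj (i, j) ▷ F.Y (s j) (s j) ≫
      F.mul (r i) (s j) (s j) ≫ a.inj (i, j) = (ρ_ _).hom ≫ a.proj (i, j) ≫ a.inj (i, j) :=
    fun i j => by
      rw [whisker_exchange_assoc, reassoc_of% F.mul_one, rightUnitor_naturality_assoc]
  simp only [h]
  rw [Finset.sum_comm,
    ← Fintype.sum_prod_type' (fun i j => (ρ_ X₁).hom ≫ a.proj (i, j) ≫ a.inj (i, j)),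
    ← Preadditive.comp_sum, a.total, Category.comp_id]

/-- On an elementary matrix both sides become sums over the new middle label and the column label,
and they agree term by term by the Frobenius relation of the entries. The shapes are kept
rectangular because the relation serves twice: for the algebra `A'`, and for inverting the
multiplication of bimodules in `matTensorIso`. -/
theorem matComul_matMul_left (a : F.MatrixObj X₁ r s) (b' : F.MatrixObj X₂ s t)
    (c : F.MatrixObj X₃ r t) (p : F.MatrixObj X₄ r n) (q : F.MatrixObj X₅ n s)
    (o : F.MatrixObj X₆ n t) :
    matComul a p q ▷ X₂ ≫ (α_ _ _ _).hom ≫ X₄ ◁ matMul q b' o =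
      matMul a b' c ≫ matComul c p o := by
  refine a.hom_ext_whiskerRight_inj fun ⟨i, j⟩ => ?_
  rw [← comp_whiskerRight_assoc, inj_matComul, reassoc_of% inj_matMul, sum_whiskerRight]
  simp only [Preadditive.sum_comp, Category.assoc, inj_matComul, Preadditive.comp_sum]
  rw [Finset.sum_comm]
  refine Finset.sum_congr rfl fun m _ => ?_
  rw [comp_whiskerRight, MonoidalCategory.tensorHom_def', comp_whiskerRight, Category.assoc, Category.assoc,
    associator_naturality_left_assoc, ← whisker_exchange, associator_naturality_middle_assoc,
    ← whiskerLeft_comp_assoc, inj_matMul, whiskerLeft_sum]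
  simp only [Preadditive.sum_comp, Preadditive.comp_sum]
  refine Finset.sum_congr rfl fun l _ => ?_
  rw [← reassoc_of% F.left_frobenius, whisker_exchange_assoc]
  simp [MonoidalCategory.tensorHom_def']

theorem matComul_matMul_right (a : F.MatrixObj X₁ r s) (b' : F.MatrixObj X₂ s t)
    (c : F.MatrixObj X₃ r t) (p : F.MatrixObj X₄ s n) (q : F.MatrixObj X₅ n t)
    (o : F.MatrixObj X₆ r n) :
    X₁ ◁ matComul b' p q ≫ (α_ _ _ _).inv ≫ matMul a p o ▷ X₅ =
      matMul a b' c ≫ matComul c o q := by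
  refine b'.hom_ext_whiskerLeft_inj fun ⟨j, l⟩ => ?_
  rw [← whiskerLeft_comp_assoc, inj_matComul, reassoc_of% matMul_inj, whiskerLeft_sum]
  simp only [Preadditive.sum_comp, Category.assoc, inj_matComul, Preadditive.comp_sum]
  rw [Finset.sum_comm]
  refine Finset.sum_congr rfl fun m _ => ?_
  rw [whiskerLeft_comp, MonoidalCategory.tensorHom_def, whiskerLeft_comp, Category.assoc, Category.assoc,
    associator_inv_naturality_right_assoc, whisker_exchange, associator_inv_naturality_middle_assoc,
    ← comp_whiskerRight_assoc, matMul_inj, sum_whiskerRight]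
  simp only [Preadditive.sum_comp, Preadditive.comp_sum]
  refine Finset.sum_congr rfl fun i _ => ?_
  rw [← reassoc_of% F.right_frobenius, ← whisker_exchange_assoc]
  simp [MonoidalCategory.tensorHom_def]

/-- Each of the `|S|` middle labels contributes `b`, and distinct middle labels do not interact. -/
theorem matComul_comp_matMul (a : F.MatrixObj X₁ r s) (b' : F.MatrixObj X₂ s t)
    (c : F.MatrixObj X₃ r t) :
    matComul c a b' ≫ matMul a b' c = ((Fintype.card S : k) * b) • 𝟙 X₃ := by
  classical
  refine c.hom_ext_inj fun ⟨i, l⟩ => c.hom_ext_proj fun ⟨i', l'⟩ => ?_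
  have h : ∀ j j', (a.inj (i, j) ⊗ₘ b'.inj (j, l)) ≫ (a.proj (i', j') ⊗ₘ b'.proj (j', l')) =
      (a.inj (i, j) ≫ a.proj (i', j')) ⊗ₘ (b'.inj (j, l) ≫ b'.proj (j', l')) :=
    fun j j' => tensorHom_comp_tensorHom _ _ _ _
  rw [reassoc_of% inj_matComul, Category.assoc, Category.assoc, matMul_proj]
  simp only [Preadditive.sum_comp, Preadditive.comp_sum, Category.assoc, reassoc_of% h]
  by_cases hi : i = i'
  · by_cases hl : l = l'
    · subst hi hl
      have : ∀ j, ∑ j', F.comul (r i) (s j) (t l) ≫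
          ((a.inj (i, j) ≫ a.proj (i, j')) ⊗ₘ (b'.inj (j, l) ≫ b'.proj (j', l))) ≫
          F.mul (r i) (s j') (t l) = b • 𝟙 _ := fun j => by
        rw [Finset.sum_eq_single j]
        · simp [F.comul_mul]
        · intro j' _ hj
          rw [a.inj_proj_ne (by simpa using hj.symm)]
          simp
        · simp
      rw [Finset.sum_comm]
      simp [this, mul_smul, Nat.cast_smul_eq_nsmul]
    · rw [Finset.sum_eq_zero]
      · simp [c.inj_proj_ne (show (i, l) ≠ (i', l') by simp [hl])]
      · intro j _
        refine Finset.sum_eq_zero fun j' _ => ?_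
        rw [b'.inj_proj_ne (by simp [hl])]
        simp
  · rw [Finset.sum_eq_zero]
    · simp [c.inj_proj_ne (show (i, l) ≠ (i', l') by simp [hi])]
    · intro j _
      refine Finset.sum_eq_zero fun j' _ => ?_
      rw [a.inj_proj_ne (by simp [hi])]
      simp

theorem inj_matCounit_self (a : F.MatrixObj X₁ r r) (i : R) :
    a.inj (i, i) ≫ matCounit a = F.counit (r i) := by
  classical
  rw [matCounit, Preadditive.comp_sum, Finset.sum_eq_single i]
  · simp
  · intro j _ hj
    rw [← Category.assoc, a.inj_proj_ne (by simpa using hj.symm), zero_comp]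
  · simp

theorem inj_matCounit_ne (a : F.MatrixObj X₁ r r) {i j : R} (h : i ≠ j) :
    a.inj (i, j) ≫ matCounit a = 0 := by
  rw [matCounit, Preadditive.comp_sum]
  refine Finset.sum_eq_zero fun l _ => ?_
  rw [← Category.assoc, a.inj_proj_ne, zero_comp]
  intro e
  simp only [Prod.mk.injEq] at e
  exact h (e.1.trans e.2.symm)

/-- The counit vanishes off the diagonal, so only the middle label equal to the row label survives,
and the counit law of that entry applies. -/
theorem matComul_matCounit_left (a : F.MatrixObj X₁ r r) (c : F.MatrixObj X₃ r t) :
    matComul c a c ≫ matCounit a ▷ X₃ = (λ_ _).inv := by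
  classical
  refine c.hom_ext_inj fun ⟨i, l⟩ => ?_
  rw [reassoc_of% inj_matComul, Preadditive.sum_comp, Finset.sum_eq_single i]
  · rw [Category.assoc, tensorHom_comp_whiskerRight, inj_matCounit_self, MonoidalCategory.tensorHom_def,
      reassoc_of% F.counit_comul, leftUnitor_inv_naturality]
  · intro j _ hj
    rw [Category.assoc, tensorHom_comp_whiskerRight, inj_matCounit_ne _ hj.symm]
    simp
  · simp

theorem matComul_matCounit_right (a : F.MatrixObj X₁ r s) (c : F.MatrixObj X₃ s s) :
    matComul a a c ≫ X₁ ◁ matCounit c = (ρ_ _).inv := by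
  classical
  refine a.hom_ext_inj fun ⟨i, l⟩ => ?_
  rw [reassoc_of% inj_matComul, Preadditive.sum_comp, Finset.sum_eq_single l]
  · rw [Category.assoc, tensorHom_comp_whiskerLeft, inj_matCounit_self, MonoidalCategory.tensorHom_def',
      reassoc_of% F.comul_counit, rightUnitor_inv_naturality]
  · intro j _ hj
    rw [Category.assoc, tensorHom_comp_whiskerLeft, inj_matCounit_ne _ hj]
    simp
  · simp

theorem matOne_matCounit (a : F.MatrixObj X₁ r r) :
    matOne a ≫ matCounit a = ∑ i, F.one (r i) ≫ F.counit (r i) := by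
  rw [matOne, Preadditive.sum_comp]
  simp only [Category.assoc, inj_matCounit_self]

end FrobeniusCategory

end Matrix

/-! ## Tensor products of bimodules -/

section TensorBimod

variable {C : Type u} [Category.{v} C] [MonoidalCategory C] [HasCoequalizers C]
  [∀ X : C, PreservesColimitsOfSize.{0, 0} (tensorLeft X)]
  [∀ X : C, PreservesColimitsOfSize.{0, 0} (tensorRight X)]
  {A B D E : Mon C}

instance (M : Bimod A B) (N : Bimod B D) : Epi (tensorProj M N) :=
  inferInstanceAs (Epi (coequalizer.π _ _))

instance (Z : C) (M : Bimod A B) (N : Bimod B D) : Epi (Z ◁ tensorProj M N) :=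
  inferInstanceAs (Epi ((tensorLeft Z).map (coequalizer.π _ _)))

instance (Z : C) (M : Bimod A B) (N : Bimod B D) : Epi (tensorProj M N ▷ Z) :=
  inferInstanceAs (Epi ((tensorRight Z).map (coequalizer.π _ _)))

theorem tensorProj_balanced (M : Bimod A B) (N : Bimod B D) :
    M.actRight ▷ N.X ≫ tensorProj M N =
      (α_ _ _ _).hom ≫ M.X ◁ N.actLeft ≫ tensorProj M N := by
  rw [← Category.assoc (α_ _ _ _).hom]
  exact coequalizer.condition _ _

theorem whiskerLeft_tensorProj_actLeft (M : Bimod A B) (N : Bimod B D) :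
    A.X ◁ tensorProj M N ≫ (M.tensorBimod N).actLeft =
      (α_ _ _ _).inv ≫ M.actLeft ▷ N.X ≫ tensorProj M N :=
  Bimod.TensorBimod.whiskerLeft_π_actLeft M N

theorem tensorProj_whiskerRight_actRight (M : Bimod A B) (N : Bimod B D) :
    tensorProj M N ▷ D.X ≫ (M.tensorBimod N).actRight =
      (α_ _ _ _).hom ≫ M.X ◁ N.actRight ≫ tensorProj M N :=
  Bimod.TensorBimod.π_tensor_id_actRight M N

theorem tensorProj_whiskerLeft (M : Bimod A B) {N N' : Bimod B D} (f : N ⟶ N') :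
    tensorProj M N ≫ (Bimod.whiskerLeft M f).hom = M.X ◁ f.hom ≫ tensorProj M N' :=
  (ι_colimMap _ _).trans (by rfl)

theorem tensorProj_whiskerRight {M M' : Bimod A B} (f : M ⟶ M') (N : Bimod B D) :
    tensorProj M N ≫ (Bimod.whiskerRight f N).hom = f.hom ▷ N.X ≫ tensorProj M' N :=
  (ι_colimMap _ _).trans (by rfl)

theorem tensorProj_leftUnitor (M : Bimod A B) :
    tensorProj (Bimod.regular A) M ≫ (Bimod.leftUnitorBimod M).hom.hom = M.actLeft :=
  coequalizer.π_desc _ _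

theorem tensorProj_rightUnitor (M : Bimod A B) :
    tensorProj M (Bimod.regular B) ≫ (Bimod.rightUnitorBimod M).hom.hom = M.actRight :=
  coequalizer.π_desc _ _

theorem tensorProj_associator (L : Bimod A B) (M : Bimod B D) (N : Bimod D E) :
    tensorProj L M ▷ N.X ≫ tensorProj (L.tensorBimod M) N ≫
        (Bimod.associatorBimod L M N).hom.hom =
      (α_ _ _ _).hom ≫ L.X ◁ tensorProj M N ≫ tensorProj L (M.tensorBimod N) := by
  have h : tensorProj (L.tensorBimod M) N ≫ (Bimod.associatorBimod L M N).hom.hom =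
      Bimod.AssociatorBimod.homAux L M N := coequalizer.π_desc _ _
  rw [h]
  exact π_tensor_id_preserves_coequalizer_inv_desc _ _ _ _

theorem tensorBimod_hom_ext {M : Bimod A B} {N : Bimod B D} {Z : C}
    {f g : (M.tensorBimod N).X ⟶ Z} (h : tensorProj M N ≫ f = tensorProj M N ≫ g) : f = g :=
  (cancel_epi _).1 h

/-- The morphism from `M ⊗_B N` induced by a balanced morphism. -/
def tensorDescHom {M : Bimod A B} {N : Bimod B D} {Z : C} (f : M.X ⊗ N.X ⟶ Z)
    (balanced : M.actRight ▷ N.X ≫ f = (α_ _ _ _).hom ≫ M.X ◁ N.actLeft ≫ f) :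
    (M.tensorBimod N).X ⟶ Z :=
  coequalizer.desc f (by rw [balanced, Category.assoc])

@[simp]
theorem tensorProj_descHom {M : Bimod A B} {N : Bimod B D} {Z : C} (f : M.X ⊗ N.X ⟶ Z)
    (balanced : M.actRight ▷ N.X ≫ f = (α_ _ _ _).hom ≫ M.X ◁ N.actLeft ≫ f) :
    tensorProj M N ≫ tensorDescHom f balanced = f :=
  coequalizer.π_desc _ _

/-- The morphism `M ⊗_B N ⟶ K` of bimodules induced by a balanced bilinear morphism. -/
def tensorDesc {M : Bimod A B} {N : Bimod B D} {K : Bimod A D} (f : M.X ⊗ N.X ⟶ K.X)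
    (balanced : M.actRight ▷ N.X ≫ f = (α_ _ _ _).hom ≫ M.X ◁ N.actLeft ≫ f)
    (left : (α_ _ _ _).inv ≫ M.actLeft ▷ N.X ≫ f = A.X ◁ f ≫ K.actLeft)
    (right : (α_ _ _ _).hom ≫ M.X ◁ N.actRight ≫ f = f ▷ D.X ≫ K.actRight) :
    M.tensorBimod N ⟶ K where
  hom := tensorDescHom f balanced
  left_act_hom := by
    rw [← cancel_epi (A.X ◁ tensorProj M N), reassoc_of% whiskerLeft_tensorProj_actLeft,
      ← whiskerLeft_comp_assoc, tensorProj_descHom, left]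
  right_act_hom := by
    rw [← cancel_epi (tensorProj M N ▷ D.X), reassoc_of% tensorProj_whiskerRight_actRight,
      ← comp_whiskerRight_assoc, tensorProj_descHom, right]

@[simp]
theorem tensorProj_desc {M : Bimod A B} {N : Bimod B D} {K : Bimod A D} (f : M.X ⊗ N.X ⟶ K.X)
    (balanced : M.actRight ▷ N.X ≫ f = (α_ _ _ _).hom ≫ M.X ◁ N.actLeft ≫ f)
    (left : (α_ _ _ _).inv ≫ M.actLeft ▷ N.X ≫ f = A.X ◁ f ≫ K.actLeft)
    (right : (α_ _ _ _).hom ≫ M.X ◁ N.actRight ≫ f = f ▷ D.X ≫ K.actRight) :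
    tensorProj M N ≫ (tensorDesc f balanced left right).hom = f :=
  tensorProj_descHom f balanced

/-- A morphism of bimodules that is an isomorphism in `C` is an isomorphism. -/
def bimodIsoOfHom {M N : Bimod A B} (f : M ⟶ N) (g : N.X ⟶ M.X) (h₁ : f.hom ≫ g = 𝟙 _)
    (h₂ : g ≫ f.hom = 𝟙 _) : M ≅ N :=
  Bimod.isoOfIso ⟨f.hom, g, h₁, h₂⟩ f.left_act_hom f.right_act_hom

/-- Let `T` be the algebra `B` with right action twisted by the automorphism `α`. Then `T ⊗_B N` is
isomorphic to the bimodule `N'` that has, up to an isomorphism `a`, the same underlying object as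
`N`, and the left action of `N` twisted by the inverse of `α`. -/
def twistedTensorIso {T : Bimod B B} (τ : T.X ≅ B.X) (α : B.X ≅ B.X)
    (hl : T.actLeft ≫ τ.hom = B.X ◁ τ.hom ≫ μ[B.X])
    (hr : T.actRight ≫ τ.hom = (τ.hom ⊗ₘ α.hom) ≫ μ[B.X]) {N N' : Bimod B D} (a : N.X ≅ N'.X)
    (left : N.actLeft ≫ a.hom = (α.hom ⊗ₘ a.hom) ≫ N'.actLeft)
    (right : N.actRight ≫ a.hom = a.hom ▷ D.X ≫ N'.actRight) :
    T.tensorBimod N ≅ N' :=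
  bimodIsoOfHom
    (tensorDesc (M := T) (K := N') ((τ.hom ⊗ₘ a.hom) ≫ N'.actLeft)
      (by
        rw [whiskerRight_comp_tensorHom_assoc, whiskerLeft_comp_tensorHom_assoc, hr, left,
          ← tensorHom_comp_whiskerRight, ← tensorHom_comp_whiskerLeft, Category.assoc,
          Category.assoc, Bimod.left_assoc]
        simp)
      (by
        rw [whiskerRight_comp_tensorHom_assoc, hl, ← whiskerRight_comp_tensorHom_assoc,
          MonoidalCategory.tensorHom_def μ a.hom, Category.assoc, ← whisker_exchange_assoc,
          Bimod.left_assoc]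
        simp [MonoidalCategory.tensorHom_def])
      (by
        rw [whiskerLeft_comp_tensorHom_assoc, right, ← tensorHom_comp_whiskerLeft,
          comp_whiskerRight, Category.assoc, Category.assoc, Bimod.middle_assoc]
        simp [MonoidalCategory.tensorHom_def]))
    -- The inverse sends `n` to the class of `1 ⊗ a⁻¹(n)`.
    ((λ_ _).inv ≫ ((η[B.X] ≫ τ.inv) ⊗ₘ a.inv) ≫ tensorProj T N)
    (by
      apply tensorBimod_hom_ext
      have h : N'.actLeft ≫ a.inv = (α.inv ⊗ₘ a.inv) ≫ N.actLeft := by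
        rw [← cancel_mono a.hom, Category.assoc, Category.assoc, left]; simp
      -- In `T` the unit times `b` is `α(b)`. This moves a scalar from the second tensor factor into
      -- the first.
      have h' : (η[B.X] ≫ τ.inv) ▷ B.X ≫ T.actRight = (λ_ _).hom ≫ α.hom ≫ τ.inv := by
        rw [← cancel_mono τ.hom, Category.assoc, hr]
        simp only [MonoidalCategory.tensorHom_def, comp_whiskerRight, Category.assoc,
          inv_hom_whiskerRight_assoc, Iso.inv_hom_id, Category.comp_id]
        rw [← whisker_exchange_assoc, MonObj.one_mul, leftUnitor_naturality]
      rw [reassoc_of% tensorProj_desc, Category.comp_id, MonoidalCategory.tensorHom_def' _ a.inv]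
      simp only [Category.assoc]
      rw [← leftUnitor_inv_naturality_assoc, reassoc_of% h, tensorHom_comp_tensorHom_assoc,
        Iso.hom_inv_id, leftUnitor_inv_naturality_assoc, whisker_exchange_assoc,
        ← (Iso.inv_comp_eq _).2 (tensorProj_balanced T N),
        associator_inv_naturality_left_assoc, ← comp_whiskerRight_assoc, h']
      simp)
    (by
      simp only [Category.assoc, tensorProj_desc]
      simp)

end TensorBimod

/-! ## Matrix algebras and their Morita contexts -/

section Coassociativity

variable {C : Type u} [Category.{v} C] [MonoidalCategory C]

/-- A morphism `X ⟶ X ⊗ X` of bimodules over the algebra `X` is coassociative. -/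
theorem comul_assoc_of_frobenius {X : C} [MonObj X] (δ : X ⟶ X ⊗ X)
    (left : δ ▷ X ≫ (α_ _ _ _).hom ≫ X ◁ μ[X] = μ[X] ≫ δ)
    (right : X ◁ δ ≫ (α_ _ _ _).inv ≫ μ[X] ▷ X = μ[X] ≫ δ) :
    δ ≫ X ◁ δ = δ ≫ δ ▷ X ≫ (α_ X X X).hom := by
  -- A left-hand Frobenius relation determines `δ` by the element `δ(1)`: `δ(x) = δ(1) · x`.
  -- Coassociativity then reduces to the other Frobenius relation.
  have h : δ = 𝟙 _ ⊗≫ (η[X] ≫ δ) ▷ X ⊗≫ X ◁ μ[X] := by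
    calc
      δ = (λ_ X).inv ≫ η[X] ▷ X ≫ μ[X] ≫ δ := by simp
      _ = _ := by rw [← left]; monoidal
  symm
  calc
    _ = δ ≫ (𝟙 _ ⊗≫ (η[X] ≫ δ) ▷ X ⊗≫ X ◁ μ[X]) ▷ X ≫ (α_ X X X).hom := by rw [← h]
    _ = 𝟙 _ ⊗≫ (𝟙_ C ◁ δ ≫ (η[X] ≫ δ) ▷ (X ⊗ X)) ⊗≫ X ◁ μ[X] ▷ X ⊗≫ 𝟙 _ := by monoidal
    _ = 𝟙 _ ⊗≫ (η[X] ≫ δ) ▷ X ⊗≫ X ◁ (X ◁ δ ≫ (α_ _ _ _).inv ≫ μ[X] ▷ X) ⊗≫ 𝟙 _ := by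
      rw [whisker_exchange]; monoidal
    _ = (𝟙 _ ⊗≫ (η[X] ≫ δ) ▷ X ⊗≫ X ◁ μ[X]) ≫ X ◁ δ := by rw [right]; monoidal
    _ = _ := by rw [← h]

end Coassociativity

section MatrixAlgebra

variable {C : Type u} [Category.{v} C] [MonoidalCategory C] [Preadditive C]
  [MonoidalPreadditive C] {k : Type w} [Field k] [Linear k C]

namespace FrobeniusCategory

variable {b : k} {I : Type*} {F : FrobeniusCategory C k b I}
variable {R S T : Type*} [Fintype R] [Fintype S] [Fintype T]
  {r : R → I} {s : S → I} {t : T → I} {X : C}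

/-- The algebra of square matrices. -/
@[reducible]
def matMonObj (a : F.MatrixObj X r r) : MonObj X where
  one := matOne a
  mul := matMul a a a
  one_mul := matOne_matMul a a
  mul_one := matMul_matOne a a
  mul_assoc := matMul_assoc a a a a a a

/-- The Frobenius algebra of square matrices. -/
def matFrobenius (a : F.MatrixObj X r r) : Frobenius C :=
  letI := matMonObj a
  letI : ComonObj X :=
    { counit := matCounit a
      comul := matComul a a a
      counit_comul := matComul_matCounit_left a a
      comul_counit := matComul_matCounit_right a a
      comul_assoc := comul_assoc_of_frobenius (X := X) _ (matComul_matMul_left a a a a a a)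
        (matComul_matMul_right a a a a a a) }
  { alg := ⟨X⟩
    left_frobenius := matComul_matMul_left a a a a a a
    right_frobenius := matComul_matMul_right a a a a a a }

/-- The algebra `A` is an algebra of square matrices. -/
structure IsMatMon (A : Mon C) (a : F.MatrixObj A.X r r) : Prop where
  mul_eq : μ[A.X] = matMul a a a
  one_eq : η[A.X] = matOne a

theorem matFrobenius_isMatMon (a : F.MatrixObj X r r) : IsMatMon (matFrobenius a).alg a :=
  ⟨rfl, rfl⟩

variable {A B D : Mon C} {a : F.MatrixObj A.X r r} {b' : F.MatrixObj B.X s s}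
  {d : F.MatrixObj D.X t t}

/-- The bimodule of matrices of a given shape. -/
def matBimod (ha : IsMatMon A a) (hb : IsMatMon B b') (m : F.MatrixObj X r s) : Bimod A B where
  X := X
  actLeft := matMul a m m
  actRight := matMul m b' m
  one_actLeft := by rw [ha.one_eq, matOne_matMul]
  left_assoc := by rw [ha.mul_eq, matMul_assoc]
  actRight_one := by rw [hb.one_eq, matMul_matOne]
  right_assoc := by rw [hb.mul_eq, matMul_assoc m b' b' m b' m, Iso.inv_hom_id_assoc]
  middle_assoc := matMul_assoc _ _ _ _ _ _

variable (a b') in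
/-- The bimodule `M` is a bimodule of matrices. -/
structure IsMatBimod (M : Bimod A B) (m : F.MatrixObj M.X r s) : Prop where
  left_eq : M.actLeft = matMul a m m
  right_eq : M.actRight = matMul m b' m

theorem matBimod_isMatBimod (ha : IsMatMon A a) (hb : IsMatMon B b') (m : F.MatrixObj X r s) :
    IsMatBimod a b' (matBimod ha hb m) m :=
  ⟨rfl, rfl⟩

theorem IsMatMon.regular (ha : IsMatMon A a) : IsMatBimod a a (Bimod.regular A) a :=
  ⟨ha.mul_eq, ha.mul_eq⟩

variable [HasCoequalizers C] [∀ X : C, PreservesColimitsOfSize.{0, 0} (tensorLeft X)]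
  [∀ X : C, PreservesColimitsOfSize.{0, 0} (tensorRight X)] [MonoidalLinear k C]
  {M : Bimod A B} {N : Bimod B D} {K : Bimod A D} {m : F.MatrixObj M.X r s}
  {n : F.MatrixObj N.X s t} {l : F.MatrixObj K.X r t}

/-- Matrix multiplication as a morphism from the tensor product of bimodules. -/
def matTensorHom (hM : IsMatBimod a b' M m) (hN : IsMatBimod b' d N n)
    (hK : IsMatBimod a d K l) : M.tensorBimod N ⟶ K :=
  tensorDesc (matMul m n l) (by rw [hM.right_eq, hN.left_eq, matMul_assoc m b' n m n l])
    (by rw [hM.left_eq, hK.left_eq, matMul_assoc a m n m l l, Iso.inv_hom_id_assoc])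
    (by rw [hN.right_eq, hK.right_eq, matMul_assoc m n d l n l])

theorem tensorProj_matTensorHom (hM : IsMatBimod a b' M m) (hN : IsMatBimod b' d N n)
    (hK : IsMatBimod a d K l) : tensorProj M N ≫ (matTensorHom hM hN hK).hom = matMul m n l := by
  rw [matTensorHom, tensorProj_desc]

/-- Matrix multiplication as an isomorphism of bimodules. -/
def matTensorIso (hM : IsMatBimod a b' M m) (hN : IsMatBimod b' d N n)
    (hK : IsMatBimod a d K l) (hb : (Fintype.card S : k) * b ≠ 0) : M.tensorBimod N ≅ K :=
  bimodIsoOfHom (matTensorHom hM hN hK)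
    (((Fintype.card S : k) * b)⁻¹ • matComul l m n ≫ tensorProj M N)
    (by
      apply tensorBimod_hom_ext
      -- The Frobenius relation replaces product followed by coproduct by splitting the left factor
      -- into `M ⊗ B` and letting `B` act on `N`. Over `B` this action may be moved back to `M`,
      -- where coproduct followed by product is the scalar `|S| b`.
      have h := matComul_matMul_left m n l m b' n
      rw [← hN.left_eq] at h
      rw [matTensorHom, reassoc_of% tensorProj_desc, Linear.comp_smul, ← reassoc_of% h,
        ← tensorProj_balanced, hM.right_eq, ← comp_whiskerRight_assoc, matComul_comp_matMul,
        MonoidalLinear.smul_whiskerRight, Linear.smul_comp, smul_smul, inv_mul_cancel₀ hb]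
      simp)
    (by
      rw [matTensorHom, Linear.smul_comp, Category.assoc, tensorProj_desc, matComul_comp_matMul,
        smul_smul, inv_mul_cancel₀ hb, one_smul])

theorem tensorProj_matTensorIso (hM : IsMatBimod a b' M m) (hN : IsMatBimod b' d N n)
    (hK : IsMatBimod a d K l) (hb : (Fintype.card S : k) * b ≠ 0) :
    tensorProj M N ≫ (matTensorIso hM hN hK hb).hom.hom = matMul m n l :=
  tensorProj_matTensorHom hM hN hK

/-- Once the projections onto the tensor products are cancelled, both sides are the triple product
of a row, a column and a row, so the diagram is associativity of matrix multiplication. -/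
theorem matMorita_diagram {P : Bimod A B} {Q : Bimod B A} {p : F.MatrixObj P.X r s}
    {q : F.MatrixObj Q.X s r} (hP : IsMatBimod a b' P p)
    (f : P.tensorBimod Q ⟶ Bimod.regular A) (g : Q.tensorBimod P ⟶ Bimod.regular B)
    (hf : tensorProj P Q ≫ f.hom = matMul p q a) (hg : tensorProj Q P ≫ g.hom = matMul q p b') :
    Bimod.whiskerRight f P ≫ (Bimod.leftUnitorBimod P).hom =
      (Bimod.associatorBimod P Q P).hom ≫ Bimod.whiskerLeft P g ≫
        (Bimod.rightUnitorBimod P).hom := by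
  apply Bimod.hom_ext
  apply tensorBimod_hom_ext
  rw [← cancel_epi (tensorProj P Q ▷ P.X)]
  dsimp only [Bimod.comp_hom']
  rw [reassoc_of% tensorProj_associator, reassoc_of% tensorProj_whiskerLeft, reassoc_of% tensorProj_whiskerRight,
    tensorProj_leftUnitor, tensorProj_rightUnitor]
  have h₁ : tensorProj P Q ▷ P.X ≫ f.hom ▷ P.X = matMul p q a ▷ P.X :=
    (comp_whiskerRight _ _ _).symm.trans (congrArg (· ▷ P.X) hf)
  have h₂ : P.X ◁ tensorProj Q P ≫ P.X ◁ g.hom = P.X ◁ matMul q p b' :=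
    (whiskerLeft_comp _ _ _).symm.trans (congrArg (P.X ◁ ·) hg)
  refine (Category.assoc _ _ _).symm.trans ((congrArg (· ≫ P.actLeft) h₁).trans ?_)
  refine Eq.trans ?_ (congrArg (fun x => (α_ P.X Q.X P.X).hom ≫ x)
    ((congrArg (· ≫ P.actRight) h₂).symm.trans (Category.assoc _ _ _)))
  exact (by rw [hP.left_eq, hP.right_eq, matMul_assoc p q p a b' p] :
    matMul p q a ▷ P.X ≫ P.actLeft = (α_ P.X Q.X P.X).hom ≫ P.X ◁ matMul q p b' ≫ P.actRight)

/-- The Morita context between two algebras of matrices. -/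
def matMoritaContext (ha : IsMatMon A a) (hb : IsMatMon B b') {X' : C} (p : F.MatrixObj X r s)
    (q : F.MatrixObj X' s r) (hr : (Fintype.card R : k) * b ≠ 0)
    (hs : (Fintype.card S : k) * b ≠ 0) : MoritaContext A B where
  P := matBimod ha hb p
  P' := matBimod hb ha q
  f := matTensorIso (matBimod_isMatBimod ha hb p) (matBimod_isMatBimod hb ha q) ha.regular hs
  g := matTensorIso (matBimod_isMatBimod hb ha q) (matBimod_isMatBimod ha hb p) hb.regular hr
  left_diagram := matMorita_diagram (matBimod_isMatBimod ha hb p)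
    _ _ (tensorProj_matTensorIso _ _ _ _) (tensorProj_matTensorIso _ _ _ _)
  right_diagram := matMorita_diagram (matBimod_isMatBimod hb ha q)
    _ _ (tensorProj_matTensorIso _ _ _ _) (tensorProj_matTensorIso _ _ _ _)

end FrobeniusCategory

end MatrixAlgebra

/-! ## Reindexing of matrices -/

section MatrixMap

variable {C : Type u} [Category.{v} C] [MonoidalCategory C] [Preadditive C]
  [MonoidalPreadditive C] {k : Type w} [Field k] [Linear k C]

namespace FrobeniusCategory

variable {b : k} {I : Type*} {F : FrobeniusCategory C k b I}
variable {R S T R' S' T' : Type*} [Fintype R] [Fintype S] [Fintype T]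
  [Fintype R'] [Fintype S'] [Fintype T']
  {r : R → I} {s : S → I} {t : T → I} {r' : R' → I} {s' : S' → I} {t' : T' → I}
  {X Y Z X' Y' Z' : C}

section

variable (a' : F.MatrixObj X' r' s') (a : F.MatrixObj X r s) (ρ : R ≃ R') (σ : S ≃ S')
  (θ : ∀ i j, F.Y (r' (ρ i)) (s' (σ j)) ≅ F.Y (r i) (s j))

/-- Reindexing of rows and columns along bijections, with isomorphisms of the entries. -/
def matMap : X' ≅ X where
  hom := ∑ p : R × S, (a'.proj (ρ p.1, σ p.2) ≫ (θ p.1 p.2).hom) ≫ a.inj p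
  inv := ∑ p : R × S, a.proj p ≫ (θ p.1 p.2).inv ≫ a'.inj (ρ p.1, σ p.2)
  hom_inv_id := by
    rw [Preadditive.sum_comp]
    simp only [Category.assoc, a.inj_sum, Iso.hom_inv_id_assoc]
    rw [← a'.total]
    exact (Equiv.prodCongr ρ σ).sum_comp fun p => a'.proj p ≫ a'.inj p
  inv_hom_id := by
    refine a.hom_ext_proj fun p => ?_
    rw [Category.assoc, a.sum_proj, Preadditive.sum_comp, Category.id_comp]
    classical
    rw [Finset.sum_eq_single p]
    · simp
    · intro q _ hq
      have : (ρ q.1, σ q.2) ≠ (ρ p.1, σ p.2) := fun e => hq (by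
        simp only [Prod.mk.injEq, EmbeddingLike.apply_eq_iff_eq] at e
        exact Prod.ext e.1 e.2)
      simp only [Category.assoc]
      rw [← Category.assoc (a'.inj _), a'.inj_proj_ne this]
      simp
    · simp

theorem matMap_proj (i : R) (j : S) :
    (matMap a' a ρ σ θ).hom ≫ a.proj (i, j) = a'.proj (ρ i, σ j) ≫ (θ i j).hom :=
  a.sum_proj _ (i, j)

theorem inj_matMap (i : R) (j : S) :
    a'.inj (ρ i, σ j) ≫ (matMap a' a ρ σ θ).hom = (θ i j).hom ≫ a.inj (i, j) := by
  rw [← cancel_mono (matMap a' a ρ σ θ).inv, Category.assoc, Iso.hom_inv_id, Category.comp_id]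
  simp [matMap, a.inj_sum]

end

section

variable {a' : F.MatrixObj X' r' s'} {b' : F.MatrixObj Y' s' t'} {c' : F.MatrixObj Z' r' t'}
  {a : F.MatrixObj X r s} {b : F.MatrixObj Y s t} {c : F.MatrixObj Z r t}
  {ρ : R ≃ R'} {σ : S ≃ S'} {τ : T ≃ T'}
  {θ₁ : ∀ i j, F.Y (r' (ρ i)) (s' (σ j)) ≅ F.Y (r i) (s j)}
  {θ₂ : ∀ i j, F.Y (s' (σ i)) (t' (τ j)) ≅ F.Y (s i) (t j)}
  {θ₃ : ∀ i j, F.Y (r' (ρ i)) (t' (τ j)) ≅ F.Y (r i) (t j)}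

/-- The sum over the middle label is reindexed along `σ`. Thus compatibility with the products has
to be checked only on entries. -/
theorem matMul_matMap (h : ∀ i j l, ((θ₁ i j).hom ⊗ₘ (θ₂ j l).hom) ≫ F.mul (r i) (s j) (t l) =
      F.mul (r' (ρ i)) (s' (σ j)) (t' (τ l)) ≫ (θ₃ i l).hom) :
    matMul a' b' c' ≫ (matMap c' c ρ τ θ₃).hom =
      ((matMap a' a ρ σ θ₁).hom ⊗ₘ (matMap b' b σ τ θ₂).hom) ≫ matMul a b c := by
  refine c.hom_ext_proj fun ⟨i, l⟩ => ?_
  rw [Category.assoc, Category.assoc, matMap_proj, matMul_proj, ← Category.assoc, matMul_proj,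
    Preadditive.sum_comp, Preadditive.comp_sum, ← Equiv.sum_comp σ]
  refine Finset.sum_congr rfl fun j _ => ?_
  rw [tensorHom_comp_tensorHom_assoc, matMap_proj, matMap_proj,
    ← tensorHom_comp_tensorHom_assoc, h, Category.assoc]

theorem matComul_matMap (h : ∀ i j l, F.comul (r' (ρ i)) (s' (σ j)) (t' (τ l)) ≫
      ((θ₁ i j).hom ⊗ₘ (θ₂ j l).hom) = (θ₃ i l).hom ≫ F.comul (r i) (s j) (t l)) :
    matComul c' a' b' ≫ ((matMap a' a ρ σ θ₁).hom ⊗ₘ (matMap b' b σ τ θ₂).hom) =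
      (matMap c' c ρ τ θ₃).hom ≫ matComul c a b := by
  refine c'.hom_ext_inj fun ⟨i', l'⟩ => ?_
  obtain ⟨i, rfl⟩ := ρ.surjective i'
  obtain ⟨l, rfl⟩ := τ.surjective l'
  rw [reassoc_of% inj_matMap, inj_matComul, ← Category.assoc, inj_matComul,
    Preadditive.sum_comp, Preadditive.comp_sum, ← Equiv.sum_comp σ]
  refine Finset.sum_congr rfl fun j _ => ?_
  rw [Category.assoc, tensorHom_comp_tensorHom, inj_matMap, inj_matMap,
    ← tensorHom_comp_tensorHom, reassoc_of% h]

end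

section

variable {a' : F.MatrixObj X' r' r'} {a : F.MatrixObj X r r} {ρ : R ≃ R'}
  {θ : ∀ i j, F.Y (r' (ρ i)) (r' (ρ j)) ≅ F.Y (r i) (r j)}

theorem matOne_matMap (h : ∀ i, F.one (r' (ρ i)) ≫ (θ i i).hom = F.one (r i)) :
    matOne a' ≫ (matMap a' a ρ ρ θ).hom = matOne a := by
  rw [matOne, matOne, Preadditive.sum_comp, ← Equiv.sum_comp ρ]
  refine Finset.sum_congr rfl fun i _ => ?_
  rw [Category.assoc, inj_matMap, reassoc_of% h]

theorem matMap_matCounit (h : ∀ i, (θ i i).hom ≫ F.counit (r i) = F.counit (r' (ρ i))) :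
    (matMap a' a ρ ρ θ).hom ≫ matCounit a = matCounit a' := by
  rw [matCounit, matCounit, Preadditive.comp_sum, ← Equiv.sum_comp ρ]
  refine Finset.sum_congr rfl fun i _ => ?_
  rw [reassoc_of% matMap_proj, h]

end

end FrobeniusCategory

end MatrixMap

/-! ## Traces in sovereign categories -/

section Trace

variable {C : Type u} [Category.{v} C] [MonoidalCategory C] [Sovereign C]

/-- Sovereignty in the form needed for traces: a single morphism of dual objects slides `f` both
through the right coevaluation and through the left evaluation. -/
theorem exists_dual_hom {X Y : C} (f : X ⟶ Y) : ∃ n : dual Y ⟶ dual X,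
    coevR Y ≫ Y ◁ n = coevR X ≫ f ▷ dual X ∧ X ◁ n ≫ evL X = f ▷ dual Y ≫ evL Y := by
  refine ⟨rightMate (Sovereign.rightPairing X) (Sovereign.rightPairing Y) f, ?_, ?_⟩
  · exact @coevaluation_comp_rightAdjointMate C _ _ X Y
      (@HasRightDual.mk _ _ _ _ _ (Sovereign.rightPairing X))
      (@HasRightDual.mk _ _ _ _ _ (Sovereign.rightPairing Y)) f
  · rw [Sovereign.rightMate_eq_leftMate]
    exact @leftAdjointMate_comp_evaluation C _ _ X Y
      (@HasLeftDual.mk _ _ _ _ _ (Sovereign.leftPairing X))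
      (@HasLeftDual.mk _ _ _ _ _ (Sovereign.leftPairing Y)) f

theorem rightMate_comp {X X' Y Y' Z Z' : C} (p : ExactPairing X X') (q : ExactPairing Y Y')
    (s : ExactPairing Z Z') (f : X ⟶ Y) (g : Y ⟶ Z) :
    rightMate p s (f ≫ g) = rightMate q s g ≫ rightMate p q f :=
  @comp_rightAdjointMate C _ _ X Y Z (@HasRightDual.mk _ _ _ _ _ p)
    (@HasRightDual.mk _ _ _ _ _ q) (@HasRightDual.mk _ _ _ _ _ s) f g

theorem leftMate_comp {X X' Y Y' Z Z' : C} (p : ExactPairing X' X) (q : ExactPairing Y' Y)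
    (s : ExactPairing Z' Z) (f : X ⟶ Y) (g : Y ⟶ Z) :
    leftMate p s (f ≫ g) = leftMate q s g ≫ leftMate p q f :=
  @comp_leftAdjointMate C _ _ X Y Z (@HasLeftDual.mk _ _ _ _ _ p)
    (@HasLeftDual.mk _ _ _ _ _ q) (@HasLeftDual.mk _ _ _ _ _ s) f g

/-- The same for a morphism out of a tensor product, with `dual Y ⊗ dual X` in place of `dual (X ⊗
Y)`. The comparison isomorphisms of the two dualities agree, so here too one morphism is the mate
for both. -/
theorem exists_dual_hom_tensor {X Y Z : C} (f : X ⊗ Y ⟶ Z) : ∃ n : dual Z ⟶ dual Y ⊗ dual X,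
    coevR Z ≫ Z ◁ n =
        (coevR X ⊗≫ (X ◁ coevR Y) ▷ dual X ⊗≫ 𝟙 ((X ⊗ Y) ⊗ dual Y ⊗ dual X)) ≫
          f ▷ (dual Y ⊗ dual X) ∧
      (X ⊗ Y) ◁ n ≫ (𝟙 ((X ⊗ Y) ⊗ dual Y ⊗ dual X) ⊗≫ X ◁ (evL Y ▷ dual X) ⊗≫ evL X) =
        f ▷ dual Z ≫ evL Z := by
  let p := @ExactPairing.tensor C _ _ X Y (dual X) (dual Y) (Sovereign.rightPairing X)
    (Sovereign.rightPairing Y)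
  let q := @ExactPairing.tensor C _ _ (dual Y) (dual X) Y X (Sovereign.leftPairing Y)
    (Sovereign.leftPairing X)
  have h : rightMate p (Sovereign.rightPairing Z) f = leftMate q (Sovereign.leftPairing Z) f := by
    rw [← Category.id_comp f, rightMate_comp p (Sovereign.rightPairing (X ⊗ Y)),
      leftMate_comp q (Sovereign.leftPairing (X ⊗ Y)), Sovereign.rightMate_eq_leftMate,
      Sovereign.rightMate_tensor_eq_leftMate_tensor]
  refine ⟨rightMate p (Sovereign.rightPairing Z) f, ?_, ?_⟩
  · exact @coevaluation_comp_rightAdjointMate C _ _ (X ⊗ Y) Z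
      (@HasRightDual.mk _ _ _ _ _ p)
      (@HasRightDual.mk _ _ _ _ _ (Sovereign.rightPairing Z)) f
  · rw [h]
    exact @leftAdjointMate_comp_evaluation C _ _ (X ⊗ Y) Z
      (@HasLeftDual.mk _ _ _ _ _ q)
      (@HasLeftDual.mk _ _ _ _ _ (Sovereign.leftPairing Z)) f

/-- The partial trace `W ⟶ 1` of a morphism `W ⊗ X ⟶ X`. -/
def partialTrace {W X : C} (f : W ⊗ X ⟶ X) : W ⟶ 𝟙_ C :=
  (ρ_ _).inv ≫ W ◁ coevR X ≫ (α_ _ _ _).inv ≫ f ▷ dual X ≫ evL X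

/-- Cyclicity of the trace: `g` is moved around the loop by way of its dual morphism, which is the
same for both dualities. -/
theorem partialTrace_comp {W X Y : C} (f : W ⊗ X ⟶ Y) (g : Y ⟶ X) :
    partialTrace (f ≫ g) = partialTrace (W ◁ g ≫ f) := by
  obtain ⟨n, h₁, h₂⟩ := exists_dual_hom g
  rw [partialTrace, comp_whiskerRight_assoc, ← h₂, ← whisker_exchange_assoc,
    ← associator_inv_naturality_right_assoc, ← whiskerLeft_comp_assoc, h₁]
  simp [partialTrace]

theorem comp_partialTrace {V W X : C} (h : V ⟶ W) (f : W ⊗ X ⟶ X) :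
    h ≫ partialTrace f = partialTrace (h ▷ X ≫ f) := by
  rw [partialTrace, rightUnitor_inv_naturality_assoc, ← whisker_exchange_assoc]
  simp [partialTrace]

theorem partialTrace_sum [Preadditive C] [MonoidalPreadditive C] {W X : C} {J : Type*}
    (s : Finset J) (f : J → (W ⊗ X ⟶ X)) :
    partialTrace (∑ j ∈ s, f j) = ∑ j ∈ s, partialTrace (f j) := by
  simp only [partialTrace, sum_whiskerRight, Preadditive.sum_comp, Preadditive.comp_sum]

/-- The trace of the regular representation of an algebra is a symmetric form. -/
theorem exists_trace_dual {X : C} [MonObj X] : ∃ ψ : X ⟶ dual X,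
    X ◁ ψ ≫ evL X = μ[X] ≫ partialTrace μ[X] ∧ ψ ▷ X ≫ evR X = μ[X] ≫ partialTrace μ[X] := by
  obtain ⟨n, hR, hL⟩ := exists_dual_hom_tensor μ[X]
  -- In elements, `tr(x(yz)) = tr((xy)z)` as traces over `z`: acting successively with `x` and `y`
  -- has the trace form evaluated at `xy`.
  have key : 𝟙 (X ⊗ X) ⊗≫ X ◁ X ◁ coevR X ⊗≫ X ◁ μ[X] ▷ dual X ⊗≫ μ[X] ▷ dual X ≫ evL X =
      μ[X] ≫ partialTrace μ[X] := by
    calc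
      _ = 𝟙 _ ⊗≫ X ◁ X ◁ coevR X ⊗≫ ((α_ X X X).hom ≫ X ◁ μ[X] ≫ μ[X]) ▷ dual X ≫ evL X := by
        monoidal
      _ = 𝟙 _ ⊗≫ ((X ⊗ X) ◁ coevR X ≫ μ[X] ▷ (X ⊗ dual X)) ⊗≫ μ[X] ▷ dual X ≫ evL X := by
        rw [← MonObj.mul_assoc]; monoidal
      _ = _ := by rw [whisker_exchange, partialTrace]; monoidal
  -- The witness sends `x` to the functional `y ↦ tr(yx ·)`, written with the dual `n` of the
  -- product so that `y` enters only through its dual slot. Read with the left evaluation it gives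
  -- `tr(yx ·)` for `y ⊗ x`; read with the right evaluation, and with the other property of `n`, it
  -- gives `tr(xy ·)` for `x ⊗ y`.
  refine ⟨𝟙 X ⊗≫ X ◁ coevR X ⊗≫ μ[X] ▷ dual X ⊗≫ X ◁ n ⊗≫ evL X ▷ dual X ⊗≫ 𝟙 (dual X), ?_, ?_⟩
  · calc
      _ = 𝟙 _ ⊗≫ X ◁ X ◁ coevR X ⊗≫ X ◁ μ[X] ▷ dual X ⊗≫ (X ⊗ X) ◁ n ≫
          (𝟙 ((X ⊗ X) ⊗ dual X ⊗ dual X) ⊗≫ X ◁ (evL X ▷ dual X) ⊗≫ evL X) := by monoidal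
      _ = _ := by rw [hL, ← key]
  -- Contracting the last dual factor of `n` with an element `y` turns the coevaluation into `Σ y eᵢ
  -- ⊗ eⁱ`.
  · have h : 𝟙 X ⊗≫ (coevR X ≫ X ◁ n) ▷ X ⊗≫ (X ⊗ dual X) ◁ evR X ⊗≫ 𝟙 (X ⊗ dual X) =
        𝟙 X ⊗≫ X ◁ coevR X ⊗≫ μ[X] ▷ dual X := by
      rw [hR]
      calc
        _ = 𝟙 _ ⊗≫ coevR X ▷ X ⊗≫ X ◁ coevR X ▷ (dual X ⊗ X) ⊗≫
            (μ[X] ▷ (dual X ⊗ (dual X ⊗ X)) ≫ X ◁ (dual X ◁ evR X)) ⊗≫ 𝟙 _ := by monoidal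
        _ = 𝟙 _ ⊗≫ coevR X ▷ X ⊗≫ X ◁ (coevR X ▷ (dual X ⊗ X) ≫ (X ⊗ dual X) ◁ evR X) ⊗≫
            μ[X] ▷ dual X ⊗≫ 𝟙 _ := by rw [← whisker_exchange]; monoidal
        _ = 𝟙 _ ⊗≫ (coevR X ▷ X ⊗≫ X ◁ evR X) ⊗≫ X ◁ coevR X ⊗≫ μ[X] ▷ dual X ⊗≫ 𝟙 _ := by
          rw [← whisker_exchange]; monoidal
        _ = _ := by rw [coevR_evR]; monoidal
    calc
      _ = 𝟙 _ ⊗≫ X ◁ coevR X ▷ X ⊗≫ μ[X] ▷ dual X ▷ X ⊗≫ X ◁ n ▷ X ⊗≫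
          (evL X ▷ (dual X ⊗ X) ≫ 𝟙_ C ◁ evR X) ⊗≫ 𝟙 _ := by monoidal
      _ = 𝟙 _ ⊗≫ X ◁ coevR X ▷ X ⊗≫ (μ[X] ▷ (dual X ⊗ X) ≫ X ◁ (n ▷ X ⊗≫ dual X ◁ evR X)) ⊗≫
          evL X ⊗≫ 𝟙 _ := by rw [← whisker_exchange]; monoidal
      _ = 𝟙 _ ⊗≫ X ◁ (𝟙 X ⊗≫ (coevR X ≫ X ◁ n) ▷ X ⊗≫ (X ⊗ dual X) ◁ evR X ⊗≫
          𝟙 (X ⊗ dual X)) ⊗≫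
          μ[X] ▷ dual X ≫ evL X ⊗≫ 𝟙 _ := by rw [← whisker_exchange]; monoidal
      _ = _ := by rw [h, ← key]; monoidal

/-- The zigzag identities show that `Phi1` is determined by the right evaluation and `Phi2` by the
left one, so both equal `ψ`. -/
theorem Frobenius.isSymmetric_of_dual (A : Frobenius C) (ψ : A.alg.X ⟶ dual A.alg.X)
    (hL : A.alg.X ◁ ψ ≫ evL A.alg.X = μ[A.alg.X] ≫ ε[A.alg.X])
    (hR : ψ ▷ A.alg.X ≫ evR A.alg.X = μ[A.alg.X] ≫ ε[A.alg.X]) : A.IsSymmetric := by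
  have h₁ : A.Phi1 = ψ := by
    rw [Frobenius.Phi1, ← hR]
    calc
      _ = 𝟙 _ ⊗≫ (A.alg.X ◁ coevR A.alg.X ≫ ψ ▷ (A.alg.X ⊗ dual A.alg.X)) ⊗≫
        evR A.alg.X ▷ dual A.alg.X ⊗≫ 𝟙 _ := by monoidal
      _ = 𝟙 _ ⊗≫ ψ ⊗≫ (dual A.alg.X ◁ coevR A.alg.X ⊗≫ evR A.alg.X ▷ dual A.alg.X) ⊗≫ 𝟙 _ := by
        rw [whisker_exchange]; monoidal
      _ = _ := by rw [coevR_evR_dual]; monoidal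
  have h₂ : A.Phi2 = ψ := by
    rw [Frobenius.Phi2, ← hL]
    calc
      _ = 𝟙 _ ⊗≫ (coevL A.alg.X ▷ A.alg.X ≫ (dual A.alg.X ⊗ A.alg.X) ◁ ψ) ⊗≫
        dual A.alg.X ◁ evL A.alg.X ⊗≫ 𝟙 _ := by monoidal
      _ = 𝟙 _ ⊗≫ ψ ⊗≫ (coevL A.alg.X ▷ dual A.alg.X ⊗≫ dual A.alg.X ◁ evL A.alg.X) ⊗≫ 𝟙 _ := by
        rw [← whisker_exchange]; monoidal
      _ = _ := by rw [coevL_evL_dual]; monoidal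
  exact h₁.trans h₂.symm

/-- A Frobenius algebra whose counit is proportional to the trace of the regular representation is
symmetric. -/
theorem Frobenius.isSymmetric_of_trace {k : Type w} [Field k] [Preadditive C] [Linear k C]
    [MonoidalPreadditive C] [MonoidalLinear k C] (A : Frobenius C) {c : k} (hc : c ≠ 0)
    (h : partialTrace μ[A.alg.X] = c • ε[A.alg.X]) : A.IsSymmetric := by
  obtain ⟨ψ, hL, hR⟩ := exists_trace_dual (X := A.alg.X)
  refine A.isSymmetric_of_dual (c⁻¹ • ψ) ?_ ?_
  · rw [MonoidalLinear.whiskerLeft_smul, Linear.smul_comp, hL, h, Linear.comp_smul, smul_smul,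
      inv_mul_cancel₀ hc, one_smul]
  · rw [MonoidalLinear.smul_whiskerRight, Linear.smul_comp, hR, h, Linear.comp_smul, smul_smul,
      inv_mul_cancel₀ hc, one_smul]

end Trace

/-! ## Products and coproducts of bimodules over a special Frobenius algebra -/

section BimodMul

variable {C : Type u} [Category.{v} C] [MonoidalCategory C]

/-- The element `Δ(1)` is central, `a Δ(1) = Δ(1) a`, since both sides are `Δ(a)`. -/
theorem Frobenius.casimir (A : Frobenius C) :
    (ρ_ _).inv ≫ A.alg.X ◁ (η[A.alg.X] ≫ Δ[A.alg.X]) ≫ (α_ _ _ _).inv ≫ μ[A.alg.X] ▷ A.alg.X =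
      (λ_ _).inv ≫ (η[A.alg.X] ≫ Δ[A.alg.X]) ▷ A.alg.X ≫ (α_ _ _ _).hom ≫
        A.alg.X ◁ μ[A.alg.X] := by
  rw [whiskerLeft_comp_assoc, A.right_frobenius, comp_whiskerRight_assoc, A.left_frobenius]
  simp

theorem Frobenius.casimir_counit (A : Frobenius C) :
    (ρ_ _).inv ≫ A.alg.X ◁ (η[A.alg.X] ≫ Δ[A.alg.X]) ≫ (α_ _ _ _).inv ≫
      (μ[A.alg.X] ≫ ε[A.alg.X]) ▷ A.alg.X = (λ_ _).inv := by
  rw [comp_whiskerRight, whiskerLeft_comp_assoc, reassoc_of% A.right_frobenius]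
  simp

theorem Frobenius.counit_casimir (A : Frobenius C) :
    (λ_ _).inv ≫ (η[A.alg.X] ≫ Δ[A.alg.X]) ▷ A.alg.X ≫ (α_ _ _ _).hom ≫
      A.alg.X ◁ (μ[A.alg.X] ≫ ε[A.alg.X]) = (ρ_ _).inv := by
  rw [whiskerLeft_comp, comp_whiskerRight_assoc, reassoc_of% A.left_frobenius]
  simp

variable {A : Frobenius C} {B D E : Mon C}

/-- The endomorphism of `M ⊗ N` inserting `Δ ∘ η` in the middle and acting with it. -/
def insertCasimir (M : Bimod B A.alg) (N : Bimod A.alg D) : M.X ⊗ N.X ⟶ M.X ⊗ N.X :=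
  𝟙 _ ⊗≫ M.X ◁ (η[A.alg.X] ≫ Δ[A.alg.X]) ▷ N.X ⊗≫ M.actRight ▷ (A.alg.X ⊗ N.X) ≫
    M.X ◁ N.actLeft

/-- Centrality of the Casimir element lets a scalar pass from its left leg, acting on `M`, to its
right leg, acting on `N`. Hence insertion factors through `M ⊗_A N`. -/
theorem insertCasimir_balanced (M : Bimod B A.alg) (N : Bimod A.alg D) :
    M.actRight ▷ N.X ≫ insertCasimir M N =
      (α_ _ _ _).hom ≫ M.X ◁ N.actLeft ≫ insertCasimir M N := by
  set e := η[A.alg.X] ≫ Δ[A.alg.X] with he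
  calc
    _ = 𝟙 _ ⊗≫ (M.actRight ▷ (𝟙_ C ⊗ N.X) ≫ M.X ◁ e ▷ N.X) ⊗≫ M.actRight ▷ (A.alg.X ⊗ N.X) ≫
        M.X ◁ N.actLeft := by rw [insertCasimir]; monoidal
    _ = 𝟙 _ ⊗≫ (M.X ⊗ A.alg.X) ◁ e ▷ N.X ⊗≫ ((α_ _ _ _).inv ≫ M.actRight ▷ A.alg.X ≫ M.actRight) ▷
        (A.alg.X ⊗ N.X) ≫ M.X ◁ N.actLeft := by rw [← whisker_exchange]; monoidal
    _ = 𝟙 _ ⊗≫ M.X ◁ ((ρ_ _).inv ≫ A.alg.X ◁ e ≫ (α_ _ _ _).inv ≫ μ ▷ A.alg.X) ▷ N.X ⊗≫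
        M.actRight ▷ (A.alg.X ⊗ N.X) ≫ M.X ◁ N.actLeft := by rw [← Bimod.right_assoc]; monoidal
    _ = 𝟙 _ ⊗≫ M.X ◁ e ▷ A.alg.X ▷ N.X ⊗≫ ((M.X ⊗ A.alg.X) ◁ (μ ▷ N.X) ≫
        M.actRight ▷ (A.alg.X ⊗ N.X)) ≫ M.X ◁ N.actLeft := by rw [he, A.casimir]; monoidal
    _ = 𝟙 _ ⊗≫ M.X ◁ e ▷ A.alg.X ▷ N.X ⊗≫ M.actRight ▷ ((A.alg.X ⊗ A.alg.X) ⊗ N.X) ≫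
        M.X ◁ (μ ▷ N.X ≫ N.actLeft) := by rw [whisker_exchange]; monoidal
    _ = 𝟙 _ ⊗≫ M.X ◁ e ▷ (A.alg.X ⊗ N.X) ⊗≫ (M.actRight ▷ (A.alg.X ⊗ A.alg.X ⊗ N.X) ≫
        M.X ◁ A.alg.X ◁ N.actLeft) ≫ M.X ◁ N.actLeft := by rw [Bimod.left_assoc]; monoidal
    _ = 𝟙 _ ⊗≫ M.X ◁ (e ▷ (A.alg.X ⊗ N.X) ≫ (A.alg.X ⊗ A.alg.X) ◁ N.actLeft) ⊗≫
        M.actRight ▷ (A.alg.X ⊗ N.X) ≫ M.X ◁ N.actLeft := by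
      rw [← whisker_exchange]; monoidal
    _ = _ := by rw [← whisker_exchange, insertCasimir]; monoidal

/-- The Casimir element touches `M` only through its right action, with which `f` commutes. -/
theorem whiskerLeft_insertCasimir {M : Bimod E A.alg} {K : Bimod B A.alg} {N : Bimod A.alg D} {Z : C}
    (f : Z ⊗ M.X ⟶ K.X)
    (h : f ▷ A.alg.X ≫ K.actRight = (α_ _ _ _).hom ≫ Z ◁ M.actRight ≫ f) :
    Z ◁ insertCasimir M N ≫ (α_ _ _ _).inv ≫ f ▷ N.X =
      (α_ _ _ _).inv ≫ f ▷ N.X ≫ insertCasimir K N := by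
  set e := η[A.alg.X] ≫ Δ[A.alg.X] with he
  symm
  calc
    _ = 𝟙 _ ⊗≫ (f ▷ (𝟙_ C ⊗ N.X) ≫ K.X ◁ (e ▷ N.X)) ⊗≫ K.actRight ▷ (A.alg.X ⊗ N.X) ≫
        K.X ◁ N.actLeft := by rw [insertCasimir]; monoidal
    _ = 𝟙 _ ⊗≫ Z ◁ M.X ◁ (e ▷ N.X) ⊗≫ (f ▷ A.alg.X ≫ K.actRight) ▷ (A.alg.X ⊗ N.X) ≫
        K.X ◁ N.actLeft := by rw [← whisker_exchange]; monoidal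
    _ = 𝟙 _ ⊗≫ Z ◁ M.X ◁ (e ▷ N.X) ⊗≫ Z ◁ M.actRight ▷ (A.alg.X ⊗ N.X) ⊗≫
        (f ▷ (A.alg.X ⊗ N.X) ≫ K.X ◁ N.actLeft) := by rw [h]; monoidal
    _ = _ := by rw [← whisker_exchange, insertCasimir]; monoidal

theorem whiskerRight_insertCasimir {M : Bimod B A.alg} {N : Bimod A.alg D} {K : Bimod A.alg E} {Z : C}
    (f : N.X ⊗ Z ⟶ K.X)
    (h : A.alg.X ◁ f ≫ K.actLeft = (α_ _ _ _).inv ≫ N.actLeft ▷ Z ≫ f) :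
    insertCasimir M N ▷ Z ≫ (α_ _ _ _).hom ≫ M.X ◁ f =
      (α_ _ _ _).hom ≫ M.X ◁ f ≫ insertCasimir M K := by
  set e := η[A.alg.X] ≫ Δ[A.alg.X] with he
  symm
  calc
    _ = 𝟙 _ ⊗≫ M.X ◁ (𝟙_ C ◁ f ≫ e ▷ K.X) ⊗≫ M.actRight ▷ (A.alg.X ⊗ K.X) ≫
        M.X ◁ K.actLeft := by rw [insertCasimir]; monoidal
    _ = 𝟙 _ ⊗≫ M.X ◁ e ▷ (N.X ⊗ Z) ⊗≫ ((M.X ⊗ A.alg.X) ◁ A.alg.X ◁ f ≫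
        M.actRight ▷ (A.alg.X ⊗ K.X)) ≫ M.X ◁ K.actLeft := by rw [whisker_exchange]; monoidal
    _ = 𝟙 _ ⊗≫ M.X ◁ e ▷ (N.X ⊗ Z) ⊗≫ M.actRight ▷ (A.alg.X ⊗ N.X ⊗ Z) ≫
        M.X ◁ (A.alg.X ◁ f ≫ K.actLeft) := by rw [whisker_exchange]; monoidal
    _ = _ := by rw [h, insertCasimir]; monoidal

variable [HasCoequalizers C] [∀ X : C, PreservesColimitsOfSize.{0, 0} (tensorLeft X)]
  [∀ X : C, PreservesColimitsOfSize.{0, 0} (tensorRight X)]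

/-- The morphism `M ⊗_A N ⟶ M ⊗ N` induced by `insertCasimir`. -/
def tensorSection (M : Bimod B A.alg) (N : Bimod A.alg D) : (M.tensorBimod N).X ⟶ M.X ⊗ N.X :=
  tensorDescHom (insertCasimir M N) (insertCasimir_balanced M N)

theorem tensorProj_section (M : Bimod B A.alg) (N : Bimod A.alg D) :
    tensorProj M N ≫ tensorSection M N = insertCasimir M N :=
  tensorProj_descHom _ (insertCasimir_balanced M N)

variable {k : Type w} [Field k] [Preadditive C] [Linear k C] [MonoidalPreadditive C]
  [MonoidalLinear k C]

/-- Over `A` the two legs of the Casimir element may be multiplied together, and `m ∘ Δ = βA id`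
yields the factor. -/
theorem insertCasimir_tensorProj {βA β1 : k} (hA : A.IsSpecialWith βA β1) (M : Bimod B A.alg)
    (N : Bimod A.alg D) : insertCasimir M N ≫ tensorProj M N = βA • tensorProj M N := by
  set e := η[A.alg.X] ≫ Δ[A.alg.X] with he
  have h : e ≫ μ = βA • η[A.alg.X] := by
    rw [he, Category.assoc, hA.comul_mul, Linear.comp_smul, Category.comp_id]
  calc
    _ = 𝟙 _ ⊗≫ M.X ◁ e ▷ N.X ⊗≫ M.actRight ▷ (A.alg.X ⊗ N.X) ≫
        (M.X ◁ N.actLeft ≫ tensorProj M N) := by rw [insertCasimir]; monoidal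
    _ = 𝟙 _ ⊗≫ M.X ◁ e ▷ N.X ⊗≫ ((α_ _ _ _).inv ≫ M.actRight ▷ A.alg.X ≫ M.actRight) ▷ N.X ≫
        tensorProj M N := by
      rw [(Iso.eq_inv_comp _).2 (tensorProj_balanced M N).symm]; monoidal
    _ = 𝟙 _ ⊗≫ M.X ◁ (e ≫ μ) ▷ N.X ⊗≫ M.actRight ▷ N.X ≫ tensorProj M N := by
      rw [← Bimod.right_assoc]; monoidal
    _ = βA • ((𝟙 _ ⊗≫ M.X ◁ η[A.alg.X] ▷ N.X ⊗≫ M.actRight ▷ N.X) ≫ tensorProj M N) := by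
      rw [h]; simp [monoidalComp]
    _ = βA • ((𝟙 _ ⊗≫ (M.X ◁ η[A.alg.X] ≫ M.actRight) ▷ N.X) ≫ tensorProj M N) := by
      congr 2; monoidal
    _ = _ := by rw [Bimod.actRight_one]; simp [monoidalComp]

theorem tensorSection_proj {βA β1 : k} (hA : A.IsSpecialWith βA β1) (M : Bimod B A.alg)
    (N : Bimod A.alg D) : tensorSection M N ≫ tensorProj M N = βA • 𝟙 _ := by
  apply tensorBimod_hom_ext
  rw [reassoc_of% tensorProj_section, insertCasimir_tensorProj hA, Linear.comp_smul, Category.comp_id]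

section

variable {M : Bimod B A.alg} {N : Bimod A.alg D} {K : Bimod B D}

/-- The multiple by `c` of the product `M ⊗ N ⟶ K` given by an isomorphism `M ⊗_A N ≅ K`. -/
def bimodMul (φ : M.tensorBimod N ≅ K) (c : kˣ) : M.X ⊗ N.X ⟶ K.X :=
  (c : k) • (tensorProj M N ≫ φ.hom.hom)

/-- The coproduct `K ⟶ M ⊗ N` belonging to `bimodMul`. -/
def bimodComul (φ : M.tensorBimod N ≅ K) (c : kˣ) : K.X ⟶ M.X ⊗ N.X :=
  (↑c⁻¹ : k) • (φ.inv.hom ≫ tensorSection M N)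

variable (φ : M.tensorBimod N ≅ K) (c : kˣ)

/-- The isomorphism and the scalar cancel, so product followed by coproduct depends only on `M` and
`N`. This is what reduces the Frobenius relations to associativity. -/
theorem bimodMul_comul : bimodMul φ c ≫ bimodComul φ c = insertCasimir M N := by
  have h : φ.hom.hom ≫ φ.inv.hom = 𝟙 _ := congrArg Bimod.Hom.hom φ.hom_inv_id
  rw [bimodMul, bimodComul, Linear.smul_comp, Linear.comp_smul, smul_smul, c.mul_inv, one_smul,
    Category.assoc, reassoc_of% h, tensorProj_section]

theorem bimodComul_mul {βA β1 : k} (hA : A.IsSpecialWith βA β1) :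
    bimodComul φ c ≫ bimodMul φ c = βA • 𝟙 _ := by
  have h : φ.inv.hom ≫ φ.hom.hom = 𝟙 _ := congrArg Bimod.Hom.hom φ.inv_hom_id
  rw [bimodMul, bimodComul, Linear.smul_comp, Linear.comp_smul, smul_smul, c.inv_mul, one_smul,
    Category.assoc, reassoc_of% tensorSection_proj hA, Linear.smul_comp, Linear.comp_smul,
    Category.id_comp, h]

theorem bimodMul_left : B.X ◁ bimodMul φ c ≫ K.actLeft =
    (α_ _ _ _).inv ≫ M.actLeft ▷ N.X ≫ bimodMul φ c := by
  have h := φ.hom.left_act_hom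
  rw [bimodMul, MonoidalLinear.whiskerLeft_smul, Linear.smul_comp, whiskerLeft_comp_assoc, ← h,
    reassoc_of% whiskerLeft_tensorProj_actLeft, Linear.comp_smul, Linear.comp_smul]

theorem bimodMul_right : bimodMul φ c ▷ D.X ≫ K.actRight =
    (α_ _ _ _).hom ≫ M.X ◁ N.actRight ≫ bimodMul φ c := by
  have h := φ.hom.right_act_hom
  rw [bimodMul, MonoidalLinear.smul_whiskerRight, Linear.smul_comp, comp_whiskerRight_assoc, ← h,
    reassoc_of% tensorProj_whiskerRight_actRight, Linear.comp_smul, Linear.comp_smul]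

include φ c in
theorem epi_bimodMul {βA β1 : k} (hA : A.IsSpecialWith βA β1) : IsSplitEpi (bimodMul φ c) :=
  ⟨⟨βA⁻¹ • bimodComul φ c, by
    rw [Linear.smul_comp, bimodComul_mul φ c hA, smul_smul, inv_mul_cancel₀ hA.betaA_ne_zero,
      one_smul]⟩⟩

end

section

variable {M : Bimod B A.alg} {N : Bimod A.alg A.alg} {P : Bimod A.alg D} {MN : Bimod B A.alg}
  {NP : Bimod A.alg D} {K : Bimod B D} {φ : M.tensorBimod N ≅ MN} {χ : N.tensorBimod P ≅ NP}
  {φ' : MN.tensorBimod P ≅ K} {χ' : M.tensorBimod NP ≅ K} {a b c d : kˣ}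

/-- The product `bimodMul χ c` is a split epimorphism, so it may be composed in front. There product
followed by coproduct becomes an insertion of the Casimir element, which slides past `bimodMul φ a`;
the rest is associativity. -/
theorem bimodMul_frobenius_right {βA β1 : k} (hA : A.IsSpecialWith βA β1)
    (h : bimodMul φ a ▷ P.X ≫ bimodMul φ' b =
      (α_ _ _ _).hom ≫ M.X ◁ bimodMul χ c ≫ bimodMul χ' d) :
    M.X ◁ bimodComul χ c ≫ (α_ _ _ _).inv ≫ bimodMul φ a ▷ P.X =
      bimodMul χ' d ≫ bimodComul φ' b := by
  have := epi_bimodMul χ c hA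
  have : Epi (M.X ◁ bimodMul χ c) := inferInstanceAs (Epi ((tensorLeft M.X).map (bimodMul χ c)))
  rw [← cancel_epi (M.X ◁ bimodMul χ c), ← whiskerLeft_comp_assoc, bimodMul_comul,
    whiskerLeft_insertCasimir _ (bimodMul_right φ a), ← bimodMul_comul φ' b, reassoc_of% h,
    Iso.inv_hom_id_assoc]

theorem bimodMul_frobenius_left {βA β1 : k} (hA : A.IsSpecialWith βA β1)
    (h : bimodMul φ a ▷ P.X ≫ bimodMul φ' b =
      (α_ _ _ _).hom ≫ M.X ◁ bimodMul χ c ≫ bimodMul χ' d) :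
    bimodComul φ a ▷ P.X ≫ (α_ _ _ _).hom ≫ M.X ◁ bimodMul χ c =
      bimodMul φ' b ≫ bimodComul χ' d := by
  have := epi_bimodMul φ a hA
  have : Epi (bimodMul φ a ▷ P.X) := inferInstanceAs (Epi ((tensorRight P.X).map (bimodMul φ a)))
  rw [← cancel_epi (bimodMul φ a ▷ P.X), ← comp_whiskerRight_assoc, bimodMul_comul,
    whiskerRight_insertCasimir _ (bimodMul_left χ c), ← bimodMul_comul χ' d, reassoc_of% h]

end

/-- After composition with the split epimorphism `bimodMul φ c` the Casimir element appears. The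
counit absorbs its left leg by `casimir_counit`, leaving the left action on `N`. -/
theorem bimodComul_counit_left {βA β1 : k} (hA : A.IsSpecialWith βA β1)
    {M : Bimod A.alg A.alg} {N : Bimod A.alg D} (φ : M.tensorBimod N ≅ N) (c : kˣ)
    (f : M ⟶ Bimod.regular A.alg) (f' : M.X ⟶ A.alg.X) (hf : f.hom = f')
    (h : bimodMul φ c = f' ▷ N.X ≫ N.actLeft) :
    bimodComul φ c ≫ (f' ≫ ε[A.alg.X]) ▷ N.X = (λ_ _).inv := by
  have := epi_bimodMul φ c hA
  have hf' : M.actRight ≫ f' = f' ▷ A.alg.X ≫ μ := by rw [← hf]; exact f.right_act_hom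
  rw [← cancel_epi (bimodMul φ c), reassoc_of% bimodMul_comul, h]
  set e := η[A.alg.X] ≫ Δ[A.alg.X] with he
  calc
    _ = 𝟙 _ ⊗≫ M.X ◁ e ▷ N.X ⊗≫ M.actRight ▷ (A.alg.X ⊗ N.X) ≫
        (M.X ◁ N.actLeft ≫ (f' ≫ ε[A.alg.X]) ▷ N.X) := by rw [insertCasimir]; monoidal
    _ = 𝟙 _ ⊗≫ M.X ◁ e ▷ N.X ⊗≫ ((M.actRight ≫ f') ≫ ε[A.alg.X]) ▷ (A.alg.X ⊗ N.X) ⊗≫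
        N.actLeft ⊗≫ 𝟙 _ := by rw [whisker_exchange]; monoidal
    _ = 𝟙 _ ⊗≫ (M.X ◁ e ≫ f' ▷ (A.alg.X ⊗ A.alg.X)) ▷ N.X ⊗≫
        (μ ≫ ε[A.alg.X]) ▷ (A.alg.X ⊗ N.X) ⊗≫ N.actLeft ⊗≫ 𝟙 _ := by rw [hf']; monoidal
    _ = 𝟙 _ ⊗≫ f' ▷ N.X ⊗≫ ((ρ_ _).inv ≫ A.alg.X ◁ e ≫ (α_ _ _ _).inv ≫
        (μ ≫ ε[A.alg.X]) ▷ A.alg.X) ▷ N.X ⊗≫ N.actLeft ⊗≫ 𝟙 _ := by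
      rw [whisker_exchange]; monoidal
    _ = _ := by rw [he, A.casimir_counit]; monoidal

theorem bimodComul_counit_right {βA β1 : k} (hA : A.IsSpecialWith βA β1)
    {M : Bimod B A.alg} {N : Bimod A.alg A.alg} (φ : M.tensorBimod N ≅ M) (c : kˣ)
    (f : N ⟶ Bimod.regular A.alg) (f' : N.X ⟶ A.alg.X) (hf : f.hom = f')
    (h : bimodMul φ c = M.X ◁ f' ≫ M.actRight) :
    bimodComul φ c ≫ M.X ◁ (f' ≫ ε[A.alg.X]) = (ρ_ _).inv := by
  have := epi_bimodMul φ c hA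
  have hf' : N.actLeft ≫ f' = A.alg.X ◁ f' ≫ μ := by rw [← hf]; exact f.left_act_hom
  rw [← cancel_epi (bimodMul φ c), reassoc_of% bimodMul_comul, h]
  set e := η[A.alg.X] ≫ Δ[A.alg.X] with he
  calc
    _ = 𝟙 _ ⊗≫ M.X ◁ e ▷ N.X ⊗≫ (M.actRight ▷ (A.alg.X ⊗ N.X) ≫
        M.X ◁ ((N.actLeft ≫ f') ≫ ε[A.alg.X])) := by rw [insertCasimir]; monoidal
    _ = 𝟙 _ ⊗≫ M.X ◁ (e ▷ N.X ≫ (A.alg.X ⊗ A.alg.X) ◁ f') ⊗≫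
        M.X ◁ A.alg.X ◁ (μ ≫ ε[A.alg.X]) ⊗≫ M.actRight ⊗≫ 𝟙 _ := by
      rw [← whisker_exchange, hf']; monoidal
    _ = 𝟙 _ ⊗≫ M.X ◁ f' ⊗≫ M.X ◁ ((λ_ _).inv ≫ e ▷ A.alg.X ≫ (α_ _ _ _).hom ≫
        A.alg.X ◁ (μ ≫ ε[A.alg.X])) ⊗≫ M.actRight ⊗≫ 𝟙 _ := by
      rw [← whisker_exchange]; monoidal
    _ = _ := by rw [he, A.counit_casimir]; monoidal

end BimodMul

/-! ## The Frobenius algebra with several objects of a trivialised subgroup -/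

section PicFrobenius

variable {C : Type u} [Category.{v} C] [MonoidalCategory C] [HasCoequalizers C]
  [∀ X : C, PreservesColimitsOfSize.{0, 0} (tensorLeft X)]
  [∀ X : C, PreservesColimitsOfSize.{0, 0} (tensorRight X)]
  [Preadditive C] [MonoidalPreadditive C] {k : Type w} [Field k] [Linear k C]
  [MonoidalLinear k C]

namespace PicBasis

variable {A : Mon C} (β : PicBasis A) {H : Subgroup (Pic A)}

/-- The isomorphism `L_s ≅ L_t` for `s = t`. -/
def castIso {s t : H} (h : s = t) : β.L s ≅ β.L t := eqToIso (by rw [h])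

/-- The basis isomorphism `L_s ⊗_A L_t ≅ L_u` for `s * t = u`. -/
def tensorIso (s t u : H) (h : s * t = u) : (β.L s).tensorBimod (β.L t) ≅ β.L u :=
  β.b s t ≪≫ β.castIso h

/-- The isomorphism `L_s ≅ A` for `s = 1`. -/
def unitAt (s : H) (h : s = 1) : β.L s ≅ Bimod.regular A := β.castIso h ≪≫ β.unitIso

/-- Products of indices are variables tied by equations, so that indices such as `ij⁻¹ · jl⁻¹ =
il⁻¹` can be used without transports. Substituting the equations leaves the defining relation of
`ψ`. -/
theorem tensorIso_assoc {ψ : Pic A → Pic A → Pic A → kˣ} (hψ : β.DescribesAssociator ψ)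
    {s t u st tu stu : H} (h₁ : s * t = st) (h₂ : t * u = tu) (h₃ : st * u = stu)
    (h₄ : s * tu = stu) :
    Bimod.whiskerRight (β.tensorIso s t st h₁).hom (β.L u) ≫ (β.tensorIso st u stu h₃).hom =
      (ψ s t u : k) • ((Bimod.associatorBimod (β.L s) (β.L t) (β.L u)).hom ≫
        Bimod.whiskerLeft (β.L s) (β.tensorIso t u tu h₂).hom ≫
          (β.tensorIso s tu stu h₄).hom) := by
  subst h₁ h₂ h₃
  have key : ∀ s t : H, (β.tensorIso s t _ rfl).hom = (β.b s t).hom :=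
    fun s t => Category.comp_id _
  rw [key, key, key]
  exact hψ s t u

theorem tensorIso_unit_left {s t : H} (hs : s = 1) (h : s * t = t) :
    (β.tensorIso s t t h).hom =
      Bimod.whiskerRight (β.unitAt s hs).hom (β.L t) ≫ (Bimod.leftUnitorBimod (β.L t)).hom := by
  subst hs
  have h' := β.b_one_left t
  simp only [tensorIso, castIso, unitAt, Iso.trans_hom, eqToIso.hom]
  refine (congrArg (fun x => x ≫ eqToHom _) h').trans ?_
  simp only [Category.assoc, eqToHom_trans, eqToHom_refl, Category.id_comp]
  exact congrArg _ (Category.comp_id _)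

theorem tensorIso_unit_right {s t : H} (ht : t = 1) (h : s * t = s) :
    (β.tensorIso s t s h).hom =
      Bimod.whiskerLeft (β.L s) (β.unitAt t ht).hom ≫ (Bimod.rightUnitorBimod (β.L s)).hom := by
  subst ht
  have h' := β.b_one_right s
  simp only [tensorIso, castIso, unitAt, Iso.trans_hom, eqToIso.hom]
  refine (congrArg (fun x => x ≫ eqToHom _) h').trans ?_
  simp only [Category.assoc, eqToHom_trans, eqToHom_refl, Category.id_comp]
  exact congrArg _ (Category.comp_id _)

/-- The isomorphism in `C` underlying `unitAt`. -/
def unitObjIso (s : H) (h : s = 1) : (β.L s).X ≅ A.X where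
  hom := (β.unitAt s h).hom.hom
  inv := (β.unitAt s h).inv.hom
  hom_inv_id := congrArg Bimod.Hom.hom (β.unitAt s h).hom_inv_id
  inv_hom_id := congrArg Bimod.Hom.hom (β.unitAt s h).inv_hom_id

/-- The isomorphism in `C` underlying `castIso`. -/
def castObjIso {s t : H} (h : s = t) : (β.L s).X ≅ (β.L t).X := eqToIso (by rw [h])

@[simp] theorem castObjIso_refl (s : H) : β.castObjIso (rfl : s = s) = Iso.refl _ := rfl

/-- The product `L_s ⊗ L_t ⟶ L_u` for `s * t = u`, with a factor `ω(s,t)`. -/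
def mul (ω : H → H → kˣ) (s t u : H) (h : s * t = u) : (β.L s).X ⊗ (β.L t).X ⟶ (β.L u).X :=
  (ω s t : k) • (tensorProj (β.L s) (β.L t) ≫ (β.tensorIso s t u h).hom.hom)

theorem mul_eq_smul (ω ω' : H → H → kˣ) (s t u : H) (h : s * t = u) :
    β.mul ω' s t u h = ((ω' s t / ω s t : kˣ) : k) • β.mul ω s t u h := by
  rw [mul, mul, smul_smul, ← Units.val_mul, div_mul_cancel]

/-- Passing to underlying morphisms in `C` leaves the associator scalar `ψ`, which the condition `dω
= ψ` cancels. -/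
theorem mul_assoc {ψ : Pic A → Pic A → Pic A → kˣ} (hψ : β.DescribesAssociator ψ)
    (ω : Trivialisation ψ H) {s t u st tu stu : H} (h₁ : s * t = st) (h₂ : t * u = tu)
    (h₃ : st * u = stu) (h₄ : s * tu = stu) :
    β.mul ω.ω s t st h₁ ▷ (β.L u).X ≫ β.mul ω.ω st u stu h₃ =
      (α_ _ _ _).hom ≫ (β.L s).X ◁ β.mul ω.ω t u tu h₂ ≫ β.mul ω.ω s tu stu h₄ := by
  have h := congrArg Bimod.Hom.hom (β.tensorIso_assoc hψ h₁ h₂ h₃ h₄)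
  dsimp only [Bimod.comp_hom', bimod_smul_hom] at h
  have h' : tensorProj (β.L s) (β.L t) ▷ (β.L u).X ≫
      (β.tensorIso s t st h₁).hom.hom ▷ (β.L u).X ≫
        tensorProj (β.L st) (β.L u) ≫ (β.tensorIso st u stu h₃).hom.hom =
      (ψ s t u : k) • ((α_ _ _ _).hom ≫ (β.L s).X ◁ tensorProj (β.L t) (β.L u) ≫
        (β.L s).X ◁ (β.tensorIso t u tu h₂).hom.hom ≫ tensorProj (β.L s) (β.L tu) ≫
          (β.tensorIso s tu stu h₄).hom.hom) := by
    rw [← reassoc_of% tensorProj_whiskerRight, h, Linear.comp_smul, Linear.comp_smul,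
      reassoc_of% tensorProj_associator, reassoc_of% tensorProj_whiskerLeft]
  have hω : ψ s t u * (ω.ω s t * ω.ω st u) = ω.ω t u * ω.ω s tu := by
    rw [← ω.coboundary_eq, coboundary, h₁, h₂, mul_comm (ω.ω st u), div_mul_cancel]
  simp only [mul, MonoidalLinear.smul_whiskerRight, MonoidalLinear.whiskerLeft_smul,
    Linear.smul_comp, Linear.comp_smul, smul_smul, comp_whiskerRight, whiskerLeft_comp,
    Category.assoc]
  rw [h', smul_smul, ← Units.val_mul, ← Units.val_mul, ← Units.val_mul]
  congr 2
  rw [mul_comm (ω.ω s tu), ← hω]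
  simp only [_root_.mul_comm]

theorem mul_unit_left {ψ : Pic A → Pic A → Pic A → kˣ} (ω : Trivialisation ψ H) {s t : H}
    (hs : s = 1) (h : s * t = t) :
    β.mul ω.ω s t t h = (β.unitObjIso s hs).hom ▷ (β.L t).X ≫ (β.L t).actLeft := by
  rw [mul, β.tensorIso_unit_left hs]
  have : ω.ω s t = 1 := by rw [hs, ω.one_left]
  rw [this, Units.val_one, one_smul]
  dsimp only [Bimod.comp_hom']
  rw [reassoc_of% tensorProj_whiskerRight, tensorProj_leftUnitor]
  rfl

theorem mul_unit_right {ψ : Pic A → Pic A → Pic A → kˣ} (ω : Trivialisation ψ H) {s t : H}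
    (ht : t = 1) (h : s * t = s) :
    β.mul ω.ω s t s h = (β.L s).X ◁ (β.unitObjIso t ht).hom ≫ (β.L s).actRight := by
  rw [mul, β.tensorIso_unit_right ht]
  have : ω.ω s t = 1 := by rw [ht, ω.one_right]
  rw [this, Units.val_one, one_smul]
  dsimp only [Bimod.comp_hom']
  rw [reassoc_of% tensorProj_whiskerLeft, tensorProj_rightUnitor]
  rfl

end PicBasis

end PicFrobenius

/-! ### Coproducts on the invertible bimodules, and the several-object Frobenius algebra on `H` -/

section PicFrobenius

variable {C : Type u} [Category.{v} C] [MonoidalCategory C] [HasCoequalizers C]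
  [∀ X : C, PreservesColimitsOfSize.{0, 0} (tensorLeft X)]
  [∀ X : C, PreservesColimitsOfSize.{0, 0} (tensorRight X)]
  [Preadditive C] [MonoidalPreadditive C] {k : Type w} [Field k] [Linear k C]
  [MonoidalLinear k C]

namespace PicBasis

variable {A : Frobenius C} (β : PicBasis A.alg) {H : Subgroup (Pic A.alg)}

/-- The coproduct `L_u ⟶ L_s ⊗ L_t` for `s * t = u`, with a factor `ω(s,t)⁻¹`. -/
def comul (ω : H → H → kˣ) (s t u : H) (h : s * t = u) : (β.L u).X ⟶ (β.L s).X ⊗ (β.L t).X :=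
  bimodComul (β.tensorIso s t u h) (ω s t)

variable {βA β1 : k} (hA : A.IsSpecialWith βA β1) {ψ : Pic A.alg → Pic A.alg → Pic A.alg → kˣ}
  (hψ : β.DescribesAssociator ψ) (ω : Trivialisation ψ H)

include hA in
theorem comul_mul {s t u : H} (h : s * t = u) :
    β.comul ω.ω s t u h ≫ β.mul ω.ω s t u h = βA • 𝟙 _ :=
  bimodComul_mul _ _ hA

include hA hψ in
theorem comul_mul_left {s t u st tu stu : H} (h₁ : s * t = st) (h₂ : t * u = tu)
    (h₃ : st * u = stu) (h₄ : s * tu = stu) :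
    β.comul ω.ω s t st h₁ ▷ (β.L u).X ≫ (α_ _ _ _).hom ≫ (β.L s).X ◁ β.mul ω.ω t u tu h₂ =
      β.mul ω.ω st u stu h₃ ≫ β.comul ω.ω s tu stu h₄ :=
  bimodMul_frobenius_left hA (β.mul_assoc hψ ω h₁ h₂ h₃ h₄)

include hA hψ in
theorem comul_mul_right {s t u st tu stu : H} (h₁ : s * t = st) (h₂ : t * u = tu)
    (h₃ : st * u = stu) (h₄ : s * tu = stu) :
    (β.L s).X ◁ β.comul ω.ω t u tu h₂ ≫ (α_ _ _ _).inv ≫ β.mul ω.ω s t st h₁ ▷ (β.L u).X =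
      β.mul ω.ω s tu stu h₄ ≫ β.comul ω.ω st u stu h₃ :=
  bimodMul_frobenius_right hA (β.mul_assoc hψ ω h₁ h₂ h₃ h₄)

include hA in
theorem comul_counit_left {s t : H} (hs : s = 1) (h : s * t = t) :
    β.comul ω.ω s t t h ≫ ((β.unitObjIso s hs).hom ≫ ε[A.alg.X]) ▷ (β.L t).X = (λ_ _).inv :=
  bimodComul_counit_left hA _ _ (β.unitAt s hs).hom _ rfl (β.mul_unit_left ω hs h)

include hA in
theorem comul_counit_right {s t : H} (ht : t = 1) (h : s * t = s) :
    β.comul ω.ω s t s h ≫ (β.L s).X ◁ ((β.unitObjIso t ht).hom ≫ ε[A.alg.X]) = (ρ_ _).inv :=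
  bimodComul_counit_right hA _ _ (β.unitAt t ht).hom _ rfl (β.mul_unit_right ω ht h)

/-- The Frobenius algebra with set of objects `H` and morphisms `L_{ij⁻¹}` from `i` to `j`. -/
@[reducible]
def frobeniusCategory : FrobeniusCategory C k βA H where
  -- Since `ij⁻¹ · jl⁻¹ = il⁻¹`, composition is the product of the `L_s`. Simultaneous right
  -- translation of `i` and `j` does not change this object.
  Y i j := (β.L (i * j⁻¹ : H)).X
  mul i j l := β.mul ω.ω (i * j⁻¹) (j * l⁻¹) (i * l⁻¹) (by group)
  one i := η[A.alg.X] ≫ (β.unitObjIso (i * i⁻¹) (mul_inv_cancel i)).inv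
  comul i j l := β.comul ω.ω (i * j⁻¹) (j * l⁻¹) (i * l⁻¹) (by group)
  counit i := (β.unitObjIso (i * i⁻¹) (mul_inv_cancel i)).hom ≫ ε[A.alg.X]
  mul_assoc i j l n := β.mul_assoc hψ ω _ _ _ _
  one_mul i j := by
    rw [β.mul_unit_left ω (mul_inv_cancel i), ← comp_whiskerRight_assoc, Category.assoc,
      Iso.inv_hom_id, Category.comp_id, Bimod.one_actLeft]
  mul_one i j := by
    rw [β.mul_unit_right ω (mul_inv_cancel j), ← whiskerLeft_comp_assoc, Category.assoc,
      Iso.inv_hom_id, Category.comp_id, Bimod.actRight_one]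
  left_frobenius i j l n := β.comul_mul_left hA hψ ω _ _ _ _
  right_frobenius i j l n := β.comul_mul_right hA hψ ω _ _ _ _
  counit_comul i j := β.comul_counit_left hA ω _ _
  comul_counit i j := β.comul_counit_right hA ω _ _
  comul_mul i j l := β.comul_mul hA ω _

end PicBasis

end PicFrobenius

/-! ## Symmetric special matrix algebras -/

namespace FrobeniusCategory

variable {C : Type u} [Category.{v} C] [MonoidalCategory C] [Preadditive C]
  [MonoidalPreadditive C] {k : Type w} [Field k] [Linear k C]
  {b : k} {I : Type*} {F : FrobeniusCategory C k b I} {R : Type*} [Fintype R] {r : R → I} {X : C}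

theorem matFrobenius_isSpecialWith (a : F.MatrixObj X r r) {b₁ : k}
    (h : ∀ i, F.one i ≫ F.counit i = b₁ • 𝟙 (𝟙_ C)) (hb : (Fintype.card R : k) * b ≠ 0)
    (hb₁ : (Fintype.card R : k) * b₁ ≠ 0) :
    (matFrobenius a).IsSpecialWith ((Fintype.card R : k) * b) ((Fintype.card R : k) * b₁) where
  betaA_ne_zero := hb
  beta1_ne_zero := hb₁
  comul_mul := matComul_comp_matMul a a a
  one_counit := (matOne_matCounit a).trans (by
    simp only [h, Finset.sum_const, Finset.card_univ, mul_smul, Nat.cast_smul_eq_nsmul])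

/-- By cyclicity only diagonal entries of the acting matrix contribute: the entry `(i, i)` acts on
the entries `(i, j)` of the other factor, for every `j`. -/
theorem partialTrace_matMul [Sovereign C] (a : F.MatrixObj X r r) : partialTrace (matMul a a a) =
    ∑ i, ∑ j, a.proj (i, i) ≫ partialTrace (F.mul (r i) (r i) (r j)) := by
  classical
  rw [← a.sum_comp_proj (matMul a a a), partialTrace_sum, Fintype.sum_prod_type]
  refine Finset.sum_congr rfl fun i _ => Finset.sum_congr rfl fun j _ => ?_
  rw [partialTrace_comp, comp_partialTrace, reassoc_of% matMul_inj, Preadditive.sum_comp,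
    Finset.sum_eq_single i]
  · simp
  · intro l _ hl
    rw [Category.assoc, Category.assoc, a.inj_proj_ne (by simpa using hl)]
    simp
  · simp

theorem matFrobenius_isSymmetric [Sovereign C] [MonoidalLinear k C] (a : F.MatrixObj X r r)
    (h : ∀ i j, partialTrace (F.mul i i j) = b • F.counit i) (hb : (Fintype.card R : k) * b ≠ 0) :
    (matFrobenius a).IsSymmetric := by
  refine (matFrobenius a).isSymmetric_of_trace hb ((partialTrace_matMul a).trans ?_)
  simp only [h, Finset.sum_const, Finset.card_univ, Linear.comp_smul, mul_smul,
    Nat.cast_smul_eq_nsmul]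
  rw [← Finset.smul_sum, ← Finset.smul_sum]
  rfl

end FrobeniusCategory

/-! ### Dimensions as traces of the left action -/

section Dimension

variable {C : Type u} [Category.{v} C] [MonoidalCategory C] [Sovereign C]

/-- The counit removes the free leg of `Δ ∘ η`, and the unit that remains acts trivially on `M`. -/
theorem preBimodEvL_counit {A : Mon C} [ComonObj A.X] (M : Bimod A A) :
    preBimodEvL M ≫ ε[A.X] = evL M.X := by
  calc
    _ = 𝟙 _ ⊗≫ (η[A.X] ≫ Δ[A.X]) ▷ (M.X ⊗ dual M.X) ⊗≫
        (A.X ◁ (M.actLeft ▷ dual M.X ≫ evL M.X) ≫ ε[A.X] ▷ 𝟙_ C) ⊗≫ 𝟙 _ := by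
      rw [preBimodEvL]; monoidal
    _ = 𝟙 _ ⊗≫ (η[A.X] ≫ Δ[A.X] ≫ ε[A.X] ▷ A.X) ▷ (M.X ⊗ dual M.X) ⊗≫
        M.actLeft ▷ dual M.X ≫ evL M.X := by
      rw [whisker_exchange]; monoidal
    _ = 𝟙 _ ⊗≫ (η[A.X] ▷ M.X ≫ M.actLeft) ▷ dual M.X ≫ evL M.X := by
      rw [ComonObj.counit_comul]; monoidal
    _ = _ := by rw [M.one_actLeft]; monoidal

/-- Composing the equation that defines the right dimension with `ε` turns the evaluation over `A`
into that of `C`, and its left-hand side into the trace of the action. The factor `b` undoes the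
normalisation `b⁻¹` of the evaluation. -/
theorem partialTrace_actLeft [HasCoequalizers C] {k : Type w} [Field k] [Preadditive C]
    [Linear k C] {A : Mon C} [ComonObj A.X] {M : Bimod A A} {b c : k} (hb : b ≠ 0)
    (h : HasRightDim b M c) : partialTrace M.actLeft = (b * c) • ε[A.X] := by
  have h₀ : bimodCoevR M ≫ bimodEvL b M = b⁻¹ •
      ((𝟙 _ ⊗≫ A.X ◁ coevR M.X ⊗≫ M.actLeft ▷ dual M.X) ≫ preBimodEvL M) :=
    (Linear.comp_smul _ _ _ _ _ _).trans (congrArg (b⁻¹ • ·)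
      ((Category.assoc _ _ _).trans (congrArg (_ ≫ ·) (coequalizer.π_desc _ _))))
  have h₁ := congrArg (b • · ≫ ε[A.X]) (h₀.symm.trans h)
  rw [Linear.smul_comp, smul_smul, mul_inv_cancel₀ hb, one_smul, Category.assoc,
    preBimodEvL_counit, Linear.smul_comp, smul_smul, Category.id_comp] at h₁
  rw [← h₁, partialTrace]
  monoidal

end Dimension

section PicFrobenius

variable {C : Type u} [Category.{v} C] [MonoidalCategory C] [Sovereign C] [HasCoequalizers C]
  [Preadditive C] [MonoidalPreadditive C] {k : Type w} [Field k] [Linear k C]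
  [MonoidalLinear k C]

namespace PicBasis

variable {A : Frobenius C} (β : PicBasis A.alg) {H : Subgroup (Pic A.alg)}
  {βA β1 : k} (hA : A.IsSpecialWith βA β1) {ψ : Pic A.alg → Pic A.alg → Pic A.alg → kˣ}
  (hψ : β.DescribesAssociator ψ) (ω : Trivialisation ψ H)

theorem frobeniusCategory_one_counit (i : H) : (β.frobeniusCategory hA hψ ω).one i ≫
    (β.frobeniusCategory hA hψ ω).counit i = β1 • 𝟙 (𝟙_ C) := by
  simpa using hA.one_counit

/-- The diagonal entry `L_{ii⁻¹}` is a copy of `A` and acts by the left action of `A` on `L_{ij⁻¹}`,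
which has dimension `1`. -/
theorem partialTrace_frobeniusCategory_mul (hH : ∀ h : H, HasRightDim βA (β.L h) (1 : k))
    (i j : H) : partialTrace ((β.frobeniusCategory hA hψ ω).mul i i j) =
      βA • (β.frobeniusCategory hA hψ ω).counit i := by
  dsimp only [frobeniusCategory]
  rw [β.mul_unit_left ω (mul_inv_cancel i), ← comp_partialTrace,
    partialTrace_actLeft hA.betaA_ne_zero (hH _), mul_one, Linear.comp_smul]

end PicBasis

end PicFrobenius

/-! ## Automorphisms from trivialisations -/

section Linear

variable {C : Type u} [Category.{v} C] [Preadditive C] {k : Type w} [Field k] [Linear k C]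

/-- A nonzero multiple of an isomorphism. -/
@[simps] def smulIso {X Y : C} (c : kˣ) (e : X ≅ Y) : X ≅ Y where
  hom := (c : k) • e.hom
  inv := (↑c⁻¹ : k) • e.inv
  hom_inv_id := by rw [Linear.smul_comp, Linear.comp_smul, smul_smul, c.mul_inv]; simp
  inv_hom_id := by rw [Linear.smul_comp, Linear.comp_smul, smul_smul, c.inv_mul]; simp

end Linear

namespace Trivialisation

variable {k : Type w} [Field k] {G : Type*} [Group G] {ψ : G → G → G → kˣ} {H : Subgroup G}
  (ω t : Trivialisation ψ H)

/-- The quotient of two trivialisations. -/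
def ratio (g h : H) : kˣ := t.ω g h / ω.ω g h

@[simp] theorem ratio_one_left (h : H) : ratio ω t 1 h = 1 := by simp [ratio, one_left]

@[simp] theorem ratio_one_right (h : H) : ratio ω t h 1 = 1 := by simp [ratio, one_right]

/-- Both cochains have coboundary `ψ`, so their quotient has trivial coboundary. -/
theorem ratio_cocycle (g h l : H) :
    ratio ω t h l * ratio ω t g (h * l) = ratio ω t (g * h) l * ratio ω t g h := by
  have e := (t.coboundary_eq g h l).trans (ω.coboundary_eq g h l).symm
  rw [coboundary, coboundary, div_eq_div_iff_mul_eq_mul] at e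
  rw [ratio, ratio, ratio, ratio, div_mul_div_comm, div_mul_div_comm, div_eq_div_iff_mul_eq_mul, e,
    _root_.mul_comm]

theorem ratio_mul (g h : H) : ratio ω t g h * ω.ω g h = t.ω g h := div_mul_cancel _ _

end Trivialisation

section PicFrobenius

variable {C : Type u} [Category.{v} C] [MonoidalCategory C] [HasCoequalizers C]
  [∀ X : C, PreservesColimitsOfSize.{0, 0} (tensorLeft X)]
  [∀ X : C, PreservesColimitsOfSize.{0, 0} (tensorRight X)]
  [Preadditive C] [MonoidalPreadditive C] {k : Type w} [Field k] [Linear k C]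
  [MonoidalLinear k C]

namespace PicBasis

variable {A : Frobenius C} (β : PicBasis A.alg) {H : Subgroup (Pic A.alg)}

/-- The isomorphism `L_s ≅ L_t` for `s = t`, multiplied by a scalar. -/
def scaledIso (c : kˣ) {s t : H} (h : s = t) : (β.L s).X ≅ (β.L t).X :=
  smulIso c (β.castObjIso h)

theorem scaledIso_trans (c d : kˣ) {s t u : H} (h : s = t) (h' : t = u) :
    (β.scaledIso c h).hom ≫ (β.scaledIso d h').hom = (β.scaledIso (c * d) (h.trans h')).hom := by
  subst h h'
  simp [scaledIso, smul_smul, _root_.mul_comm]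

theorem scaledIso_one_refl (s : H) : (β.scaledIso (1 : kˣ) (rfl : s = s)).hom = 𝟙 _ := by
  simp [scaledIso]

theorem scaledIso_mul (ω : H → H → kˣ) {s t u s' t' u' : H} (hs : s = s') (ht : t = t')
    (hu : u = u') (h : s * t = u) (h' : s' * t' = u') {a b c : kˣ} (e : a * b = c) :
    ((β.scaledIso a hs).hom ⊗ₘ (β.scaledIso b ht).hom) ≫ β.mul ω s' t' u' h' =
      β.mul ω s t u h ≫ (β.scaledIso c hu).hom := by
  subst hs ht hu e
  simp [scaledIso, MonoidalCategory.tensorHom_def, smul_smul, _root_.mul_comm]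

theorem comul_scaledIso (ω : H → H → kˣ) {s t u s' t' u' : H} (hs : s = s') (ht : t = t')
    (hu : u = u') (h : s * t = u) (h' : s' * t' = u') {a b c : kˣ} (e : a * b = c) :
    β.comul ω s t u h ≫ ((β.scaledIso a hs).hom ⊗ₘ (β.scaledIso b ht).hom) =
      (β.scaledIso c hu).hom ≫ β.comul ω s' t' u' h' := by
  subst hs ht hu e
  simp [scaledIso, MonoidalCategory.tensorHom_def, smul_smul, _root_.mul_comm]

theorem scaledIso_unitObjIso {c : kˣ} (hc : c = 1) {s t : H} (h : s = t) (hs : s = 1)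
    (ht : t = 1) :
    (β.scaledIso c h).hom ≫ (β.unitObjIso t ht).hom = (β.unitObjIso s hs).hom := by
  subst h hc
  simp [scaledIso]

theorem unitObjIso_inv_scaledIso {c : kˣ} (hc : c = 1) {s t : H} (h : s = t) (hs : s = 1)
    (ht : t = 1) :
    (β.unitObjIso s hs).inv ≫ (β.scaledIso c h).hom = (β.unitObjIso t ht).inv := by
  subst h hc
  simp [scaledIso]

variable {βA β1 : k} (hA : A.IsSpecialWith βA β1) {ψ : Pic A.alg → Pic A.alg → Pic A.alg → kˣ}
  (hψ : β.DescribesAssociator ψ) (ω t : Trivialisation ψ H)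

/-- The isomorphisms of the entries in the automorphism of the matrix algebra that belongs to
`x ∈ H`. -/
def translate (x i j : H) :
    (β.frobeniusCategory hA hψ ω).Y (i * x) (j * x) ≅ (β.frobeniusCategory hA hψ ω).Y i j :=
  -- The scalar is a quotient of a function of `j` by one of `i`, as in conjugation by a diagonal
  -- matrix. It therefore telescopes along products and is `1` on the diagonal.
  β.scaledIso (ω.ratio t j x / ω.ratio t i x) (by group)

variable [Fintype H] {X : C} (a : (β.frobeniusCategory hA hψ ω).MatrixObj X (id : H → H) id)

/-- The automorphism of the matrix algebra that belongs to `x ∈ H`. -/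
def matAut (x : H) : X ≅ X :=
  FrobeniusCategory.matMap a a (Equiv.mulRight x) (Equiv.mulRight x)
    (β.translate hA hψ ω t x)

theorem matAut_proj (x i j : H) : (β.matAut hA hψ ω t a x).hom ≫ a.proj (i, j) =
    a.proj (i * x, j * x) ≫ (β.translate hA hψ ω t x i j).hom :=
  FrobeniusCategory.matMap_proj _ _ _ _ _ _ _

theorem inj_matAut (x i j : H) : a.inj (i * x, j * x) ≫ (β.matAut hA hψ ω t a x).hom =
    (β.translate hA hψ ω t x i j).hom ≫ a.inj (i, j) :=
  FrobeniusCategory.inj_matMap a a (Equiv.mulRight x) (Equiv.mulRight x) _ i j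

/-- For the products and coproducts, `(κ(j,x)/κ(i,x)) (κ(l,x)/κ(j,x)) = κ(l,x)/κ(i,x)` with `κ =
ratio ω t`; for the unit and the counit, the factor on the diagonal is `1`. -/
theorem matAut_mem (x : H) :
    β.matAut hA hψ ω t a x ∈ (FrobeniusCategory.matFrobenius a).autGroup := by
  refine ⟨⟨?_, ?_⟩, ⟨?_, ?_⟩⟩
  · exact FrobeniusCategory.matOne_matMap fun i => by
      rw [Category.assoc]
      exact congrArg _ (β.unitObjIso_inv_scaledIso (div_self' _) _ _ _)
  · exact FrobeniusCategory.matMul_matMap fun i j l =>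
      β.scaledIso_mul _ _ _ _ _ _ (by rw [_root_.mul_comm, div_mul_div_cancel])
  · exact FrobeniusCategory.matMap_matCounit fun i => by
      rw [← Category.assoc]
      exact congrArg (· ≫ _) (β.scaledIso_unitObjIso (div_self' _) _ _ _)
  · exact (FrobeniusCategory.matComul_matMap fun i j l =>
      β.comul_scaledIso _ _ _ _ _ _ (by rw [_root_.mul_comm, div_mul_div_cancel])).symm

theorem matrix_proj_eq {i i' j j' : H} (hi : i = i') (hj : j = j') : a.proj (i', j') =
    a.proj (i, j) ≫ (β.scaledIso (1 : kˣ) (congrArg₂ (fun i j : H => i * j⁻¹) hi hj)).hom := by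
  subst hi hj
  rw [scaledIso_one_refl]
  exact (Category.comp_id _).symm

theorem matAut_mul (x y : H) : β.matAut hA hψ ω t a (x * y) =
    β.matAut hA hψ ω t a y ≪≫ β.matAut hA hψ ω t a x := by
  ext
  refine a.hom_ext_proj fun ⟨i, j⟩ => ?_
  rw [Iso.trans_hom, Category.assoc, matAut_proj, matAut_proj, reassoc_of% matAut_proj]
  have h : a.proj (i * x * y, j * x * y) = a.proj (i * (x * y), j * (x * y)) ≫
      (β.scaledIso (1 : kˣ) (by group)).hom :=
    β.matrix_proj_eq hA hψ ω a (_root_.mul_assoc i x y).symm (_root_.mul_assoc j x y).symm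
  have e : ω.ratio t j (x * y) / ω.ratio t i (x * y) =
      1 * (ω.ratio t (j * x) y / ω.ratio t (i * x) y) * (ω.ratio t j x / ω.ratio t i x) := by
    -- The cocycle identity is used for `(i, x, y)` and for `(j, x, y)`; the common factor `κ(x,y)`
    -- cancels in the quotient.
    rw [_root_.one_mul, div_mul_div_comm, ← ω.ratio_cocycle, ← ω.ratio_cocycle, mul_div_mul_left_eq_div]
  rw [h, Category.assoc, translate, translate, translate]
  refine congrArg _ (Eq.symm ((Category.assoc _ _ _).symm.trans ?_))
  rw [scaledIso_trans, scaledIso_trans, e]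

/-- The homomorphism from `H` to the automorphism group of the matrix algebra that belongs to a
trivialisation. -/
def matAutHom : H →* (FrobeniusCategory.matFrobenius a).autGroup :=
  MonoidHom.mk' (fun x => ⟨β.matAut hA hψ ω t a x, β.matAut_mem hA hψ ω t a x⟩)
    fun x y => Subtype.ext (β.matAut_mul hA hψ ω t a x y)

end PicBasis

end PicFrobenius

/-! ## The Morita context and the classes of the twisted bimodules -/

section PicFrobenius

variable {C : Type u} [Category.{v} C] [MonoidalCategory C] [HasCoequalizers C]
  [∀ X : C, PreservesColimitsOfSize.{0, 0} (tensorLeft X)]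
  [∀ X : C, PreservesColimitsOfSize.{0, 0} (tensorRight X)]
  [Preadditive C] [MonoidalPreadditive C] {k : Type w} [Field k] [Linear k C]
  [MonoidalLinear k C]

theorem card_mul_ne_zero [CharZero k] {b : k} (hb : b ≠ 0) {J : Type*} [Fintype J] [Nonempty J] :
    (Fintype.card J : k) * b ≠ 0 :=
  mul_ne_zero (Nat.cast_ne_zero.2 Fintype.card_ne_zero) hb

/-- Tensoring an isomorphism of bimodules with a bimodule on the left. -/
def bimodWhiskerLeftIso {A B D : Mon C} (M : Bimod A B) {N N' : Bimod B D} (i : N ≅ N') :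
    M.tensorBimod N ≅ M.tensorBimod N' where
  hom := Bimod.whiskerLeft M i.hom
  inv := Bimod.whiskerLeft M i.inv
  hom_inv_id := by rw [← Bimod.whiskerLeft_comp_bimod, i.hom_inv_id, Bimod.whiskerLeft_id_bimod]
  inv_hom_id := by rw [← Bimod.whiskerLeft_comp_bimod, i.inv_hom_id, Bimod.whiskerLeft_id_bimod]

/-- Tensoring with a twisted bimodule twists the left action. -/
def twistedBimodTensorIso {B D : Mon C} (α : B.X ≅ B.X) [IsMonHom α.hom] {N N' : Bimod B D}
    (a : N.X ≅ N'.X) (left : N.actLeft ≫ a.hom = (α.hom ⊗ₘ a.hom) ≫ N'.actLeft)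
    (right : N.actRight ≫ a.hom = a.hom ▷ D.X ≫ N'.actRight) :
    (twistedBimod B α.hom).tensorBimod N ≅ N' :=
  twistedTensorIso (T := twistedBimod B α.hom) (Iso.refl B.X) α (by simp [twistedBimod])
    (by simp [twistedBimod]) a left right

theorem matMul_ofIso_left {b : k} {I : Type*} {F : FrobeniusCategory C k b I} {i j : I}
    {X Z : C} (e : X ≅ F.Y i i) (f : Z ≅ F.Y i j) :
    FrobeniusCategory.matMul (F := F) (r := fun _ : Unit => i) (s := fun _ : Unit => i)
      (t := fun _ : Unit => j) (Decomp.ofIso e) (Decomp.ofIso f) (Decomp.ofIso f) =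
      (e.hom ⊗ₘ f.hom) ≫ F.mul i i j ≫ f.inv := by
  simp [FrobeniusCategory.matMul, Decomp.ofIso]

theorem matMul_ofIso_right {b : k} {I : Type*} {F : FrobeniusCategory C k b I} {i j : I}
    {X Z : C} (e : X ≅ F.Y j j) (f : Z ≅ F.Y i j) :
    FrobeniusCategory.matMul (F := F) (r := fun _ : Unit => i) (s := fun _ : Unit => j)
      (t := fun _ : Unit => j) (Decomp.ofIso f) (Decomp.ofIso e) (Decomp.ofIso f) =
      (f.hom ⊗ₘ e.hom) ≫ F.mul i j j ≫ f.inv := by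
  simp [FrobeniusCategory.matMul, Decomp.ofIso]

namespace PicBasis

variable {A : Frobenius C} (β : PicBasis A.alg) {H : Subgroup (Pic A.alg)}
  {βA β1 : k} (hA : A.IsSpecialWith βA β1) {ψ : Pic A.alg → Pic A.alg → Pic A.alg → kˣ}
  (hψ : β.DescribesAssociator ψ) (ω t : Trivialisation ψ H)

theorem frobeniusCategory_mul_left (i j : H) : (β.frobeniusCategory hA hψ ω).mul i i j =
    (β.unitObjIso (i * i⁻¹) (mul_inv_cancel i)).hom ▷ (β.L (i * j⁻¹ : H)).X ≫
      (β.L (i * j⁻¹ : H)).actLeft :=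
  β.mul_unit_left ω _ _

theorem frobeniusCategory_mul_right (i j : H) : (β.frobeniusCategory hA hψ ω).mul i j j =
    (β.L (i * j⁻¹ : H)).X ◁ (β.unitObjIso (j * j⁻¹) (mul_inv_cancel j)).hom ≫
      (β.L (i * j⁻¹ : H)).actRight :=
  β.mul_unit_right ω _ _

/-- The algebra `A` as an algebra of matrices of size one with label `i`. -/
def unitMatrix (i : H) : (β.frobeniusCategory hA hψ ω).MatrixObj A.alg.X (fun _ : Unit => i)
    (fun _ : Unit => i) :=
  Decomp.ofIso (β.unitObjIso (i * i⁻¹) (mul_inv_cancel i)).symm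

/-- The bimodule `L_s` as a bimodule of matrices of size one. -/
def entryMatrix (i j s : H) (h : s = i * j⁻¹) :
    (β.frobeniusCategory hA hψ ω).MatrixObj (β.L s).X (fun _ : Unit => i) (fun _ : Unit => j) :=
  Decomp.ofIso (β.castObjIso h)

theorem isMatBimod_entryMatrix (i j s : H) (h : s = i * j⁻¹) :
    FrobeniusCategory.IsMatBimod (β.unitMatrix hA hψ ω i) (β.unitMatrix hA hψ ω j) (β.L s)
      (β.entryMatrix hA hψ ω i j s h) where
  left_eq := by
    subst h
    refine Eq.trans ?_ (matMul_ofIso_left (F := β.frobeniusCategory hA hψ ω) _ _).symm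
    rw [frobeniusCategory_mul_left]
    simp
  right_eq := by
    subst h
    refine Eq.trans ?_ (matMul_ofIso_right (F := β.frobeniusCategory hA hψ ω) _ _).symm
    rw [frobeniusCategory_mul_right]
    simp

theorem isMatMon_unitMatrix (i : H) :
    FrobeniusCategory.IsMatMon A.alg (β.unitMatrix hA hψ ω i) where
  mul_eq := by
    refine Eq.trans ?_ (matMul_ofIso_left (F := β.frobeniusCategory hA hψ ω) _ _).symm
    rw [frobeniusCategory_mul_left]
    have h : (β.L (i * i⁻¹ : H)).actLeft ≫ (β.unitObjIso _ (mul_inv_cancel i)).hom =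
        A.alg.X ◁ (β.unitObjIso _ (mul_inv_cancel i)).hom ≫ μ :=
      (β.unitAt _ (mul_inv_cancel i)).hom.left_act_hom
    simp only [MonoidalCategory.tensorHom_def', Iso.symm_hom, Iso.symm_inv, Category.assoc,
      inv_hom_whiskerRight_assoc]
    refine Eq.trans ?_ (congrArg (A.alg.X ◁ (β.unitObjIso _ (mul_inv_cancel i)).inv ≫ ·) h.symm)
    rw [← whiskerLeft_comp_assoc, Iso.inv_hom_id, whiskerLeft_id, Category.id_comp]
  one_eq := by
    simp [unitMatrix, FrobeniusCategory.matOne, Decomp.ofIso]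

variable [Fintype H] {X P P' : C}
  (a : (β.frobeniusCategory hA hψ ω).MatrixObj X (id : H → H) id)
  (p : (β.frobeniusCategory hA hψ ω).MatrixObj P (fun _ : Unit => (1 : H)) id)
  (q : (β.frobeniusCategory hA hψ ω).MatrixObj P' id (fun _ : Unit => (1 : H)))

variable [CharZero k]

/-- The Morita context between `A` and the matrix algebra. -/
def moritaContext : MoritaContext A.alg (FrobeniusCategory.matFrobenius a).alg :=
  FrobeniusCategory.matMoritaContext (β.isMatMon_unitMatrix hA hψ ω 1)
    (FrobeniusCategory.matFrobenius_isMatMon a) p q (card_mul_ne_zero hA.betaA_ne_zero)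
    (card_mul_ne_zero hA.betaA_ne_zero)

/-- The translation of a column of matrices. -/
def columnIso {P'' : C} (x : H)
    (q' : (β.frobeniusCategory hA hψ ω).MatrixObj P'' id (fun _ : Unit => x⁻¹)) : P' ≅ P'' :=
  FrobeniusCategory.matMap q q' (Equiv.mulRight x) (Equiv.refl Unit) fun g _ =>
    β.scaledIso (ω.ratio t g x)⁻¹ (s := g * x * 1⁻¹) (t := g * x⁻¹⁻¹) (by group)

/-- Relabelling the size-one matrix algebra induces the identity of `A`. Consequently the translated
column keeps its right `A`-action without a twist. -/
theorem unitMatrix_translate (i j : H) :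
    (FrobeniusCategory.matMap (β.unitMatrix hA hψ ω i) (β.unitMatrix hA hψ ω j)
      (Equiv.refl Unit) (Equiv.refl Unit) fun _ _ =>
        β.scaledIso (1 : kˣ) (s := i * i⁻¹) (t := j * j⁻¹) (by group)).hom = 𝟙 A.alg.X := by
  refine (β.unitMatrix hA hψ ω j).hom_ext_proj fun p => ?_
  refine (FrobeniusCategory.matMap_proj _ _ _ _ _ _ _).trans (Eq.trans ?_ (Category.id_comp _).symm)
  exact β.unitObjIso_inv_scaledIso rfl _ _ _

/-- Translation of columns intertwines the action of `A'` with its twist by the automorphism of `x`,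
because `(κ(j,x)/κ(i,x)) κ(j,x)⁻¹ = κ(i,x)⁻¹`. -/
theorem matMul_columnIso_left {P'' : C} (x : H)
    (q' : (β.frobeniusCategory hA hψ ω).MatrixObj P'' id (fun _ : Unit => x⁻¹)) :
    FrobeniusCategory.matMul a q q ≫ (β.columnIso hA hψ ω t q x q').hom =
      ((β.matAut hA hψ ω t a x).hom ⊗ₘ (β.columnIso hA hψ ω t q x q').hom) ≫
        FrobeniusCategory.matMul a q' q' :=
  FrobeniusCategory.matMul_matMap fun i j l =>
    β.scaledIso_mul _ _ _ _ _ _ (by rw [div_mul_eq_mul_div, mul_inv_cancel, one_div])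

theorem matMul_columnIso_right {P'' : C} (x : H)
    (q' : (β.frobeniusCategory hA hψ ω).MatrixObj P'' id (fun _ : Unit => x⁻¹)) :
    FrobeniusCategory.matMul q (β.unitMatrix hA hψ ω 1) q ≫ (β.columnIso hA hψ ω t q x q').hom =
      (β.columnIso hA hψ ω t q x q').hom ▷ A.alg.X ≫
        FrobeniusCategory.matMul q' (β.unitMatrix hA hψ ω x⁻¹) q' := by
  rw [← tensorHom_id, ← β.unitMatrix_translate hA hψ ω 1 x⁻¹]
  exact FrobeniusCategory.matMul_matMap fun i j l =>
    β.scaledIso_mul _ _ _ _ _ _ (_root_.mul_one _)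

/-- The twisted bimodule tensored with the column of label `1` is the column of label `x⁻¹`.
Multiplying the row of label `1` by it leaves the one entry at `(1, x⁻¹)`, which is `L_x`. -/
theorem nonempty_tensor_twistedBimod_iso {B : Mon C}
    {a : (β.frobeniusCategory hA hψ ω).MatrixObj B.X (id : H → H) id}
    (ha : FrobeniusCategory.IsMatMon B a) (x : H) [hα : IsMonHom (β.matAut hA hψ ω t a x).hom] {P'' : C}
    (q' : (β.frobeniusCategory hA hψ ω).MatrixObj P'' id (fun _ : Unit => x⁻¹)) :
    Nonempty (((FrobeniusCategory.matBimod (β.isMatMon_unitMatrix hA hψ ω 1) ha p).tensorBimod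
      (twistedBimod B (β.matAut hA hψ ω t a x).hom)).tensorBimod
        (FrobeniusCategory.matBimod ha (β.isMatMon_unitMatrix hA hψ ω 1) q) ≅ β.L x) := by
  let N' := FrobeniusCategory.matBimod ha (β.isMatMon_unitMatrix hA hψ ω x⁻¹) q'
  have hl := β.matMul_columnIso_left hA hψ ω t a q x q'
  have hr := β.matMul_columnIso_right hA hψ ω t q x q'
  refine ⟨Bimod.associatorBimod _ _ _ ≪≫ bimodWhiskerLeftIso _ (twistedBimodTensorIso (N' := N')
    (β.matAut hA hψ ω t a x) (β.columnIso hA hψ ω t q x q') hl hr) ≪≫ ?_⟩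
  exact FrobeniusCategory.matTensorIso (FrobeniusCategory.matBimod_isMatBimod _ ha p)
    (FrobeniusCategory.matBimod_isMatBimod ha _ q')
    (β.isMatBimod_entryMatrix hA hψ ω 1 x⁻¹ x (by group)) (card_mul_ne_zero hA.betaA_ne_zero)

theorem classMap_twistClass {P'' : C} (x : H)
    (q' : (β.frobeniusCategory hA hψ ω).MatrixObj P'' id (fun _ : Unit => x⁻¹)) :
    (β.moritaContext hA hψ ω a p q).classMap (twistClass (FrobeniusCategory.matFrobenius a)
      (β.matAutHom hA hψ ω t a x)) = ((x : Pic A.alg) : Skeleton (Bimod A.alg A.alg)) := by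
  rw [← β.toSkeleton_L]
  exact Quotient.sound (β.nonempty_tensor_twistedBimod_iso hA hψ ω t p q
    (FrobeniusCategory.matFrobenius_isMatMon a) x (hα := (β.matAut_mem hA hψ ω t a x).1) q')

end PicBasis

end PicFrobenius

/-! ## Injectivity and fixed algebras -/

/-- The algebra structure on a subobject that is closed under multiplication. -/
@[reducible]
def monObjOfMono {C : Type u} [Category.{v} C] [MonoidalCategory C] {X Y : C} [MonObj X]
    (j : Y ⟶ X) [Mono j] (m : Y ⊗ Y ⟶ Y) (e : 𝟙_ C ⟶ Y) (hm : m ≫ j = (j ⊗ₘ j) ≫ μ[X])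
    (he : e ≫ j = η[X]) : MonObj Y where
  one := e
  mul := m
  one_mul := by
    rw [← cancel_mono j, Category.assoc, hm, whiskerRight_comp_tensorHom_assoc, he,
      MonoidalCategory.tensorHom_def', Category.assoc, MonObj.one_mul, leftUnitor_naturality]
  mul_one := by
    rw [← cancel_mono j, Category.assoc, hm, whiskerLeft_comp_tensorHom_assoc, he,
      MonoidalCategory.tensorHom_def, Category.assoc, MonObj.mul_one, rightUnitor_naturality]
  mul_assoc := by
    rw [← cancel_mono j]
    simp only [Category.assoc, hm, whiskerRight_comp_tensorHom_assoc,
      whiskerLeft_comp_tensorHom_assoc]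
    rw [← tensorHom_comp_whiskerRight, ← tensorHom_comp_whiskerLeft, Category.assoc,
      Category.assoc, MonObj.mul_assoc, associator_naturality_assoc]

section PicFrobenius

variable {C : Type u} [Category.{v} C] [MonoidalCategory C] [HasCoequalizers C]
  [∀ X : C, PreservesColimitsOfSize.{0, 0} (tensorLeft X)]
  [∀ X : C, PreservesColimitsOfSize.{0, 0} (tensorRight X)]
  [Preadditive C] [MonoidalPreadditive C] {k : Type w} [Field k] [Linear k C]
  [MonoidalLinear k C]

namespace PicBasis

variable {A : Frobenius C} (β : PicBasis A.alg) {H : Subgroup (Pic A.alg)}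

theorem scaledIso_injective {s s' : H} (hs : 𝟙 (β.L s).X ≠ 0) (h : s = s') {c d : kˣ}
    (e : (β.scaledIso c h).hom = (β.scaledIso d h).hom) : c = d := by
  subst h
  simp only [scaledIso, castObjIso_refl, smulIso_hom, Iso.refl_hom] at e
  rw [← sub_eq_zero, ← sub_smul, smul_eq_zero, sub_eq_zero] at e
  exact Units.ext (e.resolve_right hs)

variable {βA β1 : k} (hA : A.IsSpecialWith βA β1) {ψ : Pic A.alg → Pic A.alg → Pic A.alg → kˣ}
  (hψ : β.DescribesAssociator ψ) (ω t : Trivialisation ψ H)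

variable [Fintype H] {X : C} (a : (β.frobeniusCategory hA hψ ω).MatrixObj X (id : H → H) id)

/-- The factor on the entry `(i, 1)` is `κ(i,x)⁻¹`, since `κ` is normalised. As the entries are
nonzero objects, the automorphisms determine `κ`, hence `t = κ ω`. -/
theorem matAutHom_injective (hL : ∀ s : H, 𝟙 (β.L s).X ≠ 0) :
    Function.Injective fun t => β.matAutHom hA hψ ω t a := by
  intro t t' h
  have key : ∀ i x : H, ω.ratio t i x = ω.ratio t' i x := by
    intro i x
    have h₁ : β.matAut hA hψ ω t a x = β.matAut hA hψ ω t' a x :=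
      congrArg Subtype.val (DFunLike.congr_fun h x)
    have h₂ : (β.translate hA hψ ω t x i 1).hom = (β.translate hA hψ ω t' x i 1).hom := by
      have e := congrArg (fun f => a.inj (i * x, 1 * x) ≫ f.hom ≫ a.proj (i, 1)) h₁
      rw [reassoc_of% inj_matAut, reassoc_of% inj_matAut, a.inj_proj_self] at e
      simpa using e
    have h₃ := β.scaledIso_injective (hL _) _ h₂
    simpa using h₃
  refine Trivialisation.ext (funext fun i => funext fun x => ?_)
  rw [← ω.ratio_mul t, key, ω.ratio_mul]

variable [HasFiniteProducts C] (H)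

/-- The object of `Q(H)` as the direct sum of the objects `L_s`. -/
def QDecomp : Decomp (Q β H).X (fun s : H => (β.L s).X) where
  proj s := (Qπ β H s).hom
  inj s := (Qι β H s).hom
  inj_proj_self s :=
    congrArg Bimod.Hom.hom ((Decomp.ofBiproduct (Y := fun s : H => β.L s)).inj_proj_self s)
  inj_proj_ne h :=
    congrArg Bimod.Hom.hom ((Decomp.ofBiproduct (Y := fun s : H => β.L s)).inj_proj_ne h)
  total := by
    have := congrArg Bimod.Hom.hom (Decomp.ofBiproduct (Y := fun s : H => β.L s)).total
    rw [bimod_sum_hom] at this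
    exact this

variable {H}

theorem QDecomp_proj_scaledIso {s s' u : H} (h : s = u) (h' : s' = u) {c c' : kˣ} (hc : c = c') :
    (β.QDecomp H).proj s ≫ (β.scaledIso c h).hom =
      (β.QDecomp H).proj s' ≫ (β.scaledIso c' h').hom := by
  subst h h' hc
  rfl

/-- The embedding of `Q(H)` into the matrix algebra that belongs to a trivialisation. -/
def QEmbed : (Q β H).X ⟶ X :=
  ∑ p : H × H, ((β.QDecomp H).proj (p.1 * p.2⁻¹) ≫
    -- For `t = ω` this is the matrix whose entries depend only on `ij⁻¹`. The factor is the one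
    -- forced by invariance under the modified translations once the column with label `1` is
    -- prescribed.
    (β.scaledIso (ω.ratio t (p.1 * p.2⁻¹) p.2) rfl).hom) ≫ a.inj p

theorem QEmbed_proj (i l : H) : β.QEmbed hA hψ ω t a ≫ a.proj (i, l) =
    (β.QDecomp H).proj (i * l⁻¹) ≫ (β.scaledIso (ω.ratio t (i * l⁻¹) l) rfl).hom :=
  a.sum_proj _ (i, l)

theorem QEmbed_matAut (x : H) : β.QEmbed hA hψ ω t a ≫ (β.matAut hA hψ ω t a x).hom =
    β.QEmbed hA hψ ω t a := by
  refine a.hom_ext_proj fun ⟨i, l⟩ => ?_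
  rw [Category.assoc, matAut_proj, reassoc_of% QEmbed_proj, QEmbed_proj, translate, scaledIso_trans]
  refine β.QDecomp_proj_scaledIso _ _ ?_
  -- With `s = il⁻¹`, invariance of the entry `(i, l)` is `κ(l,x) κ(s,lx) = κ(i,x) κ(s,l)`, the
  -- cocycle identity for `(s, l, x)`.
  have e := ω.ratio_cocycle t (i * l⁻¹) l x
  rw [inv_mul_cancel_right] at e
  rw [show i * x * (l * x)⁻¹ = i * l⁻¹ by group, ← mul_div_assoc, _root_.mul_comm, e,
    mul_div_cancel_left]

/-- Since `κ(s,1) = 1`, the column with label `1` contains the components of `Q(H)` unchanged. This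
makes the embedding a monomorphism. -/
theorem QEmbed_proj_one (s : H) : β.QEmbed hA hψ ω t a ≫ a.proj (s, 1) ≫
    (β.scaledIso (1 : kˣ) (show s * 1⁻¹ = s by group)).hom = (β.QDecomp H).proj s := by
  rw [reassoc_of% QEmbed_proj, scaledIso_trans, β.QDecomp_proj_scaledIso _ rfl (c' := 1) (by simp),
    scaledIso_one_refl, Category.comp_id]

instance : Mono (β.QEmbed hA hψ ω t a) where
  right_cancellation f g h := (β.QDecomp H).hom_ext_proj fun s => by
    rw [← β.QEmbed_proj_one hA hψ ω t a, reassoc_of% h]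

/-- Morphisms fixed by the automorphisms factor through `Q(H)`. -/
theorem exists_lift_QEmbed {B : C} (f : B ⟶ X)
    (hf : ∀ x, f ≫ (β.matAut hA hψ ω t a x).hom = f) :
    ∃ f' : B ⟶ (Q β H).X, f' ≫ β.QEmbed hA hψ ω t a = f := by
  -- The lift is the column with label `1` of the fixed matrix.
  refine ⟨∑ s : H, (f ≫ a.proj (s, 1) ≫
    (β.scaledIso (1 : kˣ) (show s * 1⁻¹ = s by group)).hom) ≫ (β.QDecomp H).inj s,
    a.hom_ext_proj fun ⟨i, l⟩ => ?_⟩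
  have h₁ : a.proj (i * l⁻¹ * l, 1 * l) = a.proj (i, l) ≫
      (β.scaledIso (1 : kˣ) (by group)).hom :=
    β.matrix_proj_eq hA hψ ω a (inv_mul_cancel_right i l).symm (_root_.one_mul l).symm
  rw [Category.assoc, QEmbed_proj, ← Category.assoc, (β.QDecomp H).sum_proj, Category.assoc,
    Category.assoc, scaledIso_trans]
  -- Invariance under `l` expresses the entry `(il⁻¹, 1)` through the entry `(i, l)`, with factor
  -- `κ(1,l)/κ(il⁻¹,l)`. This cancels the factor of the embedding.
  nth_rw 1 [← hf l]
  rw [Category.assoc, reassoc_of% matAut_proj, h₁, translate, Category.assoc]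
  refine congrArg (f ≫ ·) ?_
  refine Eq.trans (congrArg (a.proj (i, l) ≫ ·) ?_) (Category.comp_id (a.proj (i, l)))
  rw [scaledIso_trans, scaledIso_trans]
  refine Eq.trans ?_ (β.scaledIso_one_refl (k := k) _)
  congr 2
  simp

end PicBasis

end PicFrobenius

/-! ## The fixed algebra -/

section PicFrobenius

variable {C : Type u} [Category.{v} C] [MonoidalCategory C] [HasCoequalizers C]
  [∀ X : C, PreservesColimitsOfSize.{0, 0} (tensorLeft X)]
  [∀ X : C, PreservesColimitsOfSize.{0, 0} (tensorRight X)]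
  [Preadditive C] [MonoidalPreadditive C] {k : Type w} [Field k] [Linear k C]
  [MonoidalLinear k C]

theorem tensorProj_tensorHom {A : Mon C} {M M' N N' : Bimod A A} (f : M ⟶ M') (g : N ⟶ N') :
    tensorProj M N ≫ (f ⊗ₘ g).hom = (f.hom ⊗ₘ g.hom) ≫ tensorProj M' N' := by
  refine ((reassoc_of% tensorProj_whiskerRight f N) (Bimod.whiskerLeft M' g).hom).trans ?_
  rw [tensorProj_whiskerLeft, ← Category.assoc, ← MonoidalCategory.tensorHom_def]

namespace PicBasis

variable {A : Frobenius C} (β : PicBasis A.alg) {H : Subgroup (Pic A.alg)}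
  {βA β1 : k} (hA : A.IsSpecialWith βA β1) {ψ : Pic A.alg → Pic A.alg → Pic A.alg → kˣ}
  (hψ : β.DescribesAssociator ψ) (ω t : Trivialisation ψ H)

variable [Fintype H] {X : C} (a : (β.frobeniusCategory hA hψ ω).MatrixObj X (id : H → H) id)

variable [HasFiniteProducts C]

theorem transportMul_Qmul (ω : H → H → kˣ) : transportMul (Qmul β H ω) =
    ∑ s : H, ∑ t : H, ((β.QDecomp H).proj s ⊗ₘ (β.QDecomp H).proj t) ≫
      β.mul ω s t (s * t) rfl ≫ (β.QDecomp H).inj (s * t) := by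
  have key : ∀ s t : H, tensorProj (Q β H) (Q β H) ≫
      ((Qπ β H s ⊗ₘ Qπ β H t) ≫ (β.b s t).hom ≫ Qι β H (s * t)).hom =
      ((β.QDecomp H).proj s ⊗ₘ (β.QDecomp H).proj t) ≫ tensorProj (β.L s) (β.L t) ≫
        (β.tensorIso s t (s * t) rfl).hom.hom ≫ (β.QDecomp H).inj (s * t) := fun s t => by
    have e : (β.tensorIso s t (s * t) rfl).hom = (β.b s t).hom := Category.comp_id _
    rw [e]
    exact (reassoc_of% tensorProj_tensorHom (Qπ β H s) (Qπ β H t))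
      ((β.b s t).hom ≫ Qι β H (s * t)).hom
  rw [transportMul, Qmul, bimod_sum_hom, Preadditive.comp_sum]
  refine Finset.sum_congr rfl fun s _ => ?_
  rw [bimod_sum_hom, Preadditive.comp_sum]
  refine Finset.sum_congr rfl fun t _ => ?_
  rw [bimod_smul_hom, Linear.comp_smul, key, mul, Linear.smul_comp, Linear.comp_smul,
    Category.assoc]

/-- The pairs of group elements with product `il⁻¹` are written as `(ij⁻¹, jl⁻¹)`. In this form the
product of `Q(H, ω)` is already a sum over a middle matrix index. -/
theorem transportMul_Qmul_proj (ω : H → H → kˣ) (i l : H) :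
    transportMul (Qmul β H ω) ≫ (β.QDecomp H).proj (i * l⁻¹) =
      ∑ j : H, ((β.QDecomp H).proj (i * j⁻¹) ⊗ₘ (β.QDecomp H).proj (j * l⁻¹)) ≫
        β.mul ω (i * j⁻¹) (j * l⁻¹) (i * l⁻¹) (by group) := by
  have key : ∀ s t u (h : s * t = u), ∑ t' : H, (((β.QDecomp H).proj s ⊗ₘ (β.QDecomp H).proj t') ≫
      β.mul ω s t' (s * t') rfl ≫ (β.QDecomp H).inj (s * t')) ≫ (β.QDecomp H).proj u =
      ((β.QDecomp H).proj s ⊗ₘ (β.QDecomp H).proj t) ≫ β.mul ω s t u h := fun s t u h => by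
    classical
    subst h
    rw [Finset.sum_eq_single t]
    · simp
    · intro t' _ ht
      rw [Category.assoc, Category.assoc,
        (β.QDecomp H).inj_proj_ne (fun e => ht (mul_left_cancel e))]
      simp
    · simp
  rw [transportMul_Qmul, Preadditive.sum_comp,
    ← ((Equiv.inv H).trans (Equiv.mulLeft i)).sum_comp]
  refine Finset.sum_congr rfl fun j _ => ?_
  rw [Preadditive.sum_comp]
  exact key (i * j⁻¹) (j * l⁻¹) (i * l⁻¹) (by group)

theorem transportMul_QEmbed : transportMul (Qmul β H t.ω) ≫ β.QEmbed hA hψ ω t a =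
    (β.QEmbed hA hψ ω t a ⊗ₘ β.QEmbed hA hψ ω t a) ≫ FrobeniusCategory.matMul a a a := by
  refine a.hom_ext_proj fun ⟨i, l⟩ => ?_
  rw [Category.assoc, Category.assoc, QEmbed_proj, FrobeniusCategory.matMul_proj,
    reassoc_of% transportMul_Qmul_proj, Preadditive.sum_comp, Preadditive.comp_sum]
  refine Finset.sum_congr rfl fun j _ => ?_
  rw [tensorHom_comp_tensorHom_assoc, QEmbed_proj, QEmbed_proj, ← tensorHom_comp_tensorHom_assoc,
    Category.assoc]
  refine congrArg _ ?_
  -- The entries contribute `κ(ij⁻¹,j) κ(jl⁻¹,l)`; the cocycle identity turns this into `κ(il⁻¹,l)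
  -- κ(ij⁻¹,jl⁻¹)`. The second factor converts the product with `ω` into the product with `t`.
  have e := ω.ratio_cocycle t (i * j⁻¹) (j * l⁻¹) l
  have hs : i * j⁻¹ * (j * l⁻¹) = i * l⁻¹ := by group
  rw [hs, inv_mul_cancel_right] at e
  refine Eq.trans ?_ (β.scaledIso_mul ω.ω rfl rfl rfl hs hs
    (a := ω.ratio t (i * j⁻¹) j) (b := ω.ratio t (j * l⁻¹) l) rfl).symm
  rw [β.mul_eq_smul ω.ω t.ω]
  simp only [scaledIso, castObjIso_refl, smulIso_hom, Iso.refl_hom, Linear.comp_smul,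
    Category.comp_id, smul_smul, ← Units.val_mul]
  congr 2
  rw [_root_.mul_comm (ω.ratio t (i * j⁻¹) j), e]
  rfl

theorem transportOne_QEmbed : transportOne (Qone β H) ≫ β.QEmbed hA hψ ω t a =
    FrobeniusCategory.matOne a := by
  have e : transportOne (Qone β H) = η[A.alg.X] ≫ (β.unitObjIso 1 rfl).inv ≫
      (β.QDecomp H).inj 1 :=
    congrArg (fun f => η[A.alg.X] ≫ f.hom ≫ (β.QDecomp H).inj 1)
      (Category.comp_id β.unitIso.inv).symm
  have key : ∀ (s : H) (hs : s = 1), transportOne (Qone β H) ≫ (β.QDecomp H).proj s =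
      η[A.alg.X] ≫ (β.unitObjIso s hs).inv := fun s hs => by
    subst hs
    simp [e]
  have key' : ∀ (s : H) (hs : s ≠ 1), transportOne (Qone β H) ≫ (β.QDecomp H).proj s = 0 := fun s hs => by
    rw [e, Category.assoc, Category.assoc, (β.QDecomp H).inj_proj_ne hs.symm, comp_zero, comp_zero]
  classical
  refine a.hom_ext_proj fun ⟨i, l⟩ => ?_
  rw [Category.assoc, QEmbed_proj, FrobeniusCategory.matOne, Preadditive.sum_comp]
  by_cases h : i = l
  · subst h
    rw [← Category.assoc, key _ (mul_inv_cancel i), Finset.sum_eq_single i, Category.assoc,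
      Category.assoc, a.inj_proj_self, Category.comp_id]
    · exact congrArg _ (β.unitObjIso_inv_scaledIso (by simp) _ _ _)
    · intro j _ hj
      rw [Category.assoc, a.inj_proj_ne (by simp [hj]), comp_zero]
    · simp
  · rw [← Category.assoc, key' _ (by rwa [Ne, mul_inv_eq_one]), zero_comp, Finset.sum_eq_zero]
    intro j _
    rw [Category.assoc, a.inj_proj_ne, comp_zero]
    rintro e
    simp only [Prod.mk.injEq] at e
    exact h (e.1.symm.trans e.2)

end PicBasis

end PicFrobenius

/-! ### The algebra `Q(H, t)` in `C` and its universal property -/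

section PicFrobenius

variable {C : Type u} [Category.{v} C] [MonoidalCategory C] [HasCoequalizers C]
  [∀ X : C, PreservesColimitsOfSize.{0, 0} (tensorLeft X)]
  [∀ X : C, PreservesColimitsOfSize.{0, 0} (tensorRight X)]
  [Preadditive C] [MonoidalPreadditive C] {k : Type w} [Field k] [Linear k C]
  [MonoidalLinear k C]

namespace PicBasis

variable {A : Frobenius C} (β : PicBasis A.alg) {H : Subgroup (Pic A.alg)}
  {βA β1 : k} (hA : A.IsSpecialWith βA β1) {ψ : Pic A.alg → Pic A.alg → Pic A.alg → kˣ}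
  (hψ : β.DescribesAssociator ψ) (ω t : Trivialisation ψ H)

variable [Fintype H] {X : C} (a : (β.frobeniusCategory hA hψ ω).MatrixObj X (id : H → H) id)

variable [HasFiniteProducts C]

/-- The algebra `Q(H, t)`, as an algebra in `C`. -/
def QMon : Mon C :=
  letI := FrobeniusCategory.matMonObj a
  -- The unit laws and associativity are inherited from the matrix algebra along the monomorphism.
  letI := monObjOfMono (β.QEmbed hA hψ ω t a) _ _ (β.transportMul_QEmbed hA hψ ω t a)
    (β.transportOne_QEmbed hA hψ ω t a)
  ⟨(Q β H).X⟩

/-- The algebra `Q(H, t)` is the fixed algebra of the matrix algebra. -/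
theorem isFixedAlgebra_QMon : IsFixedAlgebra (FrobeniusCategory.matFrobenius a)
    (β.matAutHom hA hψ ω t a).range (β.QMon hA hψ ω t a) (β.QEmbed hA hψ ω t a) where
  mono := inferInstanceAs (Mono (β.QEmbed hA hψ ω t a))
  fixed := by
    rintro _ ⟨x, rfl⟩
    exact β.QEmbed_matAut hA hψ ω t a x
  existsUnique_lift f hf := by
    obtain ⟨f', h⟩ := β.exists_lift_QEmbed hA hψ ω t a f fun x => hf _ ⟨x, rfl⟩
    exact ⟨f', h, fun g hg => (cancel_mono (β.QEmbed hA hψ ω t a)).1 (hg.trans h.symm)⟩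
  isMonHom := ⟨β.transportOne_QEmbed hA hψ ω t a, β.transportMul_QEmbed hA hψ ω t a⟩

theorem isAlgebraIso_QMon : IsAlgebraIso (β.QMon hA hψ ω t a) (transportMul (Qmul β H t.ω))
    (transportOne (Qone β H)) := by
  refine ⟨Iso.refl _, (Category.comp_id _).trans ?_, Category.comp_id _⟩
  exact ((congrArg (· ≫ transportMul (Qmul β H t.ω)) (id_tensorHom_id _ _)).trans
    (Category.id_comp _)).symm

end PicBasis

end PicFrobenius

/-- The bimodules of dimension one over a special Frobenius algebra are nonzero. -/
theorem id_ne_zero_of_hasRightDim {C : Type u} [Category.{v} C] [MonoidalCategory C] [Sovereign C]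
    [HasCoequalizers C] [Preadditive C] [MonoidalPreadditive C] {k : Type w} [Field k] [Linear k C]
    {A : Frobenius C} {βA β1 : k} (hA : A.IsSpecialWith βA β1) (h₁ : 𝟙 (𝟙_ C) ≠ 0)
    {M : Bimod A.alg A.alg} (hM : HasRightDim βA M (1 : k)) : 𝟙 M.X ≠ 0 := by
  intro h
  have h' := partialTrace_actLeft hA.betaA_ne_zero hM
  have h₀ : M.actLeft = 0 := by rw [← Category.comp_id M.actLeft, h, comp_zero]
  -- If `M` were zero, the trace of the action, which is `βA ε`, would vanish; but `ε ∘ η` is a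
  -- nonzero multiple of the identity.
  have hε : ε[A.alg.X] = 0 := by
    have : βA • ε[A.alg.X] = 0 := by
      rw [← _root_.mul_one βA, ← h', h₀, partialTrace]
      simp
    exact (smul_eq_zero.1 this).resolve_left hA.betaA_ne_zero
  have h₂ := hA.one_counit
  rw [hε, comp_zero] at h₂
  exact h₁ ((smul_eq_zero.1 h₂.symm).resolve_left hA.beta1_ne_zero)

end RosenbergZelinsky

end

/-! ### Assembly of the main theorem -/

theorem mainTheorem1 {k : Type w} [Field k] [CharZero k]
    {C : Type u} [Category.{v} C] [MonoidalCategory C] [Sovereign C] [Abelian C]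
    [Linear k C] [MonoidalPreadditive C] [MonoidalLinear k C]
    [∀ X Y : C, FiniteDimensional k (X ⟶ Y)]
    (h_unit_simple : Simple (𝟙_ C))
    (h_unit_abs_simple : ∀ f : 𝟙_ C ⟶ 𝟙_ C, ∃ c : k, f = c • 𝟙 (𝟙_ C))
    (A : Frobenius C) (hA_symm : A.IsSymmetric)
    (βA β1 : k) (hA_special : A.IsSpecialWith βA β1)
    (hA_simple : Simple (Bimod.regular A.alg))
    (hA_abs_simple : ∀ f : Bimod.regular A.alg ⟶ Bimod.regular A.alg,
      ∃ c : k, f = c • 𝟙 (Bimod.regular A.alg))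
    (β : PicBasis A.alg)
    (ψ : Pic A.alg → Pic A.alg →
      Pic A.alg → kˣ)
    (hψ : β.DescribesAssociator ψ)
    (H : Subgroup (Pic A.alg)) [Fintype H]
    (hH : IsAdmissible A βA β ψ H) :
    ∃ (A' : Frobenius C) (_ : A'.IsSymmetric) (_ : A'.IsSpecial k)
      (c : MoritaContext A.alg A'.alg)
      (α : Trivialisation ψ H → (H →* A'.autGroup)),
      Function.Injective α ∧
      ∀ t : Trivialisation ψ H,
        Function.Injective (α t) ∧
        (∀ h : H, c.classMap (twistClass A' (α t h)) =
          ((h : Pic A.alg) : Skeleton (Bimod A.alg A.alg))) ∧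
        ∃ (F : Mon C) (j : F.X ⟶ A'.alg.X),
          IsFixedAlgebra A' (α t).range F j ∧
          IsAlgebraIso F
            (transportMul (Qmul β H t.ω))
            (transportOne (Qone β H)) := by
  classical
  have : HasFiniteBiproducts C := HasFiniteBiproducts.of_hasFiniteProducts
  -- This trivialisation is only a base point: `A'` and the Morita context are built from it and
  -- then serve every trivialisation `t`.
  obtain ⟨ω⟩ := hH.exists_trivialisation
  let F := β.frobeniusCategory hA_special hψ ω
  let a : F.MatrixObj (⨁ fun p : H × H => F.Y (id p.1) (id p.2)) id id := Decomp.ofBiproduct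
  let p : F.MatrixObj (⨁ fun p : Unit × H => F.Y 1 (id p.2)) (fun _ => 1) id :=
    Decomp.ofBiproduct
  -- The column is needed for every label: `1` for the Morita context, and `x⁻¹` for the class of
  -- the automorphism of `x`.
  let q (l : H) : F.MatrixObj (⨁ fun p : H × Unit => F.Y (id p.1) l) id (fun _ => l) :=
    Decomp.ofBiproduct
  have hc : (Fintype.card H : k) ≠ 0 := Nat.cast_ne_zero.2 Fintype.card_ne_zero
  have hb := mul_ne_zero hc hA_special.betaA_ne_zero
  have hclass := fun t x =>
    β.classMap_twistClass hA_special hψ ω t a p (q 1) x (q x⁻¹)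
  refine ⟨FrobeniusCategory.matFrobenius a,
    FrobeniusCategory.matFrobenius_isSymmetric a
      (β.partialTrace_frobeniusCategory_mul hA_special hψ ω hH.rightDim) hb,
    ⟨_, _, FrobeniusCategory.matFrobenius_isSpecialWith a
      (β.frobeniusCategory_one_counit hA_special hψ ω) hb
        (mul_ne_zero hc hA_special.beta1_ne_zero)⟩,
    β.moritaContext hA_special hψ ω a p (q 1), fun t => β.matAutHom hA_special hψ ω t a,
    β.matAutHom_injective hA_special hψ ω a fun s =>
      id_ne_zero_of_hasRightDim hA_special (id_nonzero _) (hH.rightDim s), fun t => ⟨?_, hclass t,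
        β.QMon hA_special hψ ω t a, β.QEmbed hA_special hψ ω t a,
        β.isFixedAlgebra_QMon hA_special hψ ω t a, β.isAlgebraIso_QMon hA_special hψ ω t a⟩⟩
  -- Each `α t` is injective because the class map, composed with the class of the twisted bimodule,
  -- is a left inverse.
  intro x y hxy
  refine Subtype.ext (Units.ext ?_)
  rw [← hclass t x, hxy, hclass t y]
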